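/- **Conventions.** Let $R$ be a commutative domain with fraction field $F$. A *weighted permutation matrix* is a square matrix over $F$ with at most one nonzero element in each row and each column. For such a matrix $S$: - $S^{\to 1}$ is obtained by replacing every nonzero element by $1$; - $\bar S$ is the $0$–$1$ matrix whose block at the intersection of the zero rows and the zero columns of $S$ is the unit block (the $\nu$-th zero row meets the $\nu$-th zero column in a $1$), all other elements being $0$; - $S^{+}$ is the transpose of $S$ with every nonzero element inverted; - with $E=S^{\to1}$ we put $I_S=EE^T$, $J_S=E^TE$, $\bar I_S=\mathbf I-I_S$, $\bar J_S=\mathbf I-J_S$, and for $\lambda\in F^*$, $I_S^{\lambda}=\lambda I_S+\bar I_S$, $J_S^{\lambda}=\lambda J_S+\bar J_S$. A minor of a matrix is the determinant of a square submatrix formed by distinct rows and distinct columns listed in some order (so it is taken up to sign when its size is at least $2$); the empty minor is $1$. **The procedure.** For $A\in F^{n\times n}$, $n=2^p$, $\alpha\in F^*$, the procedure $(L,S,U,M,\widehat S,W,\alpha_r)=\mathbf{LSU}(A,\alpha)$ is defined recursively. (1) If $A=0$: $L=U=\mathbf I$, $S=0$, $M=W=\alpha\mathbf I$, $\widehat S=\alpha^{-1}\mathbf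 I$, $\alpha_r=\alpha$. (2) If $n=1$ and $A=[a]$ with $a\neq0$: $L=U=M=W=[a]$, $S=[(\alpha a)^{-1}]$, $\widehat S=[a^{-2}]$, $\alpha_r=a$. (3) If $n\ge2$ and $A\ne0$, split $A$ into four equal blocks $A_{ij}$. The output of a call with index $ij$ is denoted $L_{ij},S_{ij},U_{ij},M_{ij},\widehat S_{ij},W_{ij}$, and $I_{ij},J_{ij},\bar S_{ij},E_{ij}$ are $I_S,J_S,\bar S,S^{\to1}$ for $S=S_{ij}$. Compute, in this order: - $\mathbf{LSU}(A_{11},\alpha)$, with last output $\alpha_k$; $A_{12}^0=M_{11}A_{12}$, $A_{12}^1=\alpha_k\widehat S_{11}A_{12}^0$, $A_{12}^2=\bar S_{11}A_{12}^0/\alpha$, $A_{21}^0=A_{21}W_{11}$, $A_{21}^1=\alpha_kA_{21}^0\widehat S_{11}$, $A_{21}^2=A_{21}^0\bar S_{11}/\alpha$; - $\mathbf{LSU}(A_{21}^2,\alpha_k)$ (index $21$), with last output $\alpha_l$, and $\mathbf{LSU}(A_{12}^2,\alpha_k)$ (index $12$), with last output $\alpha_m$; $\lambda=\alpha_l/\alpha_k$,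 $\alpha_s=\lambda\alpha_m$; - $A_{22}^0=A_{21}^1S_{11}^+A_{12}^1$, $A_{22}^1=(\alpha\alpha_k^2A_{22}-A_{22}^0)/(\alpha\alpha_k)$, $A_{22}^3=\bar S_{21}M_{21}A_{22}^1W_{12}\bar S_{12}/(\alpha_k^2\alpha)$; - $\mathbf{LSU}(A_{22}^3,\alpha_s)$ (index $22$), with last output $\alpha_r$; - $U_2=J_{11}M_{11}A_{12}/\alpha_k+J_{21}M_{21}A_{22}^1/(\alpha_l\alpha)$, $\;L_3=A_{21}W_{11}I_{11}/\alpha_k+\bar S_{21}M_{21}A_{22}^1W_{12}I_{12}/(\alpha_m\alpha_k\alpha)$. The output consists of $\alpha_r$, $$L=\begin{bmatrix}L_{11}L_{12}I_{12}^{\lambda}&0\\L_3&L_{21}L_{22}\end{bmatrix},\quad S=\begin{bmatrix}S_{11}&\lambda^{-2}S_{12}\\S_{21}&S_{22}\end{bmatrix},\quad U=\begin{bmatrix}U_{21}U_{11}&U_2\\0&U_{22}J_{12}^{\lambda}U_{12}\end{bmatrix},\quad \widehat S=\alpha_r^{-1}(\alpha S+\bar S),$$ $$M=\frac1\alpha\begin{bmatrix}E'_{11}\bar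 S_{12}M_{12}S'_{11}M_{11}&E'_{12}\bar S_{22}M_{22}S'_{21}M_{21}\\E'_{21}S'_{12}M_{12}\bar S_{11}M_{11}&E'_{22}S'_{22}M_{22}\bar S_{21}M_{21}\end{bmatrix}\begin{bmatrix}\frac{\alpha_r}{\alpha_m\alpha_k}\mathbf I&0\\-\frac1{\alpha_l}L_3'&\frac1{\alpha_l}\mathbf I\end{bmatrix},$$ $$W=\frac1\alpha\begin{bmatrix}\frac{\alpha_r}{\alpha_k\alpha_l}\mathbf I&-\frac1{\alpha_m}U_2'\\0&\frac1{\alpha_m}\mathbf I\end{bmatrix}\begin{bmatrix}W_{11}S'_{11}W_{21}\bar S_{21}E'_{11}&W_{11}\bar S_{11}W_{21}S'_{21}E'_{12}\\W_{12}S'_{12}W_{22}\bar S_{22}E'_{21}&W_{12}\bar S_{12}W_{22}S'_{22}E'_{22}\end{bmatrix},$$ where $L_3'=L_3I_{12}^{\lambda^{-1}}\widehat S_{12}M_{12}\widehat S_{11}M_{11}$, $U_2'=W_{11}\widehat S_{11}W_{21}\widehat S_{21}U_2$, the $E'_{ij}$ are the blocks of $(S^{\to1}+\bar S)^T$, and $S'_{11}=\alpha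 E_{11}+\alpha\bar S_{11}$, $S'_{21}=\alpha_kE_{21}+\alpha\bar S_{21}$, $S'_{12}=\alpha_lE_{12}+\alpha\bar S_{12}$, $S'_{22}=\alpha_sE_{22}+\alpha\bar S_{22}$. **Theorem.** Let $k,p\ge0$, $n=2^p$, let $\mathcal M$ be a $(k+n)\times(k+n)$ matrix over $R$ whose upper left $k\times k$ block has determinant $\alpha\ne0$ ($\alpha=1$ if $k=0$), and let $A=(a_{ij})\in R^{n\times n}$ be the matrix of surrounding minors of this block: $a_{ij}$ is the determinant of the block bordered by row $k+i$ and column $k+j$ of $\mathcal M$. (For $k=0$: $\alpha=1$ and $A=\mathcal M$ is an arbitrary $n\times n$ matrix over $R$.) Let $r$ be the rank of $A$ over $F$ and $(L,S,U,M,\widehat S,W,\alpha_r)=\mathbf{LSU}(A,\alpha)$. Then: 1. $L$ and $U$ have entries in $R$ and rank $n$; $L$ is lower triangular, $U$ is upper triangular; every entry of $L$ on or below the diagonal and every entry of $U$ on or above the diagonal is a minor of $\mathcal M$ (hence of $A$, if $k=0$); and $L\bar I_S=\bar I_S$, $\bar J_SU=\bar J_S$. 2. $S$ is a weighted permutation matrix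 of rank $r$. There are distinct rows $i_1,\dots,i_r$ and distinct columns $j_1,\dots,j_r$ such that the nested minors $\det_t$ ($0\le t\le r$), the determinants of the upper left $k\times k$ block of $\mathcal M$ bordered by the rows $k+i_1,\dots,k+i_t$ and the columns $k+j_1,\dots,k+j_t$ in this order, are nonzero, $\det_0=\alpha$, $\alpha_r=\det_r$, and the nonzero elements of $S$ are exactly $(\det_{t-1}\det_t)^{-1}$ at the positions $(i_t,j_t)$, $1\le t\le r$; that is, they are $(\alpha\det_1)^{-1},(\det_1\det_2)^{-1},\dots,(\det_{r-1}\det_r)^{-1}$. 3. $\widehat S=\alpha_r^{-1}(\alpha S+\bar S)$; $M$ and $W$ have rank $n$, and $\alpha M$, $\alpha W$ have entries in $R$ (so $M,W\in R^{n\times n}$ if $\alpha=1$). 4. $\alpha LSU=A$, $\;L\widehat SM=\mathbf I$, $\;W\widehat SU=\mathbf I$. -/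

import Mathlib

namespace LSUFactorization

noncomputable section

open Matrix

/-! Weighted permutation matrices and the mappings on them. -/

section WeightedPermutations

variable {F : Type*} [Field F] {n : ℕ}

/-- At most one nonzero element in each row and in each column. -/
def IsWeightedPermutation (S : Matrix (Fin n) (Fin n) F) : Prop :=
  (∀ i j j', S i j ≠ 0 → S i j' ≠ 0 → j = j') ∧ (∀ i i' j, S i j ≠ 0 → S i' j ≠ 0 → i = i')

open Classical in
/-- The unit mapping: all nonzero elements are replaced by `1`. -/
def unitMap (S : Matrix (Fin n) (Fin n) F) : Matrix (Fin n) (Fin n) F :=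
  Matrix.of fun i j => if S i j = 0 then 0 else 1

/-- The row `i` of `S` is zero. -/
def ZeroRow (S : Matrix (Fin n) (Fin n) F) (i : Fin n) : Prop := ∀ j, S i j = 0

/-- The column `j` of `S` is zero. -/
def ZeroCol (S : Matrix (Fin n) (Fin n) F) (j : Fin n) : Prop := ∀ i, S i j = 0

open Classical in
/-- The complementary mapping `S̄ = S^Ext - S`: the block at the intersection of the zero rows and
the zero columns of `S` is the unit block (the first zero row meets the first zero column in a `1`,
the second zero row the second zero column, and so on), and all other elements are `0`. -/
def compl (S : Matrix (Fin n) (Fin n) F) : Matrix (Fin n) (Fin n) F :=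
  Matrix.of fun i j =>
    if ZeroRow S i ∧ ZeroCol S j ∧
      (Finset.univ.filter fun a => a < i ∧ ZeroRow S a).card =
        (Finset.univ.filter fun b => b < j ∧ ZeroCol S b).card then 1 else 0

/-- The Moore-Penrose inverse of a weighted permutation matrix: transpose, and invert the nonzero
elements (here `0⁻¹ = 0`). -/
def pinv (S : Matrix (Fin n) (Fin n) F) : Matrix (Fin n) (Fin n) F :=
  Matrix.of fun i j => (S j i)⁻¹

/-- `I = E Eᵀ` with `E` the unit mapping of `S`: the diagonal 0-1 matrix of the nonzero rows. -/
def rowProj (S : Matrix (Fin n) (Fin n) F) : Matrix (Fin n) (Fin n) F :=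
  unitMap S * (unitMap S)ᵀ

/-- `J = Eᵀ E` with `E` the unit mapping of `S`: the diagonal 0-1 matrix of the nonzero columns. -/
def colProj (S : Matrix (Fin n) (Fin n) F) : Matrix (Fin n) (Fin n) F :=
  (unitMap S)ᵀ * unitMap S

end WeightedPermutations

/-! Minors. -/

section Minors

variable {R : Type*} [CommRing R]

/-- `x` is a minor of `M` (of any size, the empty minor being `1`): the determinant of a square
submatrix whose distinct rows and distinct columns are listed in some order. -/
def IsMinor {m : Type*} (M : Matrix m m R) (x : R) : Prop :=
  ∃ (t : ℕ) (r c : Fin t → m), Function.Injective r ∧ Function.Injective c ∧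
    x = (M.submatrix r c).det

/-- The minor of `M` that is formed by its upper left `k × k` block, bordered by the further rows
`r 0, r 1, …` and the further columns `c 0, c 1, …`. -/
def borderedMinor {k n : ℕ} (M : Matrix (Fin k ⊕ Fin n) (Fin k ⊕ Fin n) R) {t : ℕ}
    (r c : Fin t → Fin n) : R :=
  (M.submatrix (Sum.map id r) (Sum.map id c)).det

end Minors

/-! The recursive algorithm. -/

section Algorithm

variable {F : Type*} [Field F]

/-- The two halves of the index set of size `2 ^ (p + 1)`. -/
def halves (p : ℕ) : Fin (2 ^ p) ⊕ Fin (2 ^ p) ≃ Fin (2 ^ (p + 1)) :=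
  finSumFinEquiv.trans (finCongr (by rw [pow_succ, mul_two]))

/-- The square blocks of a matrix of size `2 ^ (p + 1)`, as a matrix over the two halves. -/
def split {p : ℕ} (A : Matrix (Fin (2 ^ (p + 1))) (Fin (2 ^ (p + 1))) F) :
    Matrix (Fin (2 ^ p) ⊕ Fin (2 ^ p)) (Fin (2 ^ p) ⊕ Fin (2 ^ p)) F :=
  A.submatrix (halves p) (halves p)

/-- The matrix of size `2 ^ (p + 1)` with given square blocks. -/
def glue {p : ℕ} (A₁₁ A₁₂ A₂₁ A₂₂ : Matrix (Fin (2 ^ p)) (Fin (2 ^ p)) F) :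
    Matrix (Fin (2 ^ (p + 1))) (Fin (2 ^ (p + 1))) F :=
  (fromBlocks A₁₁ A₁₂ A₂₁ A₂₂).submatrix (halves p).symm (halves p).symm

/-- The data returned by the algorithm: `L`, `S`, `U`, `M`, `Ŝ`, `W` and the number `α_r`. -/
structure Output (F : Type*) (n : ℕ) where
  L : Matrix (Fin n) (Fin n) F
  S : Matrix (Fin n) (Fin n) F
  U : Matrix (Fin n) (Fin n) F
  M : Matrix (Fin n) (Fin n) F
  Shat : Matrix (Fin n) (Fin n) F
  W : Matrix (Fin n) (Fin n) F
  αr : F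

/-- Zero case of the algorithm: `A = 0`. -/
def zeroOutput (n : ℕ) (α : F) : Output F n where
  L := 1
  S := 0
  U := 1
  M := α • (1 : Matrix (Fin n) (Fin n) F)
  Shat := α⁻¹ • (1 : Matrix (Fin n) (Fin n) F)
  W := α • (1 : Matrix (Fin n) (Fin n) F)
  αr := α

/-- Nonzero case of size one: `A = [a]`, `a ≠ 0`. -/
def oneOutput (n : ℕ) (a α : F) : Output F n where
  L := Matrix.of fun _ _ => a
  S := Matrix.of fun _ _ => (α * a)⁻¹
  U := Matrix.of fun _ _ => a
  M := Matrix.of fun _ _ => a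
  Shat := Matrix.of fun _ _ => (a ^ 2)⁻¹
  W := Matrix.of fun _ _ => a
  αr := a

/-- Nonzero case of size at least two: the four calls of the procedure `rec` on matrices of half the size,
and the assembly of their results. -/
def blockStep {p : ℕ} (rec : Matrix (Fin (2 ^ p)) (Fin (2 ^ p)) F → F → Output F (2 ^ p))
    (A : Matrix (Fin (2 ^ (p + 1))) (Fin (2 ^ (p + 1))) F) (α : F) : Output F (2 ^ (p + 1)) :=
  let A₁₁ := (split A).toBlocks₁₁
  let A₁₂ := (split A).toBlocks₁₂
  let A₂₁ := (split A).toBlocks₂₁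
  let A₂₂ := (split A).toBlocks₂₂
  let o₁₁ := rec A₁₁ α
  let αk := o₁₁.αr
  let A₁₂0 := o₁₁.M * A₁₂
  let A₁₂1 := αk • (o₁₁.Shat * A₁₂0)
  let A₁₂2 := α⁻¹ • (compl o₁₁.S * A₁₂0)
  let A₂₁0 := A₂₁ * o₁₁.W
  let A₂₁1 := αk • (A₂₁0 * o₁₁.Shat)
  let A₂₁2 := α⁻¹ • (A₂₁0 * compl o₁₁.S)
  let o₂₁ := rec A₂₁2 αk
  let αl := o₂₁.αr
  let o₁₂ := rec A₁₂2 αk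
  let αm := o₁₂.αr
  let lam := αl / αk
  let αs := lam * αm
  let A₂₂0 := A₂₁1 * pinv o₁₁.S * A₁₂1
  let A₂₂1 := (α * αk)⁻¹ • ((α * αk ^ 2) • A₂₂ - A₂₂0)
  let A₂₂2 := compl o₂₁.S * o₂₁.M * A₂₂1 * o₁₂.W * compl o₁₂.S
  let A₂₂3 := (αk ^ 2 * α)⁻¹ • A₂₂2
  let o₂₂ := rec A₂₂3 αs
  let αr := o₂₂.αr
  let J₁₂lam := lam • colProj o₁₂.S + (1 - colProj o₁₂.S)
  let I₁₂lam := lam • rowProj o₁₂.S + (1 - rowProj o₁₂.S)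
  let I₁₂lamInv := lam⁻¹ • rowProj o₁₂.S + (1 - rowProj o₁₂.S)
  let L₁₂t := o₁₂.L * I₁₂lam
  let U₁₂t := J₁₂lam * o₁₂.U
  let U₂ := αk⁻¹ • (colProj o₁₁.S * o₁₁.M * A₁₂) +
    (αl * α)⁻¹ • (colProj o₂₁.S * o₂₁.M * A₂₂1)
  let L₃ := αk⁻¹ • (A₂₁ * o₁₁.W * rowProj o₁₁.S) +
    (αm * αk * α)⁻¹ • (compl o₂₁.S * o₂₁.M * A₂₂1 * o₁₂.W * rowProj o₁₂.S)
  let L := glue (o₁₁.L * L₁₂t) 0 L₃ (o₂₁.L * o₂₂.L)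
  let S := glue o₁₁.S ((lam ^ 2)⁻¹ • o₁₂.S) o₂₁.S o₂₂.S
  let U := glue (o₂₁.U * o₁₁.U) U₂ 0 (o₂₂.U * U₁₂t)
  let Shat := (α * αr⁻¹) • S + αr⁻¹ • compl S
  let L₃' := L₃ * I₁₂lamInv * o₁₂.Shat * o₁₂.M * o₁₁.Shat * o₁₁.M
  let U₂' := o₁₁.W * o₁₁.Shat * o₂₁.W * o₂₁.Shat * U₂
  let E' := split ((unitMap S + compl S)ᵀ)
  let S'₁₁ := α • unitMap o₁₁.S + α • compl o₁₁.S
  let S'₂₁ := αk • unitMap o₂₁.S + α • compl o₂₁.S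
  let S'₁₂ := αl • unitMap o₁₂.S + α • compl o₁₂.S
  let S'₂₂ := αs • unitMap o₂₂.S + α • compl o₂₂.S
  let M := α⁻¹ •
    (glue (E'.toBlocks₁₁ * compl o₁₂.S * o₁₂.M * S'₁₁ * o₁₁.M)
        (E'.toBlocks₁₂ * compl o₂₂.S * o₂₂.M * S'₂₁ * o₂₁.M)
        (E'.toBlocks₂₁ * S'₁₂ * o₁₂.M * compl o₁₁.S * o₁₁.M)
        (E'.toBlocks₂₂ * S'₂₂ * o₂₂.M * compl o₂₁.S * o₂₁.M) *
      glue ((αr / (αm * αk)) • 1) 0 (-(αl⁻¹ • L₃')) (αl⁻¹ • 1))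
  let W := α⁻¹ •
    (glue ((αr / (αk * αl)) • 1) (-(αm⁻¹ • U₂')) 0 (αm⁻¹ • 1) *
      glue (o₁₁.W * S'₁₁ * o₂₁.W * compl o₂₁.S * E'.toBlocks₁₁)
        (o₁₁.W * compl o₁₁.S * o₂₁.W * S'₂₁ * E'.toBlocks₁₂)
        (o₁₂.W * S'₁₂ * o₂₂.W * compl o₂₂.S * E'.toBlocks₂₁)
        (o₁₂.W * compl o₁₂.S * o₂₂.W * S'₂₂ * E'.toBlocks₂₂))
  { L := L, S := S, U := U, M := M, Shat := Shat, W := W, αr := αr }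

open Classical in
/-- The recursive procedure `LSU(A, α)`. -/
def lsu : (p : ℕ) → Matrix (Fin (2 ^ p)) (Fin (2 ^ p)) F → F → Output F (2 ^ p)
  | 0, A, α => if A = 0 then zeroOutput _ α else oneOutput _ (A 0 0) α
  | p + 1, A, α => if A = 0 then zeroOutput _ α else blockStep (lsu p) A α

end Algorithm

end

end LSUFactorization

namespace LSUFactorization

noncomputable section

open Matrix

set_option linter.unusedSectionVars false

/-! Fraction-free elimination along a list of pivots. -/

section Elimination

variable {F : Type*} [Field F] {m n : Type*} [DecidableEq m] [DecidableEq n]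

/-! The procedure is fraction-free Gaussian elimination in disguise. Eliminating along a list `l` of
pivots, the first previous pivot being `α` and the last pivot `β`, gives `A = α C S R + (α/β) Z`.
Here `C` and `R` collect the pivot columns and rows at the moment of their use, `S` has the inverse
products of consecutive pivots at the pivot positions, and `Z` is what remains
(`Admissible.eq_add_residual`). If `Z = 0`, completing `C` and `R` by unit columns and rows to `L`
and `U` gives `A = α L S U`. The recursion is governed by one invariant, `IsFactored`: the output of
a call belongs to a complete elimination along some admissible list. `exists_isFactored_lsu` proves
it by induction on the size.

The recursive step rests on `LeftInverseData.M_mul`. For a block `X` to the right of the factored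
one, with pivot rows `V` and residual `Y`, it gives `M X = β V + α S̄ᵀ Y`. Hence multiplying by `J`
extracts the pivot rows and multiplying by `S̄` extracts the residual, which explains every
intermediate matrix of the algorithm. The calls 11, 21, 12, 22 are consecutive parts of one
elimination (`BlockCalls.elimination`). The call 12 runs on a matrix and pivot that lack the factor
`λ` contributed by 21, and elimination is homogeneous, whence the factors `λ`. The formulas for `M`
and `W` hold because `L⁻¹` is block triangular and the remaining factor is the inverse of `Ŝ`
(`mul_assembledInverse`).

The arithmetic comes from Sylvester's identity: residuals of a matrix of surrounding minors consist
of bordered minors of the original matrix (`Admissible.residual_eq_listMinor`), so all divisions are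
exact. Triangularity is the demand in `Admissible` that zeros precede each pivot in its row and
column. For `α M`, the elimination is run on `[A | α I]`, which is again a matrix of surrounding
minors once unit columns are appended (`LeftInverseData.smul_mem_range`). Statements about `U` and
`W` follow from those about `L` and `M` by transposition. -/

/-- One step of fraction-free elimination with the pivot at the position `x`; the previous pivot
is `α`. -/
def pivotStep (A : Matrix m n F) (α : F) (x : m × n) : Matrix m n F :=
  Matrix.of fun u v => (A x.1 x.2 * A u v - A u x.2 * A x.1 v) / α

/-- The matrix left over after elimination along a list of pivots. -/
def residual : Matrix m n F → F → List (m × n) → Matrix m n F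
  | A, _, [] => A
  | A, α, x :: l => residual (pivotStep A α x) (A x.1 x.2) l

/-- The last pivot element of an elimination. -/
def lastPivot : Matrix m n F → F → List (m × n) → F
  | _, α, [] => α
  | A, α, x :: l => lastPivot (pivotStep A α x) (A x.1 x.2) l

/-- The matrix with the column of the pivot position `x` stored in the column `x.1`. -/
def pivotColumn (A : Matrix m n F) (x : m × n) : Matrix m m F :=
  Matrix.of fun u v => if v = x.1 then A u x.2 else 0

/-- The pivot columns, each stored in the column indexed by the row of its pivot. -/
def pivotCols : Matrix m n F → F → List (m × n) → Matrix m m F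
  | _, _, [] => 0
  | A, α, x :: l => pivotColumn A x + pivotCols (pivotStep A α x) (A x.1 x.2) l

/-- The inverse products of consecutive pivot elements, at the positions of the pivots. -/
def pivotWeights : Matrix m n F → F → List (m × n) → Matrix m n F
  | _, _, [] => 0
  | A, α, x :: l => Matrix.single x.1 x.2 (α * A x.1 x.2)⁻¹ +
      pivotWeights (pivotStep A α x) (A x.1 x.2) l

/-- The pivot rows, each stored in the row indexed by the column of its pivot. -/
def pivotRows (A : Matrix m n F) (α : F) (l : List (m × n)) : Matrix n n F :=
  (pivotCols Aᵀ α (l.map Prod.swap))ᵀ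

/-- The diagonal matrix that counts the occurrences of an index in a list. -/
def countDiag (F : Type*) [Field F] {m : Type*} [DecidableEq m] (l : List m) : Matrix m m F :=
  Matrix.diagonal fun i => (l.count i : F)

/-- The left factor of an elimination. -/
def leftFactor (A : Matrix m n F) (α : F) (l : List (m × n)) : Matrix m m F :=
  pivotCols A α l + (1 - countDiag F (l.map Prod.fst))

/-- The right factor of an elimination. -/
def rightFactor (A : Matrix m n F) (α : F) (l : List (m × n)) : Matrix n n F :=
  pivotRows A α l + (1 - countDiag F (l.map Prod.snd))

/-- All pivots are nonzero, and at the moment of its use there are zeros before a pivot in its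
column and in its row. The positions are measured by `a` and `b`. -/
def Admissible (a : m → ℕ) (b : n → ℕ) : Matrix m n F → F → List (m × n) → Prop
  | _, _, [] => True
  | A, α, x :: l => A x.1 x.2 ≠ 0 ∧ (∀ u, a u < a x.1 → A u x.2 = 0) ∧
      (∀ v, b v < b x.2 → A x.1 v = 0) ∧ Admissible a b (pivotStep A α x) (A x.1 x.2) l

theorem residual_append (A : Matrix m n F) (α : F) (l l' : List (m × n)) :
    residual A α (l ++ l') = residual (residual A α l) (lastPivot A α l) l' := by
  induction l generalizing A α with
  | nil => rfl
  | cons x l ih => exact ih _ _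

theorem lastPivot_append (A : Matrix m n F) (α : F) (l l' : List (m × n)) :
    lastPivot A α (l ++ l') = lastPivot (residual A α l) (lastPivot A α l) l' := by
  induction l generalizing A α with
  | nil => rfl
  | cons x l ih => exact ih _ _

theorem pivotCols_append (A : Matrix m n F) (α : F) (l l' : List (m × n)) :
    pivotCols A α (l ++ l') =
      pivotCols A α l + pivotCols (residual A α l) (lastPivot A α l) l' := by
  induction l generalizing A α with
  | nil => simp [pivotCols, residual, lastPivot]
  | cons x l ih => simp only [List.cons_append, pivotCols, ih, residual, lastPivot, add_assoc]

theorem pivotWeights_append (A : Matrix m n F) (α : F) (l l' : List (m × n)) :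
    pivotWeights A α (l ++ l') =
      pivotWeights A α l + pivotWeights (residual A α l) (lastPivot A α l) l' := by
  induction l generalizing A α with
  | nil => simp [pivotWeights, residual, lastPivot]
  | cons x l ih => simp only [List.cons_append, pivotWeights, ih, residual, lastPivot, add_assoc]

theorem admissible_append (a : m → ℕ) (b : n → ℕ) (A : Matrix m n F) (α : F)
    (l l' : List (m × n)) :
    Admissible a b A α (l ++ l') ↔
      Admissible a b A α l ∧ Admissible a b (residual A α l) (lastPivot A α l) l' := by
  induction l generalizing A α with
  | nil => simp [Admissible, residual, lastPivot]
  | cons x l ih => simp only [List.cons_append, Admissible, ih, residual, lastPivot, and_assoc]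

theorem pivotStep_transpose (A : Matrix m n F) (α : F) (x : m × n) :
    pivotStep Aᵀ α x.swap = (pivotStep A α x)ᵀ := by
  ext u v
  simp [pivotStep, mul_comm]

theorem residual_transpose (A : Matrix m n F) (α : F) (l : List (m × n)) :
    residual Aᵀ α (l.map Prod.swap) = (residual A α l)ᵀ := by
  induction l generalizing A α with
  | nil => rfl
  | cons x l ih =>
    simp only [List.map_cons, residual, pivotStep_transpose]
    exact ih _ _

theorem lastPivot_transpose (A : Matrix m n F) (α : F) (l : List (m × n)) :
    lastPivot Aᵀ α (l.map Prod.swap) = lastPivot A α l := by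
  induction l generalizing A α with
  | nil => rfl
  | cons x l ih =>
    simp only [List.map_cons, lastPivot, pivotStep_transpose]
    exact ih _ _

theorem pivotWeights_transpose (A : Matrix m n F) (α : F) (l : List (m × n)) :
    pivotWeights Aᵀ α (l.map Prod.swap) = (pivotWeights A α l)ᵀ := by
  induction l generalizing A α with
  | nil => rfl
  | cons x l ih =>
    simp only [List.map_cons, pivotWeights, pivotStep_transpose, transpose_add, transpose_single]
    congr 1
    exact ih _ _

theorem Admissible.transpose {a : m → ℕ} {b : n → ℕ} {A : Matrix m n F} {α : F}
    {l : List (m × n)} (h : Admissible a b A α l) :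
    Admissible b a Aᵀ α (l.map Prod.swap) := by
  induction l generalizing A α with
  | nil => trivial
  | cons x l ih =>
    obtain ⟨h1, h2, h3, h4⟩ := h
    simp only [List.map_cons, Admissible, pivotStep_transpose]
    exact ⟨h1, h3, h2, ih h4⟩

theorem pivotRows_append (A : Matrix m n F) (α : F) (l l' : List (m × n)) :
    pivotRows A α (l ++ l') =
      pivotRows A α l + pivotRows (residual A α l) (lastPivot A α l) l' := by
  simp only [pivotRows, List.map_append, pivotCols_append, transpose_add, residual_transpose,
    lastPivot_transpose]

/-- Counting occurrences instead of testing membership makes this additive without any disjointness;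
for admissible lists `countDiag_of_nodup` recovers the 0-1 projection. -/
theorem countDiag_append (l l' : List m) :
    countDiag F (l ++ l') = countDiag F l + countDiag F l' := by
  simp [countDiag, diagonal_add]

theorem leftFactor_append (A : Matrix m n F) (α : F) (l l' : List (m × n)) :
    leftFactor A α (l ++ l') =
      leftFactor A α l + leftFactor (residual A α l) (lastPivot A α l) l' - 1 := by
  simp only [leftFactor, pivotCols_append, List.map_append, countDiag_append]
  abel

theorem leftFactor_transpose (A : Matrix m n F) (α : F) (l : List (m × n)) :
    leftFactor Aᵀ α (l.map Prod.swap) = (rightFactor A α l)ᵀ := by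
  simp [leftFactor, rightFactor, pivotRows, countDiag, Function.comp_def]

theorem rightFactor_append (A : Matrix m n F) (α : F) (l l' : List (m × n)) :
    rightFactor A α (l ++ l') =
      rightFactor A α l + rightFactor (residual A α l) (lastPivot A α l) l' - 1 := by
  simp only [rightFactor, pivotRows_append, List.map_append, countDiag_append]
  abel

theorem pivotStep_row_eq_zero {A : Matrix m n F} {u : m} (h : ∀ v, A u v = 0) (α : F)
    (x : m × n) (v : n) : pivotStep A α x u v = 0 := by
  simp [pivotStep, h]

theorem pivotStep_pivot_row (A : Matrix m n F) (α : F) (x : m × n) (v : n) :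
    pivotStep A α x x.1 v = 0 := by
  simp [pivotStep]

theorem residual_row_eq_zero {A : Matrix m n F} {u : m} (h : ∀ v, A u v = 0) (α : F)
    (l : List (m × n)) (v : n) : residual A α l u v = 0 := by
  induction l generalizing A α with
  | nil => exact h v
  | cons x l ih => exact ih (pivotStep_row_eq_zero h α x) _

theorem pivotCols_row_eq_zero {A : Matrix m n F} {u : m} (h : ∀ v, A u v = 0) (α : F)
    (l : List (m × n)) (v : m) : pivotCols A α l u v = 0 := by
  induction l generalizing A α with
  | nil => rfl
  | cons x l ih => simp [pivotCols, pivotColumn, h, ih (pivotStep_row_eq_zero h α x)]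

section

variable {a : m → ℕ} {b : n → ℕ}

theorem Admissible.not_mem_of_row_eq_zero {A : Matrix m n F} {α : F} {l : List (m × n)}
    (hl : Admissible a b A α l) {u : m} (h : ∀ v, A u v = 0) : u ∉ l.map Prod.fst := by
  induction l generalizing A α with
  | nil => simp
  | cons x l ih =>
    obtain ⟨h1, -, -, h4⟩ := hl
    rw [List.map_cons, List.mem_cons, not_or]
    refine ⟨?_, ih h4 (pivotStep_row_eq_zero h α x)⟩
    rintro rfl
    exact h1 (h _)

/-- A step clears its pivot row, a zero row stays zero under all further steps, and a zero row
contains no pivot. -/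
theorem Admissible.nodup_fst {A : Matrix m n F} {α : F} {l : List (m × n)}
    (hl : Admissible a b A α l) : (l.map Prod.fst).Nodup := by
  induction l generalizing A α with
  | nil => simp
  | cons x l ih =>
    obtain ⟨-, -, -, h4⟩ := hl
    exact List.nodup_cons.2 ⟨h4.not_mem_of_row_eq_zero (pivotStep_pivot_row A α x), ih h4⟩

theorem Admissible.nodup_snd {A : Matrix m n F} {α : F} {l : List (m × n)}
    (hl : Admissible a b A α l) : (l.map Prod.snd).Nodup := by
  simpa [Function.comp_def] using hl.transpose.nodup_fst

theorem Admissible.residual_pivot_row {A : Matrix m n F} {α : F} {l : List (m × n)}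
    {u : m} (hu : u ∈ l.map Prod.fst) (v : n) : residual A α l u v = 0 := by
  induction l generalizing A α with
  | nil => simp at hu
  | cons x l ih =>
    rw [List.map_cons, List.mem_cons] at hu
    rcases hu with rfl | hu
    · exact residual_row_eq_zero (pivotStep_pivot_row A α x) _ _ _
    · exact ih hu

theorem pivotCols_col_eq_zero (A : Matrix m n F) (α : F) {l : List (m × n)} {v : m}
    (hv : v ∉ l.map Prod.fst) (u : m) : pivotCols A α l u v = 0 := by
  induction l generalizing A α with
  | nil => rfl
  | cons x l ih =>
    rw [List.map_cons, List.mem_cons, not_or] at hv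
    simp [pivotCols, pivotColumn, hv.1, ih _ _ hv.2]

theorem pivotWeights_eq_zero (A : Matrix m n F) (α : F) {l : List (m × n)} {u : m} {v : n}
    (h : (u, v) ∉ l) : pivotWeights A α l u v = 0 := by
  induction l generalizing A α with
  | nil => rfl
  | cons x l ih =>
    rw [List.mem_cons, not_or] at h
    have : ¬ (x.1 = u ∧ x.2 = v) := fun hx => h.1 (Prod.ext hx.1.symm hx.2.symm)
    simp [pivotWeights, ih _ _ h.2, Matrix.single, this]

theorem Admissible.lastPivot_ne_zero {A : Matrix m n F} {α : F} {l : List (m × n)}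
    (hl : Admissible a b A α l) (hα : α ≠ 0) : lastPivot A α l ≠ 0 := by
  induction l generalizing A α with
  | nil => exact hα
  | cons x l ih => exact ih hl.2.2.2 hl.1

theorem countDiag_of_nodup {l : List m} (h : l.Nodup) :
    countDiag F l = Matrix.diagonal fun i => if i ∈ l then 1 else 0 := by
  unfold countDiag
  congr 1
  ext i
  rw [h.count]
  split_ifs <;> simp

/-- The value of the left factor in a pivot column. -/
theorem Admissible.pivotCols_getElem {A : Matrix m n F} {α : F} {l : List (m × n)}
    (hl : Admissible a b A α l) {t : ℕ} (ht : t < l.length) (u : m) :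
    pivotCols A α l u (l[t]).1 = residual A α (l.take t) u (l[t]).2 := by
  induction l generalizing A α t with
  | nil => simp at ht
  | cons x l ih =>
    have hn := hl.nodup_fst
    obtain ⟨-, -, -, h4⟩ := hl
    rw [List.map_cons, List.nodup_cons] at hn
    cases t with
    | zero => simp [pivotCols, pivotColumn, residual, pivotCols_col_eq_zero _ _ hn.1]
    | succ t =>
      have ht' : t < l.length := by simpa using ht
      have hne : (l[t]).1 ≠ x.1 := fun h => hn.1 (h ▸ List.mem_map_of_mem (List.getElem_mem ht'))
      simp [pivotCols, pivotColumn, residual, hne, ih h4 ht']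

theorem Admissible.pivotWeights_getElem {A : Matrix m n F} {α : F} {l : List (m × n)}
    (hl : Admissible a b A α l) {t : ℕ} (ht : t < l.length) :
    pivotWeights A α l (l[t]).1 (l[t]).2 =
      (lastPivot A α (l.take t) * lastPivot A α (l.take (t + 1)))⁻¹ := by
  induction l generalizing A α t with
  | nil => simp at ht
  | cons x l ih =>
    have hn := hl.nodup_fst
    obtain ⟨-, -, -, h4⟩ := hl
    rw [List.map_cons, List.nodup_cons] at hn
    cases t with
    | zero =>
      have : (x.1, x.2) ∉ l := fun h => hn.1 (List.mem_map_of_mem (f := Prod.fst) h)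
      simp [pivotWeights, lastPivot, pivotWeights_eq_zero _ _ this]
    | succ t =>
      have ht' : t < l.length := by simpa using ht
      have hne : x.1 ≠ (l[t]).1 := fun h => hn.1 (h ▸ List.mem_map_of_mem (List.getElem_mem ht'))
      simp [pivotWeights, lastPivot, Matrix.single, hne, ih h4 ht']

theorem Admissible.drop {A : Matrix m n F} {α : F} {l : List (m × n)}
    (hl : Admissible a b A α l) (t : ℕ) :
    Admissible a b (residual A α (l.take t)) (lastPivot A α (l.take t)) (l.drop t) := by
  rw [← List.take_append_drop t l, admissible_append] at hl
  exact hl.2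

end

section Products

variable [Fintype m] [Fintype n] {a : m → ℕ} {b : n → ℕ}

theorem Admissible.pivotCols_mul_countDiag {A : Matrix m n F} {α : F} {l : List (m × n)}
    (hl : Admissible a b A α l) :
    pivotCols A α l * countDiag F (l.map Prod.fst) = pivotCols A α l := by
  rw [countDiag_of_nodup hl.nodup_fst]
  ext u v
  rw [mul_diagonal]
  split_ifs with h
  · simp
  · simp [pivotCols_col_eq_zero A α h]

theorem Admissible.countDiag_mul_self {A : Matrix m n F} {α : F} {l : List (m × n)}
    (hl : Admissible a b A α l) :
    countDiag F (l.map Prod.fst) * countDiag F (l.map Prod.fst) =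
      countDiag F (l.map Prod.fst) := by
  rw [countDiag_of_nodup hl.nodup_fst, diagonal_mul_diagonal]
  simp

theorem Admissible.countDiag_mul_pivotWeights {A : Matrix m n F} {α : F} {l : List (m × n)}
    (hl : Admissible a b A α l) :
    countDiag F (l.map Prod.fst) * pivotWeights A α l = pivotWeights A α l := by
  rw [countDiag_of_nodup hl.nodup_fst]
  ext u v
  rw [diagonal_mul]
  split_ifs with h
  · simp
  · rw [pivotWeights_eq_zero, mul_zero]
    exact fun h' => h (List.mem_map_of_mem (f := Prod.fst) h')

theorem Admissible.leftFactor_mul_countDiag {A : Matrix m n F} {α : F} {l : List (m × n)}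
    (hl : Admissible a b A α l) :
    leftFactor A α l * countDiag F (l.map Prod.fst) = pivotCols A α l := by
  rw [leftFactor, add_mul, hl.pivotCols_mul_countDiag, sub_mul, hl.countDiag_mul_self]
  simp

theorem Admissible.leftFactor_mul_pivotWeights {A : Matrix m n F} {α : F} {l : List (m × n)}
    (hl : Admissible a b A α l) :
    leftFactor A α l * pivotWeights A α l = pivotCols A α l * pivotWeights A α l := by
  rw [← hl.leftFactor_mul_countDiag, Matrix.mul_assoc, hl.countDiag_mul_pivotWeights]

theorem Admissible.leftFactor_mul_compl {A : Matrix m n F} {α : F} {l : List (m × n)}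
    (hl : Admissible a b A α l) :
    leftFactor A α l * (1 - countDiag F (l.map Prod.fst)) = 1 - countDiag F (l.map Prod.fst) := by
  rw [mul_sub, hl.leftFactor_mul_countDiag, mul_one, leftFactor, add_sub_cancel_left]

theorem pivotRows_cons (A : Matrix m n F) (α : F) (x : m × n) (l : List (m × n)) :
    pivotRows A α (x :: l) =
      (pivotColumn Aᵀ x.swap)ᵀ + pivotRows (pivotStep A α x) (A x.1 x.2) l := by
  simp only [pivotRows, List.map_cons, pivotCols, pivotStep_transpose, transpose_add]
  rfl

theorem pivotColumn_mul_single_mul {A : Matrix m n F} {α : F} {x : m × n} (u : m) (v : n) :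
    (pivotColumn A x * Matrix.single x.1 x.2 (α * A x.1 x.2)⁻¹ * (pivotColumn Aᵀ x.swap)ᵀ) u v =
      A u x.2 * (α * A x.1 x.2)⁻¹ * A x.1 v := by
  rw [Matrix.mul_apply, Finset.sum_eq_single x.2]
  · simp [pivotColumn]
  · intro w _ hw
    simp [pivotColumn, hw]
  · simp

theorem pivotColumn_mul_eq_zero {A : Matrix m n F} {x : m × n} {k : Type*} {S : Matrix m k F}
    (h : ∀ v, S x.1 v = 0) : pivotColumn A x * S = 0 := by
  ext u v
  simp [pivotColumn, Matrix.mul_apply, h]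

theorem mul_single_eq_zero {C : Matrix m m F} {x : m × n} {c : F} (h : ∀ u, C u x.1 = 0) :
    C * Matrix.single x.1 x.2 c = 0 := by
  ext u v
  by_cases hv : v = x.2
  · subst hv
    simp [h]
  · simp [hv]

/-- The decomposition obtained by elimination. -/
theorem Admissible.eq_add_residual {A : Matrix m n F} {α : F} {l : List (m × n)}
    (hl : Admissible a b A α l) (hα : α ≠ 0) :
    A = α • (pivotCols A α l * pivotWeights A α l * pivotRows A α l) +
      (α / lastPivot A α l) • residual A α l := by
  induction l generalizing A α with
  | nil => simp [pivotWeights, lastPivot, residual, hα]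
  | cons x l ih =>
    obtain ⟨h1, -, -, h4⟩ := hl
    have hz := h4.not_mem_of_row_eq_zero (pivotStep_pivot_row A α x)
    have hz' : x.2 ∉ (l.map Prod.swap).map Prod.fst :=
      h4.transpose.not_mem_of_row_eq_zero (u := x.2)
        (fun v => by simp [pivotStep, mul_comm])
    have e := ih h4 h1
    have hb := h4.lastPivot_ne_zero h1
    have hd : ∀ u v, pivotStep A α x u v * α = A x.1 x.2 * A u v - A u x.2 * A x.1 v := by
      intro u v
      simp [pivotStep, hα]
    rw [pivotRows_cons]
    simp only [pivotCols, pivotWeights, lastPivot, residual]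
    set B := pivotStep A α x
    set C := pivotCols B (A x.1 x.2) l with hC
    set R := pivotRows B (A x.1 x.2) l with hR
    set S := pivotWeights B (A x.1 x.2) l with hS
    -- Later pivots avoid the row and the column of `x`, so all cross terms between the first pivot
    -- and the later ones vanish, and the triple product splits into a rank-one term and the product
    -- for the tail.
    have c1 : C * Matrix.single x.1 x.2 (α * A x.1 x.2)⁻¹ = 0 :=
      mul_single_eq_zero (pivotCols_col_eq_zero _ _ hz)
    have c2 : Matrix.single x.1 x.2 (α * A x.1 x.2)⁻¹ * R = 0 := by
      have := mul_single_eq_zero (x := x.swap) (c := (α * A x.1 x.2)⁻¹)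
        (pivotCols_col_eq_zero Bᵀ (A x.1 x.2) hz')
      rw [← transpose_inj, transpose_mul, transpose_single, transpose_zero]
      exact this
    have c3 : pivotColumn A x * S = 0 := pivotColumn_mul_eq_zero fun v =>
      pivotWeights_eq_zero _ _ fun h' => hz (List.mem_map.2 ⟨_, h', rfl⟩)
    have c4 : S * (pivotColumn Aᵀ x.swap)ᵀ = 0 := by
      rw [← transpose_inj, transpose_mul, transpose_transpose, transpose_zero]
      refine pivotColumn_mul_eq_zero fun v => ?_
      rw [transpose_apply]
      refine pivotWeights_eq_zero _ _ fun h' => hz' ?_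
      simpa using ⟨v, h'⟩
    have key : (pivotColumn A x + C) * (Matrix.single x.1 x.2 (α * A x.1 x.2)⁻¹ + S) *
        ((pivotColumn Aᵀ x.swap)ᵀ + R) =
        pivotColumn A x * Matrix.single x.1 x.2 (α * A x.1 x.2)⁻¹ * (pivotColumn Aᵀ x.swap)ᵀ +
          C * S * R := by
      simp only [Matrix.add_mul, Matrix.mul_add, c1, c3, add_zero, zero_add]
      simp only [Matrix.mul_assoc, c2, c4, Matrix.mul_zero, add_zero, zero_add]
    rw [key]
    -- What remains is the scalar identity of one step: `A` is the rank-one term plus `α` over the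
    -- pivot times `pivotStep A α x`.
    ext u v
    have hd' := hd u v
    have e' : B u v = A x.1 x.2 * (C * S * R) u v +
        (A x.1 x.2 / lastPivot B (A x.1 x.2) l) * residual B (A x.1 x.2) l u v := by
      nth_rewrite 1 [e]
      simp
    rw [Matrix.add_apply, Matrix.smul_apply, Matrix.smul_apply, Matrix.add_apply,
      pivotColumn_mul_single_mul, smul_eq_mul, smul_eq_mul]
    generalize (C * S * R) u v = T at *
    generalize residual B (A x.1 x.2) l u v = Z at *
    generalize lastPivot B (A x.1 x.2) l = β at *
    rw [e'] at hd'
    field_simp at hd' ⊢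
    linear_combination -hd'

end Products

end Elimination

/-! ### Elimination with all pivots in a submatrix -/

section Embedding

variable {F : Type*} [Field F] {m n m' n' : Type*} [DecidableEq m] [DecidableEq n]
  [DecidableEq m'] [DecidableEq n']

theorem residual_submatrix (A : Matrix m' n' F) (α : F) (f : m → m') (g : n → n')
    (l : List (m × n)) :
    (residual A α (l.map (Prod.map f g))).submatrix f g = residual (A.submatrix f g) α l := by
  induction l generalizing A α with
  | nil => rfl
  | cons x l ih => exact ih _ _

theorem lastPivot_submatrix (A : Matrix m' n' F) (α : F) (f : m → m') (g : n → n')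
    (l : List (m × n)) :
    lastPivot A α (l.map (Prod.map f g)) = lastPivot (A.submatrix f g) α l := by
  induction l generalizing A α with
  | nil => rfl
  | cons x l ih => exact ih _ _

theorem pivotCols_submatrix (A : Matrix m' n' F) (α : F) {f : m → m'} (hf : f.Injective)
    (g : n → n') (l : List (m × n)) :
    (pivotCols A α (l.map (Prod.map f g))).submatrix f f = pivotCols (A.submatrix f g) α l := by
  induction l generalizing A α with
  | nil => rfl
  | cons x l ih =>
    ext u v
    simp only [List.map_cons, pivotCols, submatrix_apply, Matrix.add_apply]
    congr 1
    · simp [pivotColumn, hf.eq_iff]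
    · exact congrFun₂ (ih _ _) u v

theorem pivotWeights_submatrix (A : Matrix m' n' F) (α : F) {f : m → m'} (hf : f.Injective)
    {g : n → n'} (hg : g.Injective) (l : List (m × n)) :
    (pivotWeights A α (l.map (Prod.map f g))).submatrix f g =
      pivotWeights (A.submatrix f g) α l := by
  induction l generalizing A α with
  | nil => rfl
  | cons x l ih =>
    ext u v
    simp only [List.map_cons, pivotWeights, submatrix_apply, Matrix.add_apply]
    congr 1
    · simp [Matrix.single, hf.eq_iff, hg.eq_iff]
    · exact congrFun₂ (ih _ _) u v

theorem map_swap_map_prodMap (f : m → m') (g : n → n') (l : List (m × n)) :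
    (l.map (Prod.map f g)).map Prod.swap = (l.map Prod.swap).map (Prod.map g f) := by
  simp [Function.comp_def]

theorem map_fst_map_swap (l : List (m × n)) : (l.map Prod.swap).map Prod.fst = l.map Prod.snd := by
  simp [Function.comp_def]

theorem pivotRows_submatrix (A : Matrix m' n' F) (α : F) (f : m → m')
    {g : n → n'} (hg : g.Injective) (l : List (m × n)) :
    (pivotRows A α (l.map (Prod.map f g))).submatrix g g = pivotRows (A.submatrix f g) α l := by
  rw [pivotRows, map_swap_map_prodMap, ← transpose_submatrix, pivotCols_submatrix _ _ hg]
  rfl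

theorem pivotCols_not_range (A : Matrix m' n' F) (α : F) {f : m → m'} (g : n → n')
    (l : List (m × n)) {v : m'} (hv : v ∉ Set.range f) (u : m') :
    pivotCols A α (l.map (Prod.map f g)) u v = 0 := by
  refine pivotCols_col_eq_zero _ _ ?_ _
  simp only [List.mem_map, not_exists, not_and]
  rintro _ ⟨x, -, rfl⟩ rfl
  exact hv ⟨_, rfl⟩

theorem pivotRows_not_range (A : Matrix m' n' F) (α : F) (f : m → m') {g : n → n'}
    (l : List (m × n)) {u : n'} (hu : u ∉ Set.range g) (v : n') :
    pivotRows A α (l.map (Prod.map f g)) u v = 0 := by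
  rw [pivotRows, map_swap_map_prodMap]
  exact pivotCols_not_range _ _ _ _ hu _

theorem pivotWeights_not_range (A : Matrix m' n' F) (α : F) {f : m → m'} {g : n → n'}
    (l : List (m × n)) {u : m'} {v : n'} (h : u ∉ Set.range f ∨ v ∉ Set.range g) :
    pivotWeights A α (l.map (Prod.map f g)) u v = 0 := by
  refine pivotWeights_eq_zero _ _ ?_
  simp only [List.mem_map, not_exists, not_and]
  rintro x - hx
  rw [Prod.map, Prod.mk.injEq] at hx
  exact h.elim (fun h => h ⟨_, hx.1⟩) (fun h => h ⟨_, hx.2⟩)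

theorem countDiag_submatrix {f : m → m'} (hf : f.Injective) (l : List m) :
    (countDiag F (l.map f)).submatrix f f = countDiag F l := by
  ext u v
  by_cases h : u = v
  · subst h
    simp [countDiag, List.count_map_of_injective _ _ hf]
  · simp [countDiag, h, hf.eq_iff]

theorem leftFactor_submatrix (A : Matrix m' n' F) (α : F) {f : m → m'} (hf : f.Injective)
    (g : n → n') (l : List (m × n)) :
    (leftFactor A α (l.map (Prod.map f g))).submatrix f f = leftFactor (A.submatrix f g) α l := by
  have m1 : (l.map (Prod.map f g)).map Prod.fst = (l.map Prod.fst).map f := by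
    simp [Function.comp_def]
  rw [leftFactor, leftFactor, ← pivotCols_submatrix _ _ hf, m1,
    ← countDiag_submatrix hf (l.map Prod.fst)]
  ext i j
  simp [Matrix.one_apply, hf.eq_iff]

theorem rightFactor_submatrix (A : Matrix m' n' F) (α : F) (f : m → m') {g : n → n'}
    (hg : g.Injective) (l : List (m × n)) :
    (rightFactor A α (l.map (Prod.map f g))).submatrix g g = rightFactor (A.submatrix f g) α l := by
  rw [← transpose_inj, ← leftFactor_transpose, transpose_submatrix, transpose_submatrix,
    ← leftFactor_submatrix _ _ hg, ← map_swap_map_prodMap, leftFactor_transpose]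

theorem countDiag_not_range {f : m → m'} (l : List m) {u v : m'} (h : v ∉ Set.range f) :
    countDiag F (l.map f) u v = 0 := by
  by_cases huv : u = v
  · subst huv
    simp only [countDiag, diagonal_apply_eq]
    rw [List.count_eq_zero_of_not_mem, Nat.cast_zero]
    simp only [List.mem_map, not_exists, not_and]
    rintro x - rfl
    exact h ⟨_, rfl⟩
  · simp [countDiag, huv]

/-- The only new demand comes from rows and columns outside the submatrix that precede one of its
own. If these vanish on the submatrix they do so after every step, so the zeros need to be checked
only at the start. -/
theorem Admissible.embed {a : m → ℕ} {b : n → ℕ} {a' : m' → ℕ} {b' : n' → ℕ}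
    {A : Matrix m' n' F} {α : F} {f : m → m'} {g : n → n'} {l : List (m × n)}
    (hl : Admissible a b (A.submatrix f g) α l)
    (ha : ∀ i j, a' (f i) < a' (f j) → a i < a j) (hb : ∀ i j, b' (g i) < b' (g j) → b i < b j)
    (ha' : ∀ u, u ∉ Set.range f → (∃ i, a' u < a' (f i)) → ∀ j, A u (g j) = 0)
    (hb' : ∀ v, v ∉ Set.range g → (∃ j, b' v < b' (g j)) → ∀ i, A (f i) v = 0) :
    Admissible a' b' A α (l.map (Prod.map f g)) := by
  induction l generalizing A α with
  | nil => trivial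
  | cons x l ih =>
    obtain ⟨h1, h2, h3, h4⟩ := hl
    refine ⟨h1, ?_, ?_, ih h4 ?_ ?_⟩
    · intro u hu
      by_cases hr : u ∈ Set.range f
      · obtain ⟨i, rfl⟩ := hr
        exact h2 i (ha _ _ hu)
      · exact ha' u hr ⟨_, hu⟩ _
    · intro v hv
      by_cases hr : v ∈ Set.range g
      · obtain ⟨i, rfl⟩ := hr
        exact h3 i (hb _ _ hv)
      · exact hb' v hr ⟨_, hv⟩ _
    · intro u hu hi j
      simp [pivotStep, ha' u hu hi]
    · intro v hv hj i
      simp [pivotStep, hb' v hv hj]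

variable [Fintype m] [Fintype n] [Fintype m'] [Fintype n']

theorem mul_mul_eq_of_support {k k' : Type*} {f : m → m'} (hf : f.Injective) {g : n → n'}
    (hg : g.Injective) {S : Matrix m' n' F}
    (hS : ∀ u v, u ∉ Set.range f ∨ v ∉ Set.range g → S u v = 0) (X : Matrix k m' F)
    (Y : Matrix n' k' F) :
    X * S * Y = X.submatrix id f * S.submatrix f g * Y.submatrix g id := by
  ext i j
  simp only [Matrix.mul_apply, submatrix_apply, id]
  refine (Fintype.sum_of_injective g hg _ _ ?_ ?_).symm
  · intro v hv
    simp [hS _ v (Or.inr hv)]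
  · intro v
    congr 1
    refine Fintype.sum_of_injective f hf _ _ ?_ ?_
    · intro u hu
      simp [hS u _ (Or.inl hu)]
    · simp

/-- The decomposition obtained by elimination in a submatrix, for arbitrary rows and columns. -/
theorem Admissible.submatrix_eq_add_residual {a : m → ℕ} {b : n → ℕ} {k k' : Type*}
    {A : Matrix m' n' F} {α : F} {f : m → m'} {g : n → n'} {l : List (m × n)}
    (hl : Admissible a b (A.submatrix f g) α l) (hα : α ≠ 0)
    (hf : f.Injective) (hg : g.Injective) (s : k → m') (t : k' → n') :
    A.submatrix s t = α • ((pivotCols A α (l.map (Prod.map f g))).submatrix s f *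
        pivotWeights (A.submatrix f g) α l *
        (pivotRows A α (l.map (Prod.map f g))).submatrix g t) +
      (α / lastPivot (A.submatrix f g) α l) •
        (residual A α (l.map (Prod.map f g))).submatrix s t := by
  -- With constant position functions the conditions on preceding zeros are void, so the pivots of
  -- the submatrix are admissible for all of `A`.
  have h : Admissible (fun _ : m' => 0) (fun _ : n' => 0) A α (l.map (Prod.map f g)) :=
    hl.embed (by simp) (by simp) (by simp) (by simp)
  have e := h.eq_add_residual hα
  rw [mul_mul_eq_of_support hf hg
    (fun _ _ h => pivotWeights_not_range A α l h), pivotWeights_submatrix _ _ hf hg,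
    lastPivot_submatrix] at e
  conv_lhs => rw [e]
  rfl

variable {a : m → ℕ} {b : n → ℕ}

theorem countDiag_mul_residual_submatrix {k : Type*} (A : Matrix m' n' F) (α : F) {f : m → m'}
    {g : n → n'} (l : List (m × n)) (t : k → n') :
    countDiag F (l.map Prod.fst) * (residual A α (l.map (Prod.map f g))).submatrix f t = 0 := by
  ext u v
  rw [countDiag, diagonal_mul, submatrix_apply]
  by_cases h : u ∈ l.map Prod.fst
  · rw [Admissible.residual_pivot_row, mul_zero, Matrix.zero_apply]
    obtain ⟨x, hx, rfl⟩ := List.mem_map.1 h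
    exact List.mem_map.2 ⟨_, List.mem_map_of_mem hx, rfl⟩
  · rw [List.count_eq_zero_of_not_mem h, Nat.cast_zero, zero_mul, Matrix.zero_apply]

theorem residual_submatrix_mul_countDiag {k : Type*} (A : Matrix m' n' F) (α : F) {f : m → m'}
    {g : n → n'} (l : List (m × n)) (s : k → m') :
    (residual A α (l.map (Prod.map f g))).submatrix s g * countDiag F (l.map Prod.snd) = 0 := by
  have := countDiag_mul_residual_submatrix Aᵀ α (f := g) (g := f) (l.map Prod.swap) s
  rw [← map_swap_map_prodMap, residual_transpose, map_fst_map_swap] at this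
  rw [← transpose_inj, transpose_mul, transpose_zero, ← this]
  simp [countDiag]

theorem Admissible.pivotCols_submatrix_mul_countDiag {k : Type*} {A : Matrix m' n' F} {α : F}
    {f : m → m'} (hf : f.Injective) {g : n → n'} {l : List (m × n)}
    (hl : Admissible a b (A.submatrix f g) α l) (s : k → m') :
    (pivotCols A α (l.map (Prod.map f g))).submatrix s f * countDiag F (l.map Prod.fst) =
      (pivotCols A α (l.map (Prod.map f g))).submatrix s f := by
  rw [countDiag_of_nodup hl.nodup_fst]
  ext u v
  rw [mul_diagonal]
  split_ifs with h
  · simp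
  · rw [submatrix_apply, pivotCols_col_eq_zero, zero_mul]
    intro h'
    simp only [List.map_map, List.mem_map] at h'
    obtain ⟨x, hx, hv⟩ := h'
    exact h (List.mem_map.2 ⟨x, hx, hf hv⟩)

theorem Admissible.countDiag_mul_pivotRows_submatrix {k : Type*} {A : Matrix m' n' F} {α : F}
    {f : m → m'} {g : n → n'} (hg : g.Injective) {l : List (m × n)}
    (hl : Admissible a b (A.submatrix f g) α l) (t : k → n') :
    countDiag F (l.map Prod.snd) * (pivotRows A α (l.map (Prod.map f g))).submatrix g t =
      (pivotRows A α (l.map (Prod.map f g))).submatrix g t := by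
  have h := Admissible.pivotCols_submatrix_mul_countDiag (A := Aᵀ) (α := α) hg (g := f)
    hl.transpose t
  rw [← map_swap_map_prodMap, map_fst_map_swap] at h
  rw [← transpose_inj, transpose_mul, transpose_submatrix, pivotRows, transpose_transpose, h.symm]
  nth_rewrite 2 [← h]
  simp [countDiag]

end Embedding

/-! ### Homogeneity of elimination in the matrix and the previous pivot -/

section Scaling

variable {F : Type*} [Field F] {m n : Type*} [DecidableEq m] [DecidableEq n]

theorem pivotStep_smul (A : Matrix m n F) (α : F) {c : F} (hc : c ≠ 0) (x : m × n) :
    pivotStep (c • A) (c * α) x = c • pivotStep A α x := by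
  ext u v
  simp only [pivotStep, of_apply, Matrix.smul_apply, smul_eq_mul]
  by_cases hα : α = 0
  · simp [hα]
  · field_simp

theorem residual_smul (A : Matrix m n F) (α : F) {c : F} (hc : c ≠ 0) (l : List (m × n)) :
    residual (c • A) (c * α) l = c • residual A α l := by
  induction l generalizing A α with
  | nil => rfl
  | cons x l ih =>
    simp only [residual, pivotStep_smul _ _ hc]
    exact ih _ _

theorem lastPivot_smul (A : Matrix m n F) (α : F) {c : F} (hc : c ≠ 0) (l : List (m × n)) :
    lastPivot (c • A) (c * α) l = c * lastPivot A α l := by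
  induction l generalizing A α with
  | nil => rfl
  | cons x l ih =>
    simp only [lastPivot, pivotStep_smul _ _ hc]
    exact ih _ _

theorem pivotCols_smul (A : Matrix m n F) (α : F) {c : F} (hc : c ≠ 0) (l : List (m × n)) :
    pivotCols (c • A) (c * α) l = c • pivotCols A α l := by
  induction l generalizing A α with
  | nil => simp [pivotCols]
  | cons x l ih =>
    simp only [pivotCols, pivotStep_smul _ _ hc, smul_add]
    congr 1
    · ext u v
      simp [pivotColumn]
    · exact ih _ _

theorem pivotRows_smul (A : Matrix m n F) (α : F) {c : F} (hc : c ≠ 0) (l : List (m × n)) :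
    pivotRows (c • A) (c * α) l = c • pivotRows A α l := by
  rw [pivotRows, transpose_smul, pivotCols_smul _ _ hc]
  rfl

theorem pivotWeights_smul (A : Matrix m n F) (α : F) {c : F} (hc : c ≠ 0) (l : List (m × n)) :
    pivotWeights (c • A) (c * α) l = (c ^ 2)⁻¹ • pivotWeights A α l := by
  induction l generalizing A α with
  | nil => simp [pivotWeights]
  | cons x l ih =>
    simp only [pivotWeights, pivotStep_smul _ _ hc, smul_add]
    congr 1
    · rw [smul_single, Matrix.smul_apply, smul_eq_mul, smul_eq_mul, ← mul_inv]
      congr 2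
      ring
    · exact ih _ _

theorem Admissible.smul {a : m → ℕ} {b : n → ℕ} {A : Matrix m n F} {α c : F} (hc : c ≠ 0)
    {l : List (m × n)} (hl : Admissible a b A α l) : Admissible a b (c • A) (c * α) l := by
  induction l generalizing A α with
  | nil => trivial
  | cons x l ih =>
    obtain ⟨h1, h2, h3, h4⟩ := hl
    refine ⟨by simp [hc, h1], fun u hu => by simp [h2 u hu], fun v hv => by simp [h3 v hv], ?_⟩
    rw [pivotStep_smul _ _ hc]
    exact ih h4

end Scaling

/-! ### Algebra of partial permutations and inverse factors -/

section Algebra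

variable {F : Type*} [Field F] {ι : Type*} [DecidableEq ι] [Fintype ι]

/-- The relations between a weighted permutation matrix `S`, its unit matrix `E`, its
Moore-Penrose inverse `T`, a complementary partial permutation `C`, and the projections `P` and
`Q` to the nonzero rows and columns. -/
structure ComplementedPermutation (S E T C P Q : Matrix ι ι F) : Prop where
  mul_T : S * T = P
  T_mul : T * S = Q
  E_mul : E * Eᵀ = P
  mul_E : Eᵀ * E = Q
  C_mul : C * Cᵀ = 1 - P
  mul_C : Cᵀ * C = 1 - Q
  P_S : P * S = S
  S_Q : S * Q = S
  P_E : P * E = E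
  E_Q : E * Q = E
  Q_T : Q * T = T
  T_P : T * P = T
  P_C : P * C = 0
  C_Q : C * Q = 0
  P_P : P * P = P
  Q_Q : Q * Q = Q

namespace ComplementedPermutation

variable {S E T C P Q : Matrix ι ι F}

theorem transpose_P (h : ComplementedPermutation S E T C P Q) : Pᵀ = P := by
  rw [← h.E_mul, transpose_mul, transpose_transpose]

theorem transpose_Q (h : ComplementedPermutation S E T C P Q) : Qᵀ = Q := by
  rw [← h.mul_E, transpose_mul, transpose_transpose]

theorem transpose (h : ComplementedPermutation S E T C P Q) :
    ComplementedPermutation Sᵀ Eᵀ Tᵀ Cᵀ Q P where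
  mul_T := by rw [← transpose_mul, h.T_mul, h.transpose_Q]
  T_mul := by rw [← transpose_mul, h.mul_T, h.transpose_P]
  E_mul := by rw [transpose_transpose, h.mul_E]
  mul_E := by rw [transpose_transpose, h.E_mul]
  C_mul := by rw [transpose_transpose, h.mul_C]
  mul_C := by rw [transpose_transpose, h.C_mul]
  P_S := by rw [← h.transpose_Q, ← transpose_mul, h.S_Q]
  S_Q := by rw [← h.transpose_P, ← transpose_mul, h.P_S]
  P_E := by rw [← h.transpose_Q, ← transpose_mul, h.E_Q]
  E_Q := by rw [← h.transpose_P, ← transpose_mul, h.P_E]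
  Q_T := by rw [← h.transpose_P, ← transpose_mul, h.T_P]
  T_P := by rw [← h.transpose_Q, ← transpose_mul, h.Q_T]
  P_C := by rw [← h.transpose_Q, ← transpose_mul, h.C_Q, transpose_zero]
  C_Q := by rw [← h.transpose_P, ← transpose_mul, h.P_C, transpose_zero]
  P_P := h.Q_Q
  Q_Q := h.P_P

theorem C_T (h : ComplementedPermutation S E T C P Q) : C * T = 0 := by
  rw [← h.Q_T, ← mul_assoc, h.C_Q, zero_mul]

theorem T_C (h : ComplementedPermutation S E T C P Q) : T * C = 0 := by
  rw [← h.T_P, mul_assoc, h.P_C, mul_zero]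

theorem Ct_P (h : ComplementedPermutation S E T C P Q) : Cᵀ * P = 0 := h.transpose.C_Q

theorem Q_Ct (h : ComplementedPermutation S E T C P Q) : Q * Cᵀ = 0 := h.transpose.P_C

theorem Ct_S (h : ComplementedPermutation S E T C P Q) : Cᵀ * S = 0 := by
  rw [← h.P_S, ← mul_assoc, h.Ct_P, zero_mul]

theorem Ct_E (h : ComplementedPermutation S E T C P Q) : Cᵀ * E = 0 := by
  rw [← h.P_E, ← mul_assoc, h.Ct_P, zero_mul]

theorem E_Ct (h : ComplementedPermutation S E T C P Q) : E * Cᵀ = 0 := by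
  rw [← h.E_Q, mul_assoc, h.Q_Ct, mul_zero]

theorem smul {c : F} (hc : c ≠ 0) (h : ComplementedPermutation S E T C P Q) :
    ComplementedPermutation (c⁻¹ • S) E (c • T) C P Q :=
  { h with
    mul_T := by rw [smul_mul_smul_comm, inv_mul_cancel₀ hc, one_smul, h.mul_T]
    T_mul := by rw [smul_mul_smul_comm, mul_inv_cancel₀ hc, one_smul, h.T_mul]
    P_S := by rw [mul_smul_comm, h.P_S]
    S_Q := by rw [smul_mul_assoc, h.S_Q]
    Q_T := by rw [mul_smul_comm, h.Q_T]
    T_P := by rw [smul_mul_assoc, h.T_P] }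

/-- `S` and `C` live on complementary rows and columns, so each is inverted separately, by `T` and
by `Cᵀ`. Up to the factor `β` this is the inverse of `Ŝ`. -/
theorem inverse_mul (h : ComplementedPermutation S E T C P Q) {α : F} (hα : α ≠ 0) :
    (α⁻¹ • T + Cᵀ) * (α • S + C) = 1 := by
  simp only [add_mul, mul_add, smul_mul_assoc, mul_smul_comm, h.T_mul, h.T_C, h.Ct_S, h.mul_C,
    smul_zero, add_zero, zero_add, smul_smul, mul_inv_cancel₀ hα, one_smul, add_sub_cancel]

theorem submatrix {κ : Type*} [DecidableEq κ] [Fintype κ] (e : κ ≃ ι)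
    (h : ComplementedPermutation S E T C P Q) :
    ComplementedPermutation (S.submatrix e e) (E.submatrix e e) (T.submatrix e e)
      (C.submatrix e e) (P.submatrix e e) (Q.submatrix e e) := by
  constructor <;>
  simp only [transpose_submatrix, submatrix_mul_equiv, h.mul_T, h.T_mul, h.E_mul, h.mul_E,
    h.C_mul, h.mul_C, h.P_S, h.S_Q, h.P_E, h.E_Q, h.Q_T, h.T_P, h.P_C, h.C_Q, h.P_P, h.Q_Q,
    submatrix_sub, submatrix_zero, Pi.zero_apply, Pi.sub_apply] <;>
  simp [submatrix_one_equiv]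

end ComplementedPermutation

/-- The part of the output of the procedure that concerns the left factor. -/
structure LeftInverseData (α β : F) (L M H S E T C P Q : Matrix ι ι F) : Prop
    extends ComplementedPermutation S E T C P Q where
  α_ne : α ≠ 0
  β_ne : β ≠ 0
  H_eq : H = β⁻¹ • (α • S + C)
  L_compl : L * (1 - P) = 1 - P
  mul_eq_one : L * H * M = 1

namespace LeftInverseData

variable {α β : F} {L M H S E T C P Q : Matrix ι ι F}

theorem inv_mul (h : LeftInverseData α β L M H S E T C P Q) : H * M * L = 1 := by
  rw [mul_eq_one_comm, ← mul_assoc, h.mul_eq_one]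

theorem mul_inv (h : LeftInverseData α β L M H S E T C P Q) : L * (H * M) = 1 := by
  rw [← mul_assoc, h.mul_eq_one]

/-- This is `M = H⁻¹ L⁻¹`, since `H * M` is `L⁻¹`. The next lemmas read off products of `M` with `C`
and `E` from it. -/
theorem M_eq (h : LeftInverseData α β L M H S E T C P Q) :
    M = β • ((α⁻¹ • T + Cᵀ) * (H * M)) := by
  have := h.inverse_mul h.α_ne
  rw [← mul_assoc, h.H_eq, mul_smul_comm, this, smul_mul_assoc, one_mul,
    smul_smul, mul_inv_cancel₀ h.β_ne, one_smul]

theorem C_mul_M (h : LeftInverseData α β L M H S E T C P Q) :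
    C * M = β • ((1 - P) * (H * M)) := by
  conv_lhs => rw [h.M_eq]
  rw [mul_smul_comm, ← mul_assoc, mul_add, mul_smul_comm, h.C_T, h.C_mul, smul_zero, zero_add]

theorem E_mul_M (h : LeftInverseData α β L M H S E T C P Q) :
    α • E * M = β • (E * T * (H * M)) := by
  conv_lhs => rw [h.M_eq]
  rw [mul_smul_comm, ← mul_assoc, smul_mul_assoc, mul_add, mul_smul_comm, h.E_Ct, add_zero,
    smul_inv_smul₀ h.α_ne]

theorem smul_add_smul_mul_M (h : LeftInverseData α β L M H S E T C P Q) (c : F) :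
    (α • E + c • C) * M = β • ((E * T + c • (1 - P)) * (H * M)) := by
  rw [add_mul, h.E_mul_M, smul_mul_assoc, h.C_mul_M, add_mul, smul_add, smul_comm c,
    smul_mul_assoc]

/-- The effect of `M` on a block to the right of the factored one. -/
theorem M_mul (h : LeftInverseData α β L M H S E T C P Q) {k : Type*} {X V Y : Matrix ι k F}
    (hX : X = α • (L * S * V) + (α / β) • Y) (hV : Q * V = V) (hY : P * Y = 0) :
    M * X = β • V + α • (Cᵀ * Y) := by
  -- `L` fixes the columns of the complement of `P`, where `Y` lives; so `L` can be factored out of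
  -- `X` and removed by `L⁻¹ = H * M`.
  have hLY : L * Y = Y := by
    have : Y = (1 - P) * Y := by rw [Matrix.sub_mul, hY, Matrix.one_mul, sub_zero]
    rw [this, ← Matrix.mul_assoc, h.L_compl]
  have hT : T * Y = 0 := by rw [← h.T_P, Matrix.mul_assoc, hY, Matrix.mul_zero]
  have hX' : X = L * (α • (S * V) + (α / β) • Y) := by
    rw [Matrix.mul_add, Matrix.mul_smul, Matrix.mul_smul, hLY, ← Matrix.mul_assoc, hX]
  have hG : H * M * X = α • (S * V) + (α / β) • Y := by
    rw [hX', ← Matrix.mul_assoc, h.inv_mul, Matrix.one_mul]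
  rw [h.M_eq, Matrix.smul_mul, Matrix.mul_assoc, hG]
  simp only [Matrix.add_mul, Matrix.mul_add, Matrix.smul_mul, Matrix.mul_smul, ← Matrix.mul_assoc,
    h.T_mul, hT, h.Ct_S, hV, smul_zero, add_zero, zero_add, smul_add, smul_smul]
  have := h.α_ne
  have := h.β_ne
  congr 2 <;> field_simp

end LeftInverseData

/-- Two consecutive left factors that act on different rows. -/
structure DisjointLeft (La Pa Lb Pb : Matrix ι ι F) : Prop where
  ab : Pa * Pb = 0
  ba : Pb * Pa = 0
  row : Pa * Lb = Pa
  col : Lb * Pa = Pa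
  a_eq : (La - 1) * Pa = La - 1

/-- `La - 1` has only columns in `Pa`, while `Lb - 1` has no rows there, so their product is zero.
This turns the products of factors in the algorithm into the sums given by `leftFactor_append`. -/
theorem DisjointLeft.mul_eq {La Pa Lb Pb : Matrix ι ι F} (h : DisjointLeft La Pa Lb Pb) :
    La * Lb = La + Lb - 1 := by
  have : (La - 1) * (Lb - 1) = 0 := by
    rw [← h.a_eq, mul_assoc, mul_sub, h.row, mul_one, sub_self, mul_zero]
  simp only [mul_sub, sub_mul, mul_one, one_mul] at this
  have h2 : La * Lb = La + Lb - 1 + (La * Lb - Lb - (La - 1)) := by abel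
  rw [h2, this, add_zero]

section Pair

variable {αa βa αb βb : F} {La Ma Ha Sa Ea Ta Ca Pa Qa : Matrix ι ι F}
  {Lb Mb Hb Sb Eb Tb Cb Pb Qb : Matrix ι ι F}

/-- The last factor is `(La * Lb)⁻¹`. The inverse `Hb * Mb` of `Lb` acts as the identity on the rows
and columns of `Pa`, hence commutes with the scaling `Ea * Ta + α • (1 - Pa)` produced by `Ma`. The
scaling is written symmetrically in `a` and `b`, which the mask `1 - Pb` permits, so that the same
one appears in `pair_mul_compl`. -/
theorem compl_mul_pair (ha : LeftInverseData αa βa La Ma Ha Sa Ea Ta Ca Pa Qa)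
    (hb : LeftInverseData αb βb Lb Mb Hb Sb Eb Tb Cb Pb Qb) (h : DisjointLeft La Pa Lb Pb)
    (α : F) :
    Cb * Mb * (αa • Ea + α • Ca) * Ma = (βa * βb) •
      ((1 - Pb) * (Ea * Ta + Eb * Tb + α • (1 - Pa - Pb)) * (Hb * Mb * (Ha * Ma))) := by
  have row : Pa * (Hb * Mb) = Pa := by
    conv_lhs => rw [← h.row, mul_assoc, hb.mul_inv, mul_one]
  have col : Hb * Mb * Pa = Pa := by
    conv_lhs => rw [← h.col, ← mul_assoc, hb.inv_mul, one_mul]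
  rw [hb.C_mul_M, mul_assoc, ha.smul_add_smul_mul_M, smul_mul_smul_comm, mul_comm βb]
  congr 1
  have e1 : Hb * Mb * (Ea * Ta) = Ea * Ta * (Hb * Mb) := by
    have w1 : Ea * Ta = Pa * (Ea * Ta) := by rw [← mul_assoc, ha.P_E]
    have w2 : Ea * Ta = Ea * Ta * Pa := by rw [mul_assoc, ha.T_P]
    conv_lhs => rw [w1, ← mul_assoc, col, ← w1]
    conv_rhs => rw [w2, mul_assoc, row, ← w2]
  have e2 : Hb * Mb * (1 - Pa) = (1 - Pa) * (Hb * Mb) := by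
    rw [mul_sub, sub_mul, row, col, mul_one, one_mul]
  have e3 : Hb * Mb * (Ea * Ta + α • (1 - Pa)) = (Ea * Ta + α • (1 - Pa)) * (Hb * Mb) := by
    rw [mul_add, add_mul, e1, mul_smul_comm, e2, smul_mul_assoc]
  -- The mask removes both terms in `Pb` from the symmetric scaling.
  have e4 : (1 - Pb) * (Ea * Ta + Eb * Tb + α • (1 - Pa - Pb)) =
      (1 - Pb) * (Ea * Ta + α • (1 - Pa)) := by
    have : (1 - Pb) * (Eb * Tb) = 0 := by
      rw [← mul_assoc, sub_mul, hb.P_E, one_mul, sub_self, zero_mul]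
    have h2 : (1 - Pb) * Pb = 0 := by rw [sub_mul, hb.P_P, one_mul, sub_self]
    rw [mul_add, mul_add, this, add_zero, mul_add, mul_smul_comm, mul_smul_comm,
      mul_sub (1 - Pb) (1 - Pa), h2, sub_zero]
  rw [e4, mul_assoc, ← mul_assoc (Hb * Mb), e3]
  simp only [mul_assoc]

theorem pair_mul_compl (ha : LeftInverseData αa βa La Ma Ha Sa Ea Ta Ca Pa Qa)
    (hb : LeftInverseData αb βb Lb Mb Hb Sb Eb Tb Cb Pb Qb) (h : DisjointLeft La Pa Lb Pb)
    (α : F) :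
    (αb • Eb + α • Cb) * Mb * Ca * Ma = (βa * βb) •
      ((1 - Pa) * (Ea * Ta + Eb * Tb + α • (1 - Pa - Pb)) * (Hb * Mb * (Ha * Ma))) := by
  have row : Pa * (Hb * Mb) = Pa := by
    conv_lhs => rw [← h.row, mul_assoc, hb.mul_inv, mul_one]
  have col : Hb * Mb * Pa = Pa := by
    conv_lhs => rw [← h.col, ← mul_assoc, hb.inv_mul, one_mul]
  rw [mul_assoc _ Ca, ha.C_mul_M, hb.smul_add_smul_mul_M, smul_mul_smul_comm, mul_comm βb]
  congr 1
  have e2 : Hb * Mb * (1 - Pa) = (1 - Pa) * (Hb * Mb) := by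
    rw [mul_sub, sub_mul, row, col, mul_one, one_mul]
  have e3 : (Eb * Tb + α • (1 - Pb)) * (1 - Pa) =
      (1 - Pa) * (Ea * Ta + Eb * Tb + α • (1 - Pa - Pb)) := by
    have w1 : (1 - Pa) * (Ea * Ta) = 0 := by
      rw [← mul_assoc, sub_mul, ha.P_E, one_mul, sub_self, zero_mul]
    have w2 : Eb * Tb * Pa = 0 := by
      rw [← hb.T_P, mul_assoc, mul_assoc, h.ba, mul_zero, mul_zero]
    have w3 : Pa * (Eb * Tb) = 0 := by
      rw [← hb.P_E, ← mul_assoc, ← mul_assoc, h.ab, zero_mul, zero_mul]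
    have w4 : (1 - Pa) * (1 - Pa - Pb) = (1 - Pb) * (1 - Pa) := by
      simp only [mul_sub, sub_mul, mul_one, one_mul, ha.P_P, h.ab, h.ba]
      abel
    rw [mul_add, mul_add, w1, zero_add, mul_smul_comm, w4, add_mul, mul_sub, w2, sub_mul 1 Pa,
      w3, smul_mul_assoc, one_mul, mul_one]
  rw [mul_assoc, ← mul_assoc (Hb * Mb), e2, ← e3]
  simp only [mul_assoc]

end Pair

end Algebra

/-! ### The inverse of an assembled block factor -/

section Assembly

variable {F : Type*} [Field F] {ι : Type*} [DecidableEq ι] [Fintype ι]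

/-- The right inverse of `L * H` for a block matrix `L`, built from those of its blocks. -/
def assembledInverse (α β β₁ β₂ : F) (N₁₁ N₁₂ N₂₁ N₂₂ K : Matrix ι ι F) :
    Matrix (ι ⊕ ι) (ι ⊕ ι) F :=
  α⁻¹ • (fromBlocks N₁₁ N₁₂ N₂₁ N₂₂ *
    fromBlocks ((β / β₁) • 1) 0 (-((β / β₂) • K)) ((β / β₂) • 1))

variable {α β α₁₁ α₁₂ α₂₁ α₂₂ β₁₁ β₁₂ β₂₁ β₂₂ : F}
  {L₁₁ M₁₁ H₁₁ S₁₁ E₁₁ T₁₁ C₁₁ P₁₁ Q₁₁ : Matrix ι ι F}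
  {L₁₂ M₁₂ H₁₂ S₁₂ E₁₂ T₁₂ C₁₂ P₁₂ Q₁₂ : Matrix ι ι F}
  {L₂₁ M₂₁ H₂₁ S₂₁ E₂₁ T₂₁ C₂₁ P₂₁ Q₂₁ : Matrix ι ι F}
  {L₂₂ M₂₂ H₂₂ S₂₂ E₂₂ T₂₂ C₂₂ P₂₂ Q₂₂ L₃ : Matrix ι ι F}
  {S C P Q : Matrix (ι ⊕ ι) (ι ⊕ ι) F}

theorem ComplementedPermutation.mul_of_disjoint_cols {Q₁ Q₂ X Y : Matrix ι ι F}
    (hX : X * Q₁ = X) (hY : Q₂ * Y = Y) (h : Q₁ * Q₂ = 0) : X * Y = 0 := by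
  rw [← hX, ← hY, mul_assoc, ← mul_assoc Q₁, h, zero_mul, mul_zero]

/-- The diagonal scaling of the assembled inverse is block diagonal. -/
theorem assembled_scaling
    (h₁₁ : LeftInverseData α₁₁ β₁₁ L₁₁ M₁₁ H₁₁ S₁₁ E₁₁ T₁₁ C₁₁ P₁₁ Q₁₁)
    (h₁₂ : LeftInverseData α₁₂ β₁₂ L₁₂ M₁₂ H₁₂ S₁₂ E₁₂ T₁₂ C₁₂ P₁₂ Q₁₂)
    (h₂₁ : LeftInverseData α₂₁ β₂₁ L₂₁ M₂₁ H₂₁ S₂₁ E₂₁ T₂₁ C₂₁ P₂₁ Q₂₁)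
    (h₂₂ : LeftInverseData α₂₂ β₂₂ L₂₂ M₂₂ H₂₂ S₂₂ E₂₂ T₂₂ C₂₂ P₂₂ Q₂₂)
    (hq₁ : Q₁₁ * Q₂₁ = 0) (hq₁' : Q₂₁ * Q₁₁ = 0) (hq₂ : Q₁₂ * Q₂₂ = 0) (hq₂' : Q₂₂ * Q₁₂ = 0)
    (h : ComplementedPermutation S (fromBlocks E₁₁ E₁₂ E₂₁ E₂₂) (fromBlocks T₁₁ T₂₁ T₁₂ T₂₂)
      C P Q) :
    P = fromBlocks (P₁₁ + P₁₂) 0 0 (P₂₁ + P₂₂) ∧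
    fromBlocks E₁₁ E₁₂ E₂₁ E₂₂ * fromBlocks T₁₁ T₂₁ T₁₂ T₂₂ =
      fromBlocks (E₁₁ * T₁₁ + E₁₂ * T₁₂) 0 0 (E₂₁ * T₂₁ + E₂₂ * T₂₂) := by
  constructor
  · rw [← h.E_mul, fromBlocks_transpose, fromBlocks_multiply, h₁₁.E_mul, h₁₂.E_mul, h₂₁.E_mul,
      h₂₂.E_mul,
      ComplementedPermutation.mul_of_disjoint_cols h₁₁.E_Q h₂₁.transpose.P_E hq₁,
      ComplementedPermutation.mul_of_disjoint_cols h₁₂.E_Q h₂₂.transpose.P_E hq₂,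
      ComplementedPermutation.mul_of_disjoint_cols h₂₁.E_Q h₁₁.transpose.P_E hq₁',
      ComplementedPermutation.mul_of_disjoint_cols h₂₂.E_Q h₁₂.transpose.P_E hq₂']
    simp
  · rw [fromBlocks_multiply,
      ComplementedPermutation.mul_of_disjoint_cols h₁₁.E_Q h₂₁.Q_T hq₁,
      ComplementedPermutation.mul_of_disjoint_cols h₁₂.E_Q h₂₂.Q_T hq₂,
      ComplementedPermutation.mul_of_disjoint_cols h₂₁.E_Q h₁₁.Q_T hq₁',
      ComplementedPermutation.mul_of_disjoint_cols h₂₂.E_Q h₁₂.Q_T hq₂']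
    simp

/-- A block of `(E + C)ᵀ` already vanishes on the columns hidden by the mask `1 - Pb`, so the masks
left by the products with `S̄` can be dropped. -/
theorem mul_compl_of_disjoint {E Pa Pb C' : Matrix ι ι F} (hE : Pa * E = E)
    (hb : Pbᵀ = Pb) (hba : Pb * Pa = 0) (hC : Pb * C' = 0) :
    (E + C')ᵀ * (1 - Pb) = (E + C')ᵀ := by
  have : (E + C')ᵀ * Pb = 0 := by
    rw [← hb, ← transpose_mul, mul_add, hC, ← hE, ← mul_assoc, hba, zero_mul, add_zero,
      transpose_zero]
  rw [mul_sub, this, mul_one, sub_zero]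

/-- Without its masks, the matrix of the four products is `(E + C)ᵀ * D * G`, where `D` is the block
diagonal scaling and `G` is block diagonal with the inverses of `L₁₁ * L₁₂` and `L₂₁ * L₂₂`, up to
scalars `β₁₁ * β₁₂` and `β₂₁ * β₂₂` on the block columns. The triangular right factor in
`assembledInverse` cancels these scalars and turns `G` into the inverse of the whole `L`, while `(E
+ C)ᵀ * D` is the inverse of `Ŝ` up to a scalar. -/
theorem mul_assembledInverse
    (h₁₁ : LeftInverseData α₁₁ β₁₁ L₁₁ M₁₁ H₁₁ S₁₁ E₁₁ T₁₁ C₁₁ P₁₁ Q₁₁)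
    (h₁₂ : LeftInverseData α₁₂ β₁₂ L₁₂ M₁₂ H₁₂ S₁₂ E₁₂ T₁₂ C₁₂ P₁₂ Q₁₂)
    (h₂₁ : LeftInverseData α₂₁ β₂₁ L₂₁ M₂₁ H₂₁ S₂₁ E₂₁ T₂₁ C₂₁ P₂₁ Q₂₁)
    (h₂₂ : LeftInverseData α₂₂ β₂₂ L₂₂ M₂₂ H₂₂ S₂₂ E₂₂ T₂₂ C₂₂ P₂₂ Q₂₂)
    (d₁ : DisjointLeft L₁₁ P₁₁ L₁₂ P₁₂) (d₂ : DisjointLeft L₂₁ P₂₁ L₂₂ P₂₂)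
    (hq₁ : Q₁₁ * Q₂₁ = 0) (hq₂ : Q₁₂ * Q₂₂ = 0)
    (h : ComplementedPermutation S (fromBlocks E₁₁ E₁₂ E₂₁ E₂₂) (fromBlocks T₁₁ T₂₁ T₁₂ T₂₂)
      C P Q) (hα : α ≠ 0) (hβ : β ≠ 0) :
    fromBlocks (L₁₁ * L₁₂) 0 L₃ (L₂₁ * L₂₂) * (β⁻¹ • (α • S + C)) *
      assembledInverse α β (β₁₁ * β₁₂) (β₂₁ * β₂₂)
        ((fromBlocks E₁₁ E₁₂ E₂₁ E₂₂ + C)ᵀ.toBlocks₁₁ *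
          (C₁₂ * M₁₂ * (α₁₁ • E₁₁ + α • C₁₁) * M₁₁))
        ((fromBlocks E₁₁ E₁₂ E₂₁ E₂₂ + C)ᵀ.toBlocks₁₂ *
          (C₂₂ * M₂₂ * (α₂₁ • E₂₁ + α • C₂₁) * M₂₁))
        ((fromBlocks E₁₁ E₁₂ E₂₁ E₂₂ + C)ᵀ.toBlocks₂₁ *
          ((α₁₂ • E₁₂ + α • C₁₂) * M₁₂ * C₁₁ * M₁₁))
        ((fromBlocks E₁₁ E₁₂ E₂₁ E₂₂ + C)ᵀ.toBlocks₂₂ *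
          ((α₂₂ • E₂₂ + α • C₂₂) * M₂₂ * C₂₁ * M₂₁))
        (L₃ * (H₁₂ * M₁₂ * (H₁₁ * M₁₁))) = 1 := by
  have hq₁' : Q₂₁ * Q₁₁ = 0 := by
    rw [← transpose_inj, transpose_mul, h₁₁.transpose_Q, h₂₁.transpose_Q, hq₁, transpose_zero]
  have hq₂' : Q₂₂ * Q₁₂ = 0 := by
    rw [← transpose_inj, transpose_mul, h₁₂.transpose_Q, h₂₂.transpose_Q, hq₂, transpose_zero]
  obtain ⟨hP, hET⟩ := assembled_scaling h₁₁ h₁₂ h₂₁ h₂₂ hq₁ hq₁' hq₂ hq₂' h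
  rw [compl_mul_pair h₁₁ h₁₂ d₁, pair_mul_compl h₁₁ h₁₂ d₁, compl_mul_pair h₂₁ h₂₂ d₂,
    pair_mul_compl h₂₁ h₂₂ d₂]
  have gu : L₁₁ * L₁₂ * (H₁₂ * M₁₂ * (H₁₁ * M₁₁)) = 1 := by
    rw [mul_assoc, ← mul_assoc L₁₂, h₁₂.mul_inv, one_mul, h₁₁.mul_inv]
  have gd : L₂₁ * L₂₂ * (H₂₂ * M₂₂ * (H₂₁ * M₂₁)) = 1 := by
    rw [mul_assoc, ← mul_assoc L₂₂, h₂₂.mul_inv, one_mul, h₂₁.mul_inv]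
  generalize H₁₂ * M₁₂ * (H₁₁ * M₁₁) = Gu at *
  generalize H₂₂ * M₂₂ * (H₂₁ * M₂₁) = Gd at *
  have hC : P * C = 0 := h.P_C
  obtain ⟨C11, C12, C21, C22, rfl⟩ : ∃ a b c d, C = fromBlocks a b c d :=
    ⟨_, _, _, _, (fromBlocks_toBlocks C).symm⟩
  rw [hP, fromBlocks_multiply, ← fromBlocks_zero, fromBlocks_inj] at hC
  simp only [Matrix.zero_mul, add_zero, zero_add] at hC
  obtain ⟨c1, c2, c3, c4⟩ := hC
  -- `P * C = 0` gives only that sums of two projections kill the blocks of `C`; orthogonality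
  -- separates the two summands.
  have kill : ∀ {Pa Pb X : Matrix ι ι F}, Pa * Pb = 0 → Pb * Pb = Pb → Pb * Pa = 0 →
      (Pa + Pb) * X = 0 → Pb * X = 0 := by
    intro Pa Pb X _ h2 h3 h4
    have : Pb * ((Pa + Pb) * X) = Pb * X := by rw [← mul_assoc, mul_add, h3, h2, zero_add]
    rw [← this, h4, mul_zero]
  have kill' : ∀ {Pa Pb X : Matrix ι ι F}, Pa * Pb = 0 → Pa * Pa = Pa →
      (Pa + Pb) * X = 0 → Pa * X = 0 := by
    intro Pa Pb X h1 h2 h4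
    have : Pa * ((Pa + Pb) * X) = Pa * X := by rw [← mul_assoc, mul_add, h1, h2, add_zero]
    rw [← this, h4, mul_zero]
  have e11 := mul_compl_of_disjoint (C' := C11) h₁₁.P_E h₁₂.transpose_P d₁.ba
    (kill d₁.ab h₁₂.P_P d₁.ba c1)
  have e12 := mul_compl_of_disjoint (C' := C21) h₂₁.P_E h₂₂.transpose_P d₂.ba
    (kill d₂.ab h₂₂.P_P d₂.ba c3)
  have e21 := mul_compl_of_disjoint (C' := C12) h₁₂.P_E h₁₁.transpose_P d₁.ab
    (kill' d₁.ab h₁₁.P_P c2)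
  have e22 := mul_compl_of_disjoint (C' := C22) h₂₂.P_E h₂₁.transpose_P d₂.ab
    (kill' d₂.ab h₂₁.P_P c4)
  -- `D = E * T + α • (1 - P)`: on nonzero rows `Eᵀ` turns `E * T` into `T`, on zero rows `Cᵀ` picks
  -- up the factor `α`.
  have hD : (fromBlocks E₁₁ E₁₂ E₂₁ E₂₂ + fromBlocks C11 C12 C21 C22)ᵀ *
      fromBlocks (E₁₁ * T₁₁ + E₁₂ * T₁₂ + α • (1 - P₁₁ - P₁₂)) 0 0
        (E₂₁ * T₂₁ + E₂₂ * T₂₂ + α • (1 - P₂₁ - P₂₂)) =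
      fromBlocks T₁₁ T₂₁ T₁₂ T₂₂ + α • (fromBlocks C11 C12 C21 C22)ᵀ := by
    have : fromBlocks (E₁₁ * T₁₁ + E₁₂ * T₁₂ + α • (1 - P₁₁ - P₁₂)) 0 0
        (E₂₁ * T₂₁ + E₂₂ * T₂₂ + α • (1 - P₂₁ - P₂₂)) =
        fromBlocks E₁₁ E₁₂ E₂₁ E₂₂ * fromBlocks T₁₁ T₂₁ T₁₂ T₂₂ + α • (1 - P) := by
      have hs : (1 : Matrix (ι ⊕ ι) (ι ⊕ ι) F) - fromBlocks (P₁₁ + P₁₂) 0 0 (P₂₁ + P₂₂) =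
          fromBlocks (1 - P₁₁ - P₁₂) 0 0 (1 - P₂₁ - P₂₂) := by
        rw [sub_eq_iff_eq_add, fromBlocks_add, ← fromBlocks_one]
        congr 1 <;> simp
      rw [hET, hP, hs, fromBlocks_smul, fromBlocks_add]
      simp
    have w : (fromBlocks E₁₁ E₁₂ E₂₁ E₂₂)ᵀ * (1 - P) = 0 := by
      rw [mul_sub, h.transpose.E_Q, mul_one, sub_self]
    rw [this, transpose_add, mul_add, mul_smul_comm, add_mul, add_mul, w, ← mul_assoc, h.mul_E,
      h.Q_T, ← mul_assoc, h.Ct_E, mul_sub, h.Ct_P]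
    simp
  have hb : β₁₁ * β₁₂ ≠ 0 := mul_ne_zero h₁₁.β_ne h₁₂.β_ne
  have hb' : β₂₁ * β₂₂ ≠ 0 := mul_ne_zero h₂₁.β_ne h₂₂.β_ne
  generalize E₁₁ * T₁₁ + E₁₂ * T₁₂ + α • (1 - P₁₁ - P₁₂) = Du at *
  generalize E₂₁ * T₂₁ + E₂₂ * T₂₂ + α • (1 - P₂₁ - P₂₂) = Dd at *
  generalize β₁₁ * β₁₂ = b1 at *
  generalize β₂₁ * β₂₂ = b2 at *
  have hM : assembledInverse α β b1 b2
        ((fromBlocks E₁₁ E₁₂ E₂₁ E₂₂ + fromBlocks C11 C12 C21 C22)ᵀ.toBlocks₁₁ *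
          (b1 • ((1 - P₁₂) * Du * Gu)))
        ((fromBlocks E₁₁ E₁₂ E₂₁ E₂₂ + fromBlocks C11 C12 C21 C22)ᵀ.toBlocks₁₂ *
          (b2 • ((1 - P₂₂) * Dd * Gd)))
        ((fromBlocks E₁₁ E₁₂ E₂₁ E₂₂ + fromBlocks C11 C12 C21 C22)ᵀ.toBlocks₂₁ *
          (b1 • ((1 - P₁₁) * Du * Gu)))
        ((fromBlocks E₁₁ E₁₂ E₂₁ E₂₂ + fromBlocks C11 C12 C21 C22)ᵀ.toBlocks₂₂ *
          (b2 • ((1 - P₂₁) * Dd * Gd)))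
        (L₃ * Gu) =
      (β * α⁻¹) • ((fromBlocks E₁₁ E₁₂ E₂₁ E₂₂ + fromBlocks C11 C12 C21 C22)ᵀ *
        fromBlocks Du 0 0 Dd * fromBlocks Gu 0 (-(Gd * (L₃ * Gu))) Gd) := by
    have t1 : ∀ {e f X Y : Matrix ι ι F}, e * f = e → e * (f * X * Y) = e * (X * Y) := by
      intro e f X Y hef
      rw [mul_assoc, ← mul_assoc, hef]
    rw [assembledInverse, mul_comm, mul_smul]
    congr 1
    rw [fromBlocks_add, fromBlocks_transpose]
    simp only [toBlocks_fromBlocks₁₁, toBlocks_fromBlocks₁₂, toBlocks_fromBlocks₂₁,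
      toBlocks_fromBlocks₂₂, mul_smul_comm, t1 e11, t1 e12, t1 e21, t1 e22]
    rw [fromBlocks_multiply, fromBlocks_multiply, fromBlocks_multiply, fromBlocks_smul]
    simp only [mul_zero, add_zero, zero_add, mul_smul_comm, smul_mul_assoc, mul_one, mul_neg,
      smul_neg, smul_add, smul_smul, mul_assoc, div_mul_cancel₀ _ hb, div_mul_cancel₀ _ hb']
  rw [hM, hD]
  have hG : fromBlocks (L₁₁ * L₁₂) 0 L₃ (L₂₁ * L₂₂) *
      fromBlocks Gu 0 (-(Gd * (L₃ * Gu))) Gd = 1 := by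
    rw [fromBlocks_multiply, mul_neg, mul_neg, ← mul_assoc (L₂₁ * L₂₂), gu, gd]
    simp [fromBlocks_one]
  have hN : (β⁻¹ • (α • S + fromBlocks C11 C12 C21 C22)) *
      ((β * α⁻¹) • (fromBlocks T₁₁ T₂₁ T₁₂ T₂₂ + α • (fromBlocks C11 C12 C21 C22)ᵀ)) = 1 := by
    have h1 := mul_eq_one_comm.1 (h.inverse_mul hα)
    rw [← h1, smul_mul_smul_comm, ← mul_assoc, inv_mul_cancel₀ hβ, one_mul, ← mul_smul_comm,
      smul_add, inv_smul_smul₀ hα]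
  rw [mul_assoc, ← smul_mul_assoc, ← mul_assoc (β⁻¹ • _), hN, one_mul, hG]

end Assembly

/-! ### Unit map, complement and pseudoinverse of a weighted permutation -/

section Fin

variable {F : Type*} [Field F] {n : ℕ}

theorem pinv_transpose (S : Matrix (Fin n) (Fin n) F) : pinv Sᵀ = (pinv S)ᵀ := rfl

theorem compl_transpose (S : Matrix (Fin n) (Fin n) F) : compl Sᵀ = (compl S)ᵀ := by
  ext i j
  simp only [compl, of_apply, transpose_apply]
  by_cases h1 : ZeroRow S j
  · by_cases h2 : ZeroCol S i
    · have h1' : ZeroCol Sᵀ j := h1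
      have h2' : ZeroRow Sᵀ i := h2
      simp only [h1, h2, h1', h2', true_and]
      exact if_congr ⟨fun h => h.symm, fun h => h.symm⟩ rfl rfl
    · have h2' : ¬ ZeroRow Sᵀ i := h2
      simp only [h2, h2', false_and, and_false, if_false]
  · have h1' : ¬ ZeroCol Sᵀ j := h1
    simp only [h1, h1', false_and, and_false, if_false]

theorem rowProj_transpose (S : Matrix (Fin n) (Fin n) F) : rowProj Sᵀ = colProj S := rfl

theorem IsWeightedPermutation.transpose {S : Matrix (Fin n) (Fin n) F}
    (h : IsWeightedPermutation S) : IsWeightedPermutation Sᵀ :=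
  ⟨fun i j j' => h.2 j j' i, fun i i' j => h.1 j i i'⟩

open Classical in
-- Distinct rows never meet in a column, and a nonzero row has a single nonzero entry. Leaving `f`
-- and `g` free covers both `E * Eᵀ` and `S * pinv S`.
theorem IsWeightedPermutation.sum_row {S : Matrix (Fin n) (Fin n) F}
    (h : IsWeightedPermutation S) {f g : F → F} (hf : f 0 = 0) (hg : g 0 = 0)
    (hfg : ∀ x, x ≠ 0 → f x * g x = 1) (i i' : Fin n) :
    ∑ j, f (S i j) * g (S i' j) =
      Matrix.diagonal (fun i => if ZeroRow S i then 0 else 1) i i' := by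
  by_cases hii : i = i'
  · subst hii
    rw [diagonal_apply_eq]
    split_ifs with hz
    · exact Finset.sum_eq_zero fun j _ => by rw [hz j, hf, zero_mul]
    · obtain ⟨j, hj⟩ := not_forall.1 hz
      rw [Finset.sum_eq_single j, hfg _ hj]
      · intro j' _ hj'
        have : S i j' = 0 := by
          by_contra hne
          exact hj' (h.1 i j' j hne hj)
        rw [this, hf, zero_mul]
      · simp
  · rw [diagonal_apply_ne _ hii]
    refine Finset.sum_eq_zero fun j _ => ?_
    by_cases h1 : S i j = 0
    · rw [h1, hf, zero_mul]
    · have : S i' j = 0 := by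
        by_contra hne
        exact hii (h.2 i i' j h1 hne)
      rw [this, hg, mul_zero]

open Classical in
theorem IsWeightedPermutation.rowProj_eq {S : Matrix (Fin n) (Fin n) F}
    (h : IsWeightedPermutation S) :
    rowProj S = Matrix.diagonal (fun i => if ZeroRow S i then 0 else 1) := by
  ext i i'
  rw [← h.sum_row (f := fun x => if x = 0 then 0 else 1) (g := fun x => if x = 0 then 0 else 1)
    (by simp) (by simp) (by simp +contextual)]
  rfl

theorem IsWeightedPermutation.mul_pinv {S : Matrix (Fin n) (Fin n) F}
    (h : IsWeightedPermutation S) : S * pinv S = rowProj S := by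
  rw [h.rowProj_eq]
  ext i i'
  rw [← h.sum_row (f := fun x => x) (g := fun x => x⁻¹) rfl (by simp)
    (fun x hx => mul_inv_cancel₀ hx)]
  rfl

open Classical in
-- Sending a nonzero column to the row of its nonzero entry is injective, so there are at most as
-- many nonzero columns as nonzero rows.
theorem IsWeightedPermutation.card_zeroRow_le {S : Matrix (Fin n) (Fin n) F}
    (h : IsWeightedPermutation S) :
    (Finset.univ.filter fun i => ZeroRow S i).card ≤
      (Finset.univ.filter fun j => ZeroCol S j).card := by
  have key : (Finset.univ.filter fun j => ¬ ZeroCol S j).card ≤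
      (Finset.univ.filter fun i => ¬ ZeroRow S i).card := by
    choose! f hf using fun j (hj : ¬ ZeroCol S j) => not_forall.1 hj
    refine Finset.card_le_card_of_injOn f ?_ ?_
    · intro j hj
      have := hf j (by simpa using hj)
      simp only [Finset.coe_filter, Finset.mem_univ, true_and, Set.mem_ofPred_eq]
      exact fun hz => this (hz j)
    · intro j hj j' hj' hjj
      have h1 := hf j (by simpa using hj)
      have h2 := hf j' (by simpa using hj')
      rw [← hjj] at h2
      exact h.1 _ _ _ h1 h2
  have e1 := Finset.card_filter_add_card_filter_not (s := (Finset.univ : Finset (Fin n)))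
    (fun j => ZeroCol S j)
  have e2 := Finset.card_filter_add_card_filter_not (s := (Finset.univ : Finset (Fin n)))
    (fun i => ZeroRow S i)
  omega

open Classical in
-- The number of earlier elements with property `p` increases strictly along the elements with `p`;
-- hence `compl` pairs each zero row with at most one zero column, and conversely.
theorem card_filter_lt_injOn {p : Fin n → Prop} {i i' : Fin n} (hi : p i) (hi' : p i')
    (h : (Finset.univ.filter fun a => a < i ∧ p a).card =
      (Finset.univ.filter fun a => a < i' ∧ p a).card) : i = i' := by
  have key : ∀ {i i' : Fin n}, p i → i < i' →
      (Finset.univ.filter fun a => a < i ∧ p a).card <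
        (Finset.univ.filter fun a => a < i' ∧ p a).card := by
    intro i i' hi hlt
    refine Finset.card_lt_card (Finset.ssubset_iff_subset_ne.2 ⟨?_, ?_⟩)
    · intro a ha
      simp only [Finset.mem_filter, Finset.mem_univ, true_and] at ha ⊢
      exact ⟨ha.1.trans hlt, ha.2⟩
    · intro he
      have : i ∈ Finset.univ.filter fun a => a < i' ∧ p a := by simp [hlt, hi]
      rw [← he] at this
      simp at this
  rcases lt_trichotomy i i' with hlt | he | hlt
  · exact absurd h (key hi hlt).ne
  · exact he
  · exact absurd h (key hi' hlt).ne'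

open Classical in
-- The counting function on the zero columns is injective into a range of the same size, hence onto
-- it; the count of `i` lies in this range because zero rows do not outnumber zero columns.
theorem IsWeightedPermutation.exists_compl {S : Matrix (Fin n) (Fin n) F}
    (h : IsWeightedPermutation S) {i : Fin n} (hi : ZeroRow S i) :
    ∃ j, ZeroCol S j ∧ (Finset.univ.filter fun a => a < i ∧ ZeroRow S a).card =
      (Finset.univ.filter fun b => b < j ∧ ZeroCol S b).card := by
  have hlt : ∀ {p : Fin n → Prop} {i : Fin n}, p i →
      (Finset.univ.filter fun a => a < i ∧ p a).card < (Finset.univ.filter fun a => p a).card := by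
    intro p i hi
    refine Finset.card_lt_card (Finset.ssubset_iff_subset_ne.2 ⟨?_, ?_⟩)
    · intro a ha
      simp only [Finset.mem_filter, Finset.mem_univ, true_and] at ha ⊢
      exact ha.2
    · intro he
      have : i ∈ Finset.univ.filter fun a => p a := by simp [hi]
      rw [← he] at this
      simp at this
  have := Finset.surjOn_of_injOn_of_card_le
    (s := Finset.univ.filter fun j => ZeroCol S j)
    (t := Finset.range (Finset.univ.filter fun j => ZeroCol S j).card)
    (fun j => (Finset.univ.filter fun b => b < j ∧ ZeroCol S b).card)
    (fun j hj => by
      simp only [Finset.coe_range, Set.mem_Iio]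
      exact hlt (by simpa using hj))
    (fun j hj j' hj' hjj => card_filter_lt_injOn (by simpa using hj) (by simpa using hj') hjj)
    (by simp)
  obtain ⟨j, hj, hj'⟩ := this (a := (Finset.univ.filter fun a => a < i ∧ ZeroRow S a).card)
    (by
      simp only [Finset.coe_range, Set.mem_Iio]
      exact (hlt hi).trans_le h.card_zeroRow_le)
  exact ⟨j, by simpa using hj, hj'.symm⟩

theorem IsWeightedPermutation.compl_mul_transpose {S : Matrix (Fin n) (Fin n) F}
    (h : IsWeightedPermutation S) : compl S * (compl S)ᵀ = 1 - rowProj S := by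
  classical
  rw [h.rowProj_eq, ← diagonal_one, diagonal_sub]
  ext i i'
  rw [Matrix.mul_apply]
  by_cases hii : i = i'
  · subst hii
    rw [diagonal_apply_eq]
    by_cases hz : ZeroRow S i
    · obtain ⟨j, hj, hc⟩ := h.exists_compl hz
      rw [Finset.sum_eq_single j]
      · simp [compl, hz, hj, hc]
      · intro j' _ hj'
        by_cases h2 : ZeroCol S j' ∧ (Finset.univ.filter fun a => a < i ∧ ZeroRow S a).card =
            (Finset.univ.filter fun b => b < j' ∧ ZeroCol S b).card
        · exact absurd (card_filter_lt_injOn h2.1 hj (h2.2.symm.trans hc)) hj'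
        · simp [compl, h2]
      · simp
    · simp [compl, hz]
  · rw [diagonal_apply_ne _ hii]
    refine Finset.sum_eq_zero fun j _ => ?_
    simp only [compl, of_apply, transpose_apply, ite_mul, one_mul, zero_mul]
    split_ifs with h1 h2
    · exact absurd (card_filter_lt_injOn h1.1 h2.1 (h1.2.2.trans h2.2.2.symm)) hii
    · rfl
    · rfl

theorem IsWeightedPermutation.rowProj_mul {S X : Matrix (Fin n) (Fin n) F}
    (h : IsWeightedPermutation S) (hX : ∀ i j, ZeroRow S i → X i j = 0) :
    rowProj S * X = X := by
  classical
  rw [h.rowProj_eq]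
  ext i j
  rw [diagonal_mul]
  split_ifs with hz
  · rw [zero_mul, hX i j hz]
  · rw [one_mul]

theorem IsWeightedPermutation.rowProj_mul_compl {S : Matrix (Fin n) (Fin n) F}
    (h : IsWeightedPermutation S) : rowProj S * compl S = 0 := by
  classical
  rw [h.rowProj_eq]
  ext i j
  rw [diagonal_mul]
  split_ifs with hz
  · simp
  · simp [compl, hz]

theorem IsWeightedPermutation.complementedPermutation {S : Matrix (Fin n) (Fin n) F}
    (h : IsWeightedPermutation S) :
    ComplementedPermutation S (unitMap S) (pinv S) (compl S) (rowProj S) (colProj S) := by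
  have ht := h.transpose
  have hS : rowProj S * S = S := h.rowProj_mul fun i j hz => hz j
  have hS' : rowProj Sᵀ * Sᵀ = Sᵀ := ht.rowProj_mul fun i j hz => hz j
  have hE : rowProj S * unitMap S = unitMap S := h.rowProj_mul fun i j hz => by
    simp [unitMap, hz j]
  have hE' : rowProj Sᵀ * unitMap Sᵀ = unitMap Sᵀ := ht.rowProj_mul fun i j hz => by
    have := hz j
    simp only [unitMap, of_apply, if_pos this]
  have hT : rowProj Sᵀ * pinv S = pinv S := ht.rowProj_mul fun i j hz => by
    have := hz j
    rw [transpose_apply] at this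
    simp [pinv, this]
  have hT' : rowProj S * (pinv S)ᵀ = (pinv S)ᵀ := h.rowProj_mul fun i j hz => by
    simp [pinv, hz j]
  have hPt : (rowProj S)ᵀ = rowProj S := by
    rw [rowProj, transpose_mul, transpose_transpose]
  have hQt : (colProj S)ᵀ = colProj S := by
    rw [colProj, transpose_mul, transpose_transpose]
  rw [rowProj_transpose] at hS' hE' hT
  refine ⟨h.mul_pinv, ?_, rfl, rfl, h.compl_mul_transpose, ?_, hS, ?_, hE, ?_, hT, ?_,
    h.rowProj_mul_compl, ?_, ?_, ?_⟩
  · have := ht.mul_pinv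
    rwa [pinv_transpose, rowProj_transpose, ← transpose_mul, ← transpose_inj,
      transpose_transpose, hQt] at this
  · have := ht.compl_mul_transpose
    rwa [compl_transpose, transpose_transpose, rowProj_transpose] at this
  · rw [← transpose_inj, transpose_mul, hQt, hS']
  · rw [← transpose_inj, transpose_mul, hQt]
    exact hE'
  · rw [← transpose_inj, transpose_mul, hPt, hT']
  · have := ht.rowProj_mul_compl
    rwa [compl_transpose, rowProj_transpose, ← transpose_inj, transpose_mul, transpose_transpose,
      transpose_zero, hQt] at this
  · rw [rowProj, ← mul_assoc]
    congr 1
  · rw [colProj, mul_assoc]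
    congr 1
    rw [← transpose_inj, transpose_mul, transpose_mul, transpose_transpose]
    exact hE'

end Fin

/-! ### The invariant of a call, its scaling and its effect on a larger matrix -/

section Factored

variable {F : Type*} [Field F] {ι κ : Type*} [DecidableEq ι] [Fintype ι] [DecidableEq κ]
  [Fintype κ]

/-- The output of the procedure together with the matrices derived from `S`. -/
structure FactorData (ι F : Type*) where
  L : Matrix ι ι F
  S : Matrix ι ι F
  U : Matrix ι ι F
  M : Matrix ι ι F
  H : Matrix ι ι F
  W : Matrix ι ι F
  E : Matrix ι ι F
  T : Matrix ι ι F
  C : Matrix ι ι F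
  P : Matrix ι ι F
  Q : Matrix ι ι F
  β : F

/-- The data `d` describe the complete elimination of `A` along the pivots `l`. -/
structure IsFactored (a : ι → ℕ) (A : Matrix ι ι F) (α : F) (l : List (ι × ι))
    (d : FactorData ι F) : Prop where
  α_ne : α ≠ 0
  adm : Admissible a a A α l
  res : residual A α l = 0
  L_eq : d.L = leftFactor A α l
  U_eq : d.U = rightFactor A α l
  S_eq : d.S = pivotWeights A α l
  β_eq : d.β = lastPivot A α l
  P_eq : d.P = countDiag F (l.map Prod.fst)
  Q_eq : d.Q = countDiag F (l.map Prod.snd)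
  perm : ComplementedPermutation d.S d.E d.T d.C d.P d.Q
  H_eq : d.H = d.β⁻¹ • (α • d.S + d.C)
  LHM : d.L * d.H * d.M = 1
  WHU : d.W * d.H * d.U = 1

namespace IsFactored

variable {a : ι → ℕ} {A : Matrix ι ι F} {α : F} {l : List (ι × ι)} {d : FactorData ι F}

theorem β_ne (h : IsFactored a A α l d) : d.β ≠ 0 := by
  rw [h.β_eq]
  exact h.adm.lastPivot_ne_zero h.α_ne

theorem left (h : IsFactored a A α l d) :
    LeftInverseData α d.β d.L d.M d.H d.S d.E d.T d.C d.P d.Q :=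
  { h.perm with
    α_ne := h.α_ne
    β_ne := h.β_ne
    H_eq := h.H_eq
    L_compl := by rw [h.L_eq, h.P_eq, h.adm.leftFactor_mul_compl]
    mul_eq_one := h.LHM }

theorem compl_mul_U (h : IsFactored a A α l d) : (1 - d.Q) * d.U = 1 - d.Q := by
  have := h.adm.transpose.leftFactor_mul_compl
  rw [leftFactor_transpose, map_fst_map_swap, ← h.U_eq, ← h.Q_eq] at this
  rw [← transpose_inj, transpose_mul, transpose_sub, transpose_one, h.perm.transpose_Q, this]

theorem right (h : IsFactored a A α l d) :
    LeftInverseData α d.β d.Uᵀ d.Wᵀ d.Hᵀ d.Sᵀ d.Eᵀ d.Tᵀ d.Cᵀ d.Q d.P :=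
  { h.perm.transpose with
    α_ne := h.α_ne
    β_ne := h.β_ne
    H_eq := by rw [h.H_eq, transpose_smul, transpose_add, transpose_smul]
    L_compl := by
      rw [← transpose_inj, transpose_mul, transpose_transpose, transpose_sub, transpose_one,
        h.perm.transpose_Q, h.compl_mul_U]
    mul_eq_one := by
      rw [← transpose_mul, ← transpose_mul, ← mul_assoc, h.WHU, transpose_one] }

theorem M_mul (h : IsFactored a A α l d) {k : Type*} {X V Y : Matrix ι k F}
    (hX : X = α • (d.L * d.S * V) + (α / d.β) • Y) (hV : d.Q * V = V) (hY : d.P * Y = 0) :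
    d.M * X = d.β • V + α • (d.Cᵀ * Y) := h.left.M_mul hX hV hY

theorem mul_W (h : IsFactored a A α l d) {k : Type*} {X V Y : Matrix k ι F}
    (hX : X = α • (V * d.S * d.U) + (α / d.β) • Y) (hV : V * d.P = V) (hY : Y * d.Q = 0) :
    X * d.W = d.β • V + α • (Y * d.Cᵀ) := by
  have := h.right.M_mul (X := Xᵀ) (V := Vᵀ) (Y := Yᵀ)
    (by rw [hX, transpose_add, transpose_smul, transpose_smul, transpose_mul, transpose_mul,
      Matrix.mul_assoc])
    (by rw [← h.perm.transpose_P, ← transpose_mul, hV])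
    (by rw [← h.perm.transpose_Q, ← transpose_mul, hY, transpose_zero])
  rw [← transpose_inj, transpose_mul, this]
  simp

/-- Rows that vanish in `B` supply no pivot of the second elimination, and its pivot columns vanish
on them. -/
theorem disjointLeft {B : Matrix ι ι F} {β : F} {l' : List (ι × ι)} {d' : FactorData ι F}
    (h : IsFactored a A α l d) (h' : IsFactored a B β l' d') (hB : d.P * B = 0) :
    DisjointLeft d.L d.P d'.L d'.P := by
  have hp : d.P = Matrix.diagonal fun i => if i ∈ l.map Prod.fst then 1 else 0 := by
    rw [h.P_eq, countDiag_of_nodup h.adm.nodup_fst]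
  have hp' : d'.P = Matrix.diagonal fun i => if i ∈ l'.map Prod.fst then 1 else 0 := by
    rw [h'.P_eq, countDiag_of_nodup h'.adm.nodup_fst]
  have hrow : ∀ i ∈ l.map Prod.fst, ∀ j, B i j = 0 := by
    intro i hi j
    have := congrFun₂ hB i j
    rwa [hp, diagonal_mul, if_pos hi, one_mul] at this
  have hdisj : ∀ i ∈ l.map Prod.fst, i ∉ l'.map Prod.fst := fun i hi =>
    h'.adm.not_mem_of_row_eq_zero (hrow i hi)
  have hab : d.P * d'.P = 0 := by
    rw [hp, hp', diagonal_mul_diagonal, ← diagonal_zero]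
    congr 1
    ext i
    by_cases hi : i ∈ l.map Prod.fst
    · rw [if_neg (hdisj i hi), mul_zero]
    · rw [if_neg hi, zero_mul]
  have hba : d'.P * d.P = 0 := by
    rw [← transpose_inj, transpose_mul, h.perm.transpose_P, h'.perm.transpose_P, hab,
      transpose_zero]
  have hc : d.P * pivotCols B β l' = 0 := by
    ext i j
    rw [hp, diagonal_mul]
    split_ifs with hi
    · rw [pivotCols_row_eq_zero (hrow i hi), mul_zero, Matrix.zero_apply]
    · rw [zero_mul, Matrix.zero_apply]
  have hc' : pivotCols B β l' * d.P = 0 := by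
    rw [← h'.adm.pivotCols_mul_countDiag, ← h'.P_eq, mul_assoc, hba, mul_zero]
  have hL : d'.L = pivotCols B β l' + (1 - d'.P) := by rw [h'.L_eq, h'.P_eq]; rfl
  refine ⟨hab, hba, ?_, ?_, ?_⟩
  · rw [hL, mul_add, hc, mul_sub, hab, mul_one, sub_zero, zero_add]
  · rw [hL, add_mul, hc', sub_mul, hba, one_mul, sub_zero, zero_add]
  · have := h.adm.leftFactor_mul_countDiag
    rw [← h.P_eq, ← h.L_eq] at this
    rw [sub_mul, this, one_mul, h.L_eq, leftFactor, ← h.P_eq]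
    abel

theorem disjointRight {B : Matrix ι ι F} {β : F} {l' : List (ι × ι)} {d' : FactorData ι F}
    (h : IsFactored a A α l d) (h' : IsFactored a B β l' d') (hB : B * d.Q = 0) :
    DisjointLeft d.Uᵀ d.Q d'.Uᵀ d'.Q := by
  -- The invariant is symmetric: transposition exchanges `L` with `U`, `M` with `W` and `P` with
  -- `Q`.
  have tr : ∀ {A : Matrix ι ι F} {α : F} {l : List (ι × ι)} {d : FactorData ι F},
      IsFactored a A α l d → IsFactored a Aᵀ α (l.map Prod.swap)
        ⟨d.Uᵀ, d.Sᵀ, d.Lᵀ, d.Wᵀ, d.Hᵀ, d.Mᵀ, d.Eᵀ, d.Tᵀ, d.Cᵀ, d.Q, d.P, d.β⟩ := by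
    intro A α l d h
    exact
      { α_ne := h.α_ne
        adm := h.adm.transpose
        res := by rw [residual_transpose, h.res, transpose_zero]
        L_eq := by rw [leftFactor_transpose, ← h.U_eq]
        U_eq := by
          rw [← transpose_inj, ← leftFactor_transpose, transpose_transpose, transpose_transpose,
            h.L_eq]
          simp
        S_eq := by rw [pivotWeights_transpose, ← h.S_eq]
        β_eq := by rw [lastPivot_transpose, ← h.β_eq]
        P_eq := by rw [map_fst_map_swap, ← h.Q_eq]
        Q_eq := by rw [h.P_eq]; simp [Function.comp_def]
        perm := h.perm.transpose
        H_eq := h.right.H_eq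
        LHM := h.right.mul_eq_one
        WHU := by rw [← transpose_mul, ← transpose_mul, ← mul_assoc, h.LHM, transpose_one] }
  refine (tr h).disjointLeft (tr h') ?_
  rw [← h.perm.transpose_Q, ← transpose_mul, hB, transpose_zero]

end IsFactored

/-- The data for the matrix and the pivot scaled by `c`. -/
def FactorData.scale (c : F) (d : FactorData ι F) : FactorData ι F :=
  { d with
    L := d.L * (c • d.P + (1 - d.P))
    S := (c ^ 2)⁻¹ • d.S
    U := (c • d.Q + (1 - d.Q)) * d.U
    M := c • d.M
    H := c⁻¹ • ((c⁻¹ • d.P + (1 - d.P)) * d.H)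
    W := c • d.W
    T := c ^ 2 • d.T
    β := c * d.β }

/-- Pivot columns and rows acquire `c` but the completing unit columns and rows do not, whence the
factors `c • P + (1 - P)` and `c • Q + (1 - Q)`. The weights acquire `c⁻²`, and correspondingly only
the pivot rows of `H` receive one more `c⁻¹` than the rest. -/
theorem IsFactored.scale {a : ι → ℕ} {A : Matrix ι ι F} {α c : F} {l : List (ι × ι)}
    {d : FactorData ι F} (h : IsFactored a A α l d) (hc : c ≠ 0) :
    IsFactored a (c • A) (c * α) l (d.scale c) := by
  have hp := h.perm
  have e1 : (c⁻¹ • d.P + (1 - d.P)) * d.H = d.β⁻¹ • ((c⁻¹ * α) • d.S + d.C) := by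
    rw [h.H_eq, mul_smul_comm, add_mul, sub_mul, one_mul, smul_mul_assoc, mul_add, hp.P_C,
      mul_smul_comm, hp.P_S, add_zero, smul_smul]
    congr 1
    abel
  have e2 : d.H * (c⁻¹ • d.Q + (1 - d.Q)) = d.β⁻¹ • ((c⁻¹ * α) • d.S + d.C) := by
    rw [h.H_eq, smul_mul_assoc, mul_add, mul_sub, mul_one, mul_smul_comm, add_mul, hp.C_Q,
      smul_mul_assoc, hp.S_Q, add_zero, smul_smul]
    congr 1
    abel
  have i1 : ∀ {P : Matrix ι ι F}, P * P = P →
      (c • P + (1 - P)) * (c⁻¹ • P + (1 - P)) = 1 := by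
    intro P hP
    simp only [add_mul, mul_add, sub_mul, mul_sub, one_mul, mul_one, smul_mul_assoc,
      mul_smul_comm, hP, smul_smul, inv_mul_cancel₀ hc, sub_self, add_zero, one_smul]
    abel
  exact
    { α_ne := mul_ne_zero hc h.α_ne
      adm := h.adm.smul hc
      res := by rw [residual_smul _ _ hc, h.res, smul_zero]
      L_eq := by
        have := h.adm.leftFactor_mul_countDiag
        have h2 := h.adm.leftFactor_mul_compl
        rw [← h.P_eq, ← h.L_eq] at this h2
        change d.L * (c • d.P + (1 - d.P)) = _
        rw [leftFactor, pivotCols_smul _ _ hc, ← h.P_eq, mul_add, mul_smul_comm, this, h2]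
      U_eq := by
        have := h.adm.transpose.leftFactor_mul_countDiag
        rw [leftFactor_transpose, map_fst_map_swap, ← h.U_eq, ← h.Q_eq, ← transpose_inj,
          transpose_mul, transpose_transpose, hp.transpose_Q] at this
        change (c • d.Q + (1 - d.Q)) * d.U = _
        rw [rightFactor, pivotRows_smul _ _ hc, ← h.Q_eq, add_mul, smul_mul_assoc, this,
          h.compl_mul_U]
        rfl
      S_eq := by
        change (c ^ 2)⁻¹ • d.S = _
        rw [pivotWeights_smul _ _ hc, h.S_eq]
      β_eq := by
        change c * d.β = _
        rw [lastPivot_smul _ _ hc, h.β_eq]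
      P_eq := h.P_eq
      Q_eq := h.Q_eq
      perm := hp.smul (pow_ne_zero 2 hc)
      H_eq := by
        change c⁻¹ • ((c⁻¹ • d.P + (1 - d.P)) * d.H) =
          (c * d.β)⁻¹ • ((c * α) • (c ^ 2)⁻¹ • d.S + d.C)
        rw [e1, smul_smul, smul_smul, mul_inv]
        congr 3
        field_simp
      LHM := by
        change d.L * (c • d.P + (1 - d.P)) * (c⁻¹ • ((c⁻¹ • d.P + (1 - d.P)) * d.H)) *
          (c • d.M) = 1
        rw [mul_smul_comm, mul_smul_comm, smul_mul_assoc, smul_smul, mul_inv_cancel₀ hc, one_smul,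
          mul_assoc d.L, ← mul_assoc _ _ d.H, i1 hp.P_P, one_mul, h.LHM]
      WHU := by
        change c • d.W * (c⁻¹ • ((c⁻¹ • d.P + (1 - d.P)) * d.H)) *
          ((c • d.Q + (1 - d.Q)) * d.U) = 1
        have i2 : (c⁻¹ • d.Q + (1 - d.Q)) * (c • d.Q + (1 - d.Q)) = 1 :=
          mul_eq_one_comm.1 (i1 hp.Q_Q)
        rw [smul_mul_smul_comm, mul_inv_cancel₀ hc, one_smul, e1, ← e2, mul_assoc, mul_assoc d.H,
          ← mul_assoc _ _ d.U, i2, one_mul, ← mul_assoc, h.WHU] }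

/-- The effect on all of `A` of the elimination of the block with rows `f` and columns `g`; the
remaining rows and columns are `f'` and `g'`. -/
structure BlockElimination (A : Matrix κ κ F) (α : F) (l : List (κ × κ)) (f g f' g' : ι → κ)
    (d : FactorData ι F) : Prop where
  L_ff : (leftFactor A α l).submatrix f f = d.L
  L_fo : (leftFactor A α l).submatrix f f' = 0
  L_oo : (leftFactor A α l).submatrix f' f' = 1
  U_gg : (rightFactor A α l).submatrix g g = d.U
  U_og : (rightFactor A α l).submatrix g' g = 0
  U_oo : (rightFactor A α l).submatrix g' g' = 1
  S_fg : (pivotWeights A α l).submatrix f g = d.S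
  S_fo : (pivotWeights A α l).submatrix f g' = 0
  S_og : (pivotWeights A α l).submatrix f' g = 0
  S_oo : (pivotWeights A α l).submatrix f' g' = 0
  last : lastPivot A α l = d.β
  res : (residual A α l).submatrix f g = 0
  Q_mul : d.Q * (rightFactor A α l).submatrix g g' = (rightFactor A α l).submatrix g g'
  mul_P : (leftFactor A α l).submatrix f' f * d.P = (leftFactor A α l).submatrix f' f
  P_mul : d.P * (residual A α l).submatrix f g' = 0
  mul_Q : (residual A α l).submatrix f' g * d.Q = 0
  M_mul : d.M * A.submatrix f g' = d.β • (rightFactor A α l).submatrix g g' +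
    α • (d.Cᵀ * (residual A α l).submatrix f g')
  mul_W : A.submatrix f' g * d.W = d.β • (leftFactor A α l).submatrix f' f +
    α • ((residual A α l).submatrix f' g * d.Cᵀ)
  rest : A.submatrix f' g' = α • ((leftFactor A α l).submatrix f' f * d.S *
    (rightFactor A α l).submatrix g g') + (α / d.β) • (residual A α l).submatrix f' g'

/-- The pivots of the block also eliminate in all of `A`. The decomposition restricted to the
neighbouring blocks has the form required by `M_mul` and `mul_W`, with pivot rows or columns
supported on `Q` or `P` and a residual vanishing there. -/
theorem IsFactored.blockElimination {a : ι → ℕ} {A : Matrix κ κ F} {α : F}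
    {l : List (ι × ι)} {d : FactorData ι F} {f g f' g' : ι → κ}
    (h : IsFactored a (A.submatrix f g) α l d) (hf : f.Injective) (hg : g.Injective)
    (hf' : f'.Injective) (hg' : g'.Injective)
    (hff : ∀ i, f' i ∉ Set.range f) (hgg : ∀ i, g' i ∉ Set.range g) :
    BlockElimination A α (l.map (Prod.map f g)) f g f' g' d := by
  have m1 : (l.map (Prod.map f g)).map Prod.fst = (l.map Prod.fst).map f := by
    simp [Function.comp_def]
  have m2 : (l.map (Prod.map f g)).map Prod.snd = (l.map Prod.snd).map g := by
    simp [Function.comp_def]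
  have hff' : ∀ i j, f' i ≠ f j := fun i j e => hff i ⟨j, e.symm⟩
  have hgg' : ∀ i j, g' i ≠ g j := fun i j e => hgg i ⟨j, e.symm⟩
  have cd : ∀ {f f' : ι → κ} (_ : ∀ i j, f' i ≠ f j) (l : List ι) (i j : ι),
      countDiag F (l.map f) (f' i) (f j) = 0 := by
    intro f f' hne l i j
    rw [countDiag, diagonal_apply_ne _ (hne i j)]
  have lf : (leftFactor A α (l.map (Prod.map f g))).submatrix f' f =
      (pivotCols A α (l.map (Prod.map f g))).submatrix f' f := by
    ext i j
    rw [submatrix_apply, leftFactor, Matrix.add_apply, Matrix.sub_apply, m1, cd hff',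
      Matrix.one_apply_ne (hff' i j), sub_zero, add_zero, submatrix_apply]
  have rg : (rightFactor A α (l.map (Prod.map f g))).submatrix g g' =
      (pivotRows A α (l.map (Prod.map f g))).submatrix g g' := by
    ext i j
    rw [submatrix_apply, rightFactor, Matrix.add_apply, Matrix.sub_apply, m2,
      countDiag_not_range _ (hgg j), Matrix.one_apply_ne (hgg' j i).symm, sub_zero, add_zero,
      submatrix_apply]
  have QV := h.adm.countDiag_mul_pivotRows_submatrix hg g'
  have VP := h.adm.pivotCols_submatrix_mul_countDiag hf f'
  have PY := countDiag_mul_residual_submatrix A α (f := f) (g := g) l g'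
  have YQ := residual_submatrix_mul_countDiag A α (f := f) (g := g) l f'
  rw [← h.Q_eq, ← rg] at QV
  rw [← h.P_eq, ← lf] at VP
  rw [← h.P_eq] at PY
  rw [← h.Q_eq] at YQ
  have X1 := h.adm.submatrix_eq_add_residual h.α_ne hf hg f g'
  have X2 := h.adm.submatrix_eq_add_residual h.α_ne hf hg f' g
  have X3 := h.adm.submatrix_eq_add_residual h.α_ne hf hg f' g'
  rw [← h.S_eq, ← h.β_eq] at X1 X2 X3
  rw [← rg, pivotCols_submatrix _ _ hf] at X1
  rw [← lf, pivotRows_submatrix _ _ _ hg] at X2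
  rw [← rg, ← lf] at X3
  have eL : pivotCols (A.submatrix f g) α l * d.S = d.L * d.S := by
    rw [h.S_eq, h.L_eq, h.adm.leftFactor_mul_pivotWeights]
  have eU : d.S * pivotRows (A.submatrix f g) α l = d.S * d.U := by
    have := h.adm.transpose.leftFactor_mul_pivotWeights
    rw [pivotWeights_transpose, leftFactor_transpose, ← h.S_eq, ← h.U_eq, ← transpose_mul] at this
    rw [← transpose_inj, this, transpose_mul, pivotRows, transpose_transpose]
  rw [eL] at X1
  rw [mul_assoc, eU, ← mul_assoc] at X2
  refine
    { L_ff := by rw [leftFactor_submatrix _ _ hf, h.L_eq]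
      L_fo := ?_
      L_oo := ?_
      U_gg := by rw [rightFactor_submatrix _ _ _ hg, h.U_eq]
      U_og := ?_
      U_oo := ?_
      S_fg := by rw [pivotWeights_submatrix _ _ hf hg, h.S_eq]
      S_fo := ?_
      S_og := ?_
      S_oo := ?_
      last := by rw [lastPivot_submatrix, h.β_eq]
      res := by rw [residual_submatrix, h.res]
      Q_mul := QV
      mul_P := VP
      P_mul := PY
      mul_Q := YQ
      M_mul := h.M_mul X1 QV PY
      mul_W := h.mul_W X2 VP YQ
      rest := X3 }
  · ext i j
    rw [submatrix_apply, leftFactor, Matrix.add_apply, Matrix.sub_apply, m1,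
      countDiag_not_range _ (hff j), pivotCols_not_range _ _ _ _ (hff j),
      Matrix.one_apply_ne (hff' j i).symm]
    simp
  · ext i j
    rw [submatrix_apply, leftFactor, Matrix.add_apply, Matrix.sub_apply, m1,
      countDiag_not_range _ (hff j), pivotCols_not_range _ _ _ _ (hff j)]
    simp [Matrix.one_apply, hf'.eq_iff]
  · ext i j
    rw [submatrix_apply, rightFactor, Matrix.add_apply, Matrix.sub_apply, m2, cd hgg',
      pivotRows_not_range _ _ _ _ (hgg i), Matrix.one_apply_ne (hgg' i j)]
    simp
  · ext i j
    rw [submatrix_apply, rightFactor, Matrix.add_apply, Matrix.sub_apply, m2,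
      countDiag_not_range _ (hgg j), pivotRows_not_range _ _ _ _ (hgg i)]
    simp [Matrix.one_apply, hg'.eq_iff]
  · ext i j
    exact pivotWeights_not_range _ _ _ (Or.inr (hgg j))
  · ext i j
    exact pivotWeights_not_range _ _ _ (Or.inl (hff i))
  · ext i j
    exact pivotWeights_not_range _ _ _ (Or.inl (hff i))

end Factored

/-! ### The four calls as one elimination -/

section BlockStep

variable {F : Type*} [Field F] {ι : Type*} [DecidableEq ι] [Fintype ι]

namespace ComplementedPermutation

variable {S E T C P Q V Y : Matrix ι ι F}

/-- The two summands of `M X` occupy complementary rows; `C` recovers the residual and, in the next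
lemma, `Q` the pivot rows. -/
theorem C_mul_combination (h : ComplementedPermutation S E T C P Q) (hV : Q * V = V)
    (hY : P * Y = 0) (α β : F) : C * (β • V + α • (Cᵀ * Y)) = α • Y := by
  rw [mul_add, mul_smul_comm, mul_smul_comm, ← hV, ← mul_assoc C, h.C_Q, ← mul_assoc C, h.C_mul,
    sub_mul, hY]
  simp

theorem Q_mul_combination (h : ComplementedPermutation S E T C P Q) (hV : Q * V = V)
    (α β : F) : Q * (β • V + α • (Cᵀ * Y)) = β • V := by
  rw [mul_add, mul_smul_comm, mul_smul_comm, hV, ← mul_assoc Q, h.Q_Ct]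
  simp

theorem scaled_mul_combination (h : ComplementedPermutation S E T C P Q) (hV : Q * V = V)
    (hY : P * Y = 0) {α β : F} (hβ : β ≠ 0) :
    β⁻¹ • (α • S + C) * (β • V + α • (Cᵀ * Y)) = α • (S * V) + (α / β) • Y := by
  have : S * (Cᵀ * Y) = 0 := by rw [← h.S_Q, mul_assoc, ← mul_assoc Q, h.Q_Ct, zero_mul, mul_zero]
  rw [smul_mul_assoc, add_mul, h.C_mul_combination hV hY, smul_mul_assoc, mul_add, mul_smul_comm,
    mul_smul_comm, this, smul_zero, add_zero, smul_add, smul_smul, smul_smul, smul_smul]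
  congr 2 <;> field_simp

theorem combination_mul_C (h : ComplementedPermutation S E T C P Q) (hV : V * P = V)
    (hY : Y * Q = 0) (α β : F) : (β • V + α • (Y * Cᵀ)) * C = α • Y := by
  have := h.transpose.C_mul_combination (V := Vᵀ) (Y := Yᵀ)
    (by rw [← h.transpose_P, ← transpose_mul, hV])
    (by rw [← h.transpose_Q, ← transpose_mul, hY, transpose_zero]) α β
  rw [← transpose_inj, transpose_mul]
  simpa using this

theorem combination_mul_P (h : ComplementedPermutation S E T C P Q) (hV : V * P = V)
    (α β : F) : (β • V + α • (Y * Cᵀ)) * P = β • V := by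
  rw [add_mul, smul_mul_assoc, smul_mul_assoc, hV, mul_assoc, h.Ct_P]
  simp

theorem combination_mul_scaled (h : ComplementedPermutation S E T C P Q) (hV : V * P = V)
    (hY : Y * Q = 0) {α β : F} (hβ : β ≠ 0) :
    (β • V + α • (Y * Cᵀ)) * (β⁻¹ • (α • S + C)) = α • (V * S) + (α / β) • Y := by
  have := h.transpose.scaled_mul_combination (V := Vᵀ) (Y := Yᵀ)
    (by rw [← h.transpose_P, ← transpose_mul, hV])
    (by rw [← h.transpose_Q, ← transpose_mul, hY, transpose_zero]) (α := α) hβ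
  rw [← transpose_inj, transpose_mul]
  simpa using this

end ComplementedPermutation

namespace BlockElimination

variable {κ : Type*} [DecidableEq κ] [Fintype κ] {A : Matrix κ κ F} {α : F} {l : List (κ × κ)}
  {f g f' g' : ι → κ} {d : FactorData ι F}

/-- Both parts can be read off from `M` times the neighbouring block. So a zero block stays zero,
and it contributes nothing to the right factor. -/
theorem eq_zero_of_right (h : BlockElimination A α l f g f' g' d) (hα : α ≠ 0) (hβ : d.β ≠ 0)
    (hp : ComplementedPermutation d.S d.E d.T d.C d.P d.Q) (hA : A.submatrix f g' = 0) :
    (rightFactor A α l).submatrix g g' = 0 ∧ (residual A α l).submatrix f g' = 0 := by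
  have e := h.M_mul
  rw [hA, Matrix.mul_zero] at e
  constructor
  · have := hp.Q_mul_combination (Y := (residual A α l).submatrix f g') h.Q_mul α d.β
    rw [← e, mul_zero] at this
    exact (smul_eq_zero.1 this.symm).resolve_left hβ
  · have := hp.C_mul_combination h.Q_mul h.P_mul α d.β
    rw [← e, mul_zero] at this
    exact (smul_eq_zero.1 this.symm).resolve_left hα

theorem eq_zero_of_left (h : BlockElimination A α l f g f' g' d) (hα : α ≠ 0) (hβ : d.β ≠ 0)
    (hp : ComplementedPermutation d.S d.E d.T d.C d.P d.Q) (hA : A.submatrix f' g = 0) :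
    (leftFactor A α l).submatrix f' f = 0 ∧ (residual A α l).submatrix f' g = 0 := by
  have e := h.mul_W
  rw [hA, Matrix.zero_mul] at e
  constructor
  · have := hp.combination_mul_P (Y := (residual A α l).submatrix f' g) h.mul_P α d.β
    rw [← e, zero_mul] at this
    exact (smul_eq_zero.1 this.symm).resolve_left hβ
  · have := hp.combination_mul_C h.mul_P h.mul_Q α d.β
    rw [← e, zero_mul] at this
    exact (smul_eq_zero.1 this.symm).resolve_left hα

end BlockElimination

theorem eq_fromBlocks_submatrix {R : Type*} (A : Matrix (ι ⊕ ι) (ι ⊕ ι) R) :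
    A = fromBlocks (A.submatrix Sum.inl Sum.inl) (A.submatrix Sum.inl Sum.inr)
      (A.submatrix Sum.inr Sum.inl) (A.submatrix Sum.inr Sum.inr) :=
  (fromBlocks_toBlocks A).symm

/-- The Schur complement of the first block, scaled by the initial pivot. -/
def schurBlock (A : Matrix (ι ⊕ ι) (ι ⊕ ι) F) (α : F) (d : FactorData ι F) : Matrix ι ι F :=
  (α * d.β)⁻¹ • ((α * d.β ^ 2) • A.toBlocks₂₂ -
    d.β • (A.toBlocks₂₁ * d.W * d.H) * d.T * (d.β • (d.H * (d.M * A.toBlocks₁₂))))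

/-- The lower left block of the left factor. -/
def leftBlock (A : Matrix (ι ⊕ ι) (ι ⊕ ι) F) (α : F) (d₁₁ d₂₁ d₁₂ : FactorData ι F) :
    Matrix ι ι F :=
  d₁₁.β⁻¹ • (A.toBlocks₂₁ * d₁₁.W * d₁₁.P) +
    (d₁₂.β * d₁₁.β * α)⁻¹ • (d₂₁.C * d₂₁.M * schurBlock A α d₁₁ * d₁₂.W * d₁₂.P)

/-- The upper right block of the right factor. -/
def rightBlock (A : Matrix (ι ⊕ ι) (ι ⊕ ι) F) (α : F) (d₁₁ d₂₁ : FactorData ι F) :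
    Matrix ι ι F :=
  d₁₁.β⁻¹ • (d₁₁.Q * d₁₁.M * A.toBlocks₁₂) +
    (d₂₁.β * α)⁻¹ • (d₂₁.Q * d₂₁.M * schurBlock A α d₁₁)

/-- The four calls of the recursive step. -/
structure BlockCalls (a : ι → ℕ) (A : Matrix (ι ⊕ ι) (ι ⊕ ι) F) (α : F)
    (l₁₁ l₂₁ l₁₂ l₂₂ : List (ι × ι)) (d₁₁ d₂₁ d₁₂ d₂₂ : FactorData ι F) : Prop where
  h₁₁ : IsFactored a A.toBlocks₁₁ α l₁₁ d₁₁
  h₂₁ : IsFactored a (α⁻¹ • (A.toBlocks₂₁ * d₁₁.W * d₁₁.C)) d₁₁.β l₂₁ d₂₁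
  h₁₂ : IsFactored a (α⁻¹ • (d₁₁.C * (d₁₁.M * A.toBlocks₁₂))) d₁₁.β l₁₂ d₁₂
  h₂₂ : IsFactored a ((d₁₁.β ^ 2 * α)⁻¹ •
    (d₂₁.C * d₂₁.M * schurBlock A α d₁₁ * d₁₂.W * d₁₂.C)) (d₂₁.β / d₁₁.β * d₁₂.β) l₂₂ d₂₂

namespace BlockCalls

variable {a : ι → ℕ} {A : Matrix (ι ⊕ ι) (ι ⊕ ι) F} {α : F} {l₁₁ l₂₁ l₁₂ l₂₂ : List (ι × ι)}
  {d₁₁ d₂₁ d₁₂ d₂₂ : FactorData ι F}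

theorem ratio_ne (h : BlockCalls a A α l₁₁ l₂₁ l₁₂ l₂₂ d₁₁ d₂₁ d₁₂ d₂₂) :
    d₂₁.β / d₁₁.β ≠ 0 := div_ne_zero h.h₂₁.β_ne h.h₁₁.β_ne

/-- The call for the upper right block, with all its rows scaled as after the elimination of the
lower left block. -/
theorem scaled (h : BlockCalls a A α l₁₁ l₂₁ l₁₂ l₂₂ d₁₁ d₂₁ d₁₂ d₂₂) :
    IsFactored a ((d₂₁.β / d₁₁.β) • α⁻¹ • (d₁₁.C * (d₁₁.M * A.toBlocks₁₂))) d₂₁.β l₁₂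
      (d₁₂.scale (d₂₁.β / d₁₁.β)) := by
  have := h.h₁₂.scale h.ratio_ne
  rwa [div_mul_cancel₀ _ h.h₁₁.β_ne] at this

theorem disjoint_upper (h : BlockCalls a A α l₁₁ l₂₁ l₁₂ l₂₂ d₁₁ d₂₁ d₁₂ d₂₂) :
    DisjointLeft d₁₁.L d₁₁.P (d₁₂.scale (d₂₁.β / d₁₁.β)).L d₁₂.P :=
  h.h₁₁.disjointLeft h.scaled (by
    rw [mul_smul_comm, mul_smul_comm, ← mul_assoc, h.h₁₁.perm.P_C]
    simp)

theorem disjoint_lower (h : BlockCalls a A α l₁₁ l₂₁ l₁₂ l₂₂ d₁₁ d₂₁ d₁₂ d₂₂) :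
    DisjointLeft d₂₁.L d₂₁.P d₂₂.L d₂₂.P :=
  h.h₂₁.disjointLeft h.h₂₂ (by
    simp only [mul_smul_comm, ← mul_assoc, h.h₂₁.perm.P_C, zero_mul, smul_zero])

theorem disjoint_leftHalf (h : BlockCalls a A α l₁₁ l₂₁ l₁₂ l₂₂ d₁₁ d₂₁ d₁₂ d₂₂) :
    DisjointLeft d₁₁.Uᵀ d₁₁.Q d₂₁.Uᵀ d₂₁.Q :=
  h.h₁₁.disjointRight h.h₂₁ (by
    rw [smul_mul_assoc, mul_assoc, h.h₁₁.perm.C_Q, mul_zero, smul_zero])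

theorem disjoint_rightHalf (h : BlockCalls a A α l₁₁ l₂₁ l₁₂ l₂₂ d₁₁ d₂₁ d₁₂ d₂₂) :
    DisjointLeft (d₁₂.scale (d₂₁.β / d₁₁.β)).Uᵀ d₁₂.Q d₂₂.Uᵀ d₂₂.Q :=
  h.scaled.disjointRight h.h₂₂ (by
    change _ * d₁₂.Q = 0
    rw [smul_mul_assoc, mul_assoc, h.h₁₂.perm.C_Q, mul_zero, smul_zero])

/-- The four partial eliminations together are a complete elimination of the block matrix. -/
theorem elimination (h : BlockCalls a A α l₁₁ l₂₁ l₁₂ l₂₂ d₁₁ d₂₁ d₁₂ d₂₂) {a' : ι ⊕ ι → ℕ}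
    (hl : ∀ i j, a' (Sum.inl i) < a' (Sum.inl j) → a i < a j)
    (hr : ∀ i j, a' (Sum.inr i) < a' (Sum.inr j) → a i < a j)
    (hlr : ∀ i j, a' (Sum.inl i) < a' (Sum.inr j)) :
    ∃ l, Admissible a' a' A α l ∧ residual A α l = 0 ∧
      leftFactor A α l = fromBlocks (d₁₁.L * (d₁₂.scale (d₂₁.β / d₁₁.β)).L) 0
        (leftBlock A α d₁₁ d₂₁ d₁₂) (d₂₁.L * d₂₂.L) ∧
      rightFactor A α l = fromBlocks (d₂₁.U * d₁₁.U) (rightBlock A α d₁₁ d₂₁) 0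
        (d₂₂.U * (d₁₂.scale (d₂₁.β / d₁₁.β)).U) ∧
      pivotWeights A α l = fromBlocks d₁₁.S (d₁₂.scale (d₂₁.β / d₁₁.β)).S d₂₁.S d₂₂.S ∧
      lastPivot A α l = d₂₂.β := by
  obtain ⟨h₁₁, h₂₁, h₁₂, h₂₂⟩ := id h
  have h12s := h.scaled
  have hlam := h.ratio_ne
  have hα := h₁₁.α_ne
  have hβ1 := h₁₁.β_ne
  have hβ2 := h₂₁.β_ne
  have hβ12 := h₁₂.β_ne
  have dU := h.disjoint_upper.mul_eq
  have dL := h.disjoint_lower.mul_eq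
  have dl := h.disjoint_leftHalf.mul_eq
  have dr := h.disjoint_rightHalf.mul_eq
  rw [← transpose_mul, ← transpose_add, ← transpose_one, ← transpose_sub, transpose_inj] at dl dr
  have ninl : ∀ i : ι, Sum.inl i ∉ Set.range (Sum.inr : ι → ι ⊕ ι) := by simp
  have ninr : ∀ i : ι, Sum.inr i ∉ Set.range (Sum.inl : ι → ι ⊕ ι) := by simp
  have hrl : ∀ i j, ¬ a' (Sum.inr i) < a' (Sum.inl j) := fun i j => (hlr j i).asymm
  -- the first block
  have g1 := IsFactored.blockElimination (A := A) (f := Sum.inl) (g := Sum.inl) (f' := Sum.inr)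
    (g' := Sum.inr) h₁₁ Sum.inl_injective Sum.inl_injective Sum.inr_injective Sum.inr_injective
    ninr ninr
  have ad1 : Admissible a' a' A α (l₁₁.map (Prod.map Sum.inl Sum.inl)) := by
    refine Admissible.embed (a := a) (b := a) h₁₁.adm hl hl ?_ ?_
    · rintro (i | i) hi ⟨j, hj⟩
      · exact absurd ⟨i, rfl⟩ hi
      · exact absurd hj (hrl _ _)
    · rintro (i | i) hi ⟨j, hj⟩
      · exact absurd ⟨i, rfl⟩ hi
      · exact absurd hj (hrl _ _)
  set l1 := l₁₁.map (Prod.map (Sum.inl : ι → ι ⊕ ι) (Sum.inl : ι → ι ⊕ ι)) with hl1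
  set R1 := residual A α l1 with hR1
  have MX1 : d₁₁.M * A.toBlocks₁₂ = _ := g1.M_mul
  have XW1 : A.toBlocks₂₁ * d₁₁.W = _ := g1.mul_W
  have B12 : α⁻¹ • (d₁₁.C * (d₁₁.M * A.toBlocks₁₂)) = R1.submatrix Sum.inl Sum.inr := by
    rw [MX1, h₁₁.perm.C_mul_combination g1.Q_mul g1.P_mul, inv_smul_smul₀ hα]
  have B21 : α⁻¹ • (A.toBlocks₂₁ * d₁₁.W * d₁₁.C) = R1.submatrix Sum.inr Sum.inl := by
    rw [XW1, h₁₁.perm.combination_mul_C g1.mul_P g1.mul_Q, inv_smul_smul₀ hα]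
  -- Since `H` times `M` is `L⁻¹`, the two outer factors are `α V' S` and `α S V` up to residual
  -- terms, which `T` and the support of `V` remove. Thus `A₂₂0` is `(α β)² V' S V`, exactly the
  -- pivot part of `α β² A₂₂`.
  have hschur : schurBlock A α d₁₁ = α • R1.submatrix Sum.inr Sum.inr := by
    have e1 := h₁₁.perm.scaled_mul_combination (α := α) g1.Q_mul g1.P_mul hβ1
    have e2 := h₁₁.perm.combination_mul_scaled (α := α) g1.mul_P g1.mul_Q hβ1
    rw [← h₁₁.H_eq, ← MX1] at e1
    rw [← h₁₁.H_eq, ← XW1] at e2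
    have hA : A.toBlocks₂₂ = _ := g1.rest
    have hV := g1.Q_mul
    have hY := g1.P_mul
    have hY' := g1.mul_Q
    rw [schurBlock, e1, e2, hA]
    generalize (rightFactor A α l1).submatrix Sum.inl Sum.inr = V at *
    generalize (leftFactor A α l1).submatrix Sum.inr Sum.inl = V' at *
    rw [← hR1] at hY hY' ⊢
    generalize R1.submatrix Sum.inl Sum.inr = Y at *
    generalize R1.submatrix Sum.inr Sum.inl = Y' at *
    generalize R1.submatrix Sum.inr Sum.inr = Z at *
    have t1 : d₁₁.T * (α • (d₁₁.S * V) + (α / d₁₁.β) • Y) = α • V := by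
      rw [mul_add, mul_smul_comm, mul_smul_comm, ← mul_assoc, h₁₁.perm.T_mul, hV,
        ← h₁₁.perm.T_P, mul_assoc, hY]
      simp
    have t2 : (α • (V' * d₁₁.S) + (α / d₁₁.β) • Y') * V = α • (V' * d₁₁.S * V) := by
      have : Y' * V = 0 := by rw [← hV, ← mul_assoc, hY', zero_mul]
      rw [add_mul, smul_mul_assoc, smul_mul_assoc, this]
      simp
    rw [mul_assoc _ d₁₁.T, mul_smul_comm d₁₁.β d₁₁.T, t1, smul_mul_assoc, mul_smul_comm, mul_smul_comm,
      t2, smul_add, smul_sub, smul_add]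
    simp only [smul_smul]
    have c1 : (α * d₁₁.β)⁻¹ * (α * d₁₁.β ^ 2 * α) =
        (α * d₁₁.β)⁻¹ * (d₁₁.β * (d₁₁.β * (α * α))) := by ring
    have c2 : (α * d₁₁.β)⁻¹ * (α * d₁₁.β ^ 2 * (α / d₁₁.β)) = α := by field_simp
    rw [c1, c2]
    abel
  -- the lower left block
  rw [B21] at h₂₁
  have g2 := IsFactored.blockElimination (A := R1) (f := Sum.inr) (g := Sum.inl) (f' := Sum.inl)
    (g' := Sum.inr) h₂₁ Sum.inr_injective Sum.inl_injective Sum.inl_injective Sum.inr_injective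
    ninl ninr
  have R1z : R1.submatrix Sum.inl Sum.inl = 0 := g1.res
  have ad2 : Admissible a' a' R1 d₁₁.β (l₂₁.map (Prod.map Sum.inr Sum.inl)) := by
    refine Admissible.embed (a := a) (b := a) h₂₁.adm hr hl ?_ ?_
    · rintro (i | i) hi - j
      · exact congrFun₂ R1z i j
      · exact absurd ⟨i, rfl⟩ hi
    · rintro (i | i) hi ⟨j, hj⟩
      · exact absurd ⟨i, rfl⟩ hi
      · exact absurd hj (hrl _ _)
  set l2 := l₂₁.map (Prod.map (Sum.inr : ι → ι ⊕ ι) (Sum.inl : ι → ι ⊕ ι)) with hl2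
  set R2 := residual R1 d₁₁.β l2 with hR2
  -- The upper left block is already zero, so the pivots in the lower left block act on the upper
  -- rows only by the factor `λ`, the quotient of last pivots.
  obtain ⟨V2', Y2'⟩ := g2.eq_zero_of_left hβ1 hβ2 h₂₁.perm R1z
  have Z2 : R2.submatrix Sum.inl Sum.inr =
      (d₂₁.β / d₁₁.β) • α⁻¹ • (d₁₁.C * (d₁₁.M * A.toBlocks₁₂)) := by
    rw [B12, g2.rest, V2']
    simp only [zero_mul, smul_zero, zero_add, smul_smul]
    rw [div_mul_div_cancel₀ hβ1, div_self hβ2, one_smul]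
  -- the upper right block
  rw [← Z2] at h12s
  have g3 := IsFactored.blockElimination (A := R2) (f := Sum.inl) (g := Sum.inr) (f' := Sum.inr)
    (g' := Sum.inl) h12s Sum.inl_injective Sum.inr_injective Sum.inr_injective Sum.inl_injective
    ninr ninl
  have ad3 : Admissible a' a' R2 d₂₁.β (l₁₂.map (Prod.map Sum.inl Sum.inr)) := by
    refine Admissible.embed (a := a) (b := a) h12s.adm hl hr ?_ ?_
    · rintro (i | i) hi ⟨j, hj⟩
      · exact absurd ⟨i, rfl⟩ hi
      · exact absurd hj (hrl _ _)
    · rintro (i | i) hi - j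
      · exact congrFun₂ Y2' j i
      · exact absurd ⟨i, rfl⟩ hi
  set l3 := l₁₂.map (Prod.map (Sum.inl : ι → ι ⊕ ι) (Sum.inr : ι → ι ⊕ ι)) with hl3
  set R3 := residual R2 d₂₁.β l3 with hR3
  -- Both left blocks are zero by now and remain so; hence the pivots of the last block will have
  -- zeros before them in their rows.
  obtain ⟨V3, Y3⟩ := g3.eq_zero_of_right hβ2 h12s.β_ne h12s.perm Y2'
  have Z3 : R3.submatrix Sum.inr Sum.inl = 0 := by
    have e := g3.rest
    have e0 : R2.submatrix Sum.inr Sum.inl = 0 := g2.res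
    rw [V3, e0, mul_zero, smul_zero, zero_add] at e
    exact (smul_eq_zero.1 e.symm).resolve_left (div_ne_zero hβ2 h12s.β_ne)
  have CMS : d₂₁.C * d₂₁.M * schurBlock A α d₁₁ =
      (α * d₁₁.β) • R2.submatrix Sum.inr Sum.inr := by
    rw [hschur, mul_smul_comm, mul_assoc, g2.M_mul,
      h₂₁.perm.C_mul_combination g2.Q_mul g2.P_mul, smul_smul]
  have hs3 : (d₁₂.scale (d₂₁.β / d₁₁.β)).β = d₂₁.β / d₁₁.β * d₁₂.β := rfl
  have YW : (d₂₁.β / d₁₁.β) • (R2.submatrix Sum.inr Sum.inr * d₁₂.W) = _ :=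
    (mul_smul_comm _ _ _).symm.trans g3.mul_W
  -- The algorithm multiplies by the `W` of the unscaled call, whereas the elimination uses the
  -- scaled one, which is `λ` times larger.
  have YW' := congrArg ((d₂₁.β / d₁₁.β)⁻¹ • ·) YW
  simp only [inv_smul_smul₀ hlam] at YW'
  have A223 : (d₁₁.β ^ 2 * α)⁻¹ • (d₂₁.C * d₂₁.M * schurBlock A α d₁₁ * d₁₂.W * d₁₂.C) =
      R3.submatrix Sum.inr Sum.inr := by
    have e := h12s.perm.combination_mul_C g3.mul_P g3.mul_Q d₂₁.β
      (d₁₂.scale (d₂₁.β / d₁₁.β)).β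
    have e' : (d₁₂.scale (d₂₁.β / d₁₁.β)).C = d₁₂.C := rfl
    rw [CMS, smul_mul_assoc, YW', smul_mul_assoc, smul_mul_assoc, ← e', e]
    simp only [smul_smul]
    have : (d₁₁.β ^ 2 * α)⁻¹ * (α * d₁₁.β * ((d₂₁.β / d₁₁.β)⁻¹ * d₂₁.β)) = 1 := by
      field_simp
    rw [this, one_smul]
  -- the lower right block
  rw [A223, ← hs3] at h₂₂
  have g4 := IsFactored.blockElimination (A := R3) (f := Sum.inr) (g := Sum.inr) (f' := Sum.inl)
    (g' := Sum.inl) h₂₂ Sum.inr_injective Sum.inr_injective Sum.inl_injective Sum.inl_injective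
    ninl ninl
  have R3z : R3.submatrix Sum.inl Sum.inr = 0 := g3.res
  have ad4 : Admissible a' a' R3 (d₁₂.scale (d₂₁.β / d₁₁.β)).β
      (l₂₂.map (Prod.map Sum.inr Sum.inr)) := by
    refine Admissible.embed (a := a) (b := a) h₂₂.adm hr hr ?_ ?_
    · rintro (i | i) hi - j
      · exact congrFun₂ R3z i j
      · exact absurd ⟨i, rfl⟩ hi
    · rintro (i | i) hi - j
      · exact congrFun₂ Z3 j i
      · exact absurd ⟨i, rfl⟩ hi
  set l4 := l₂₂.map (Prod.map (Sum.inr : ι → ι ⊕ ι) (Sum.inr : ι → ι ⊕ ι)) with hl4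
  obtain ⟨V4, Y4⟩ := g4.eq_zero_of_right h12s.β_ne h₂₂.β_ne h₂₂.perm Z3
  obtain ⟨V4', Y4'⟩ := g4.eq_zero_of_left h12s.β_ne h₂₂.β_ne h₂₂.perm R3z
  have Z4 : (residual R3 (d₁₂.scale (d₂₁.β / d₁₁.β)).β l4).submatrix Sum.inl Sum.inl = 0 := by
    have e := g4.rest
    rw [V4, Y3, mul_zero, smul_zero, zero_add] at e
    exact (smul_eq_zero.1 e.symm).resolve_left (div_ne_zero h12s.β_ne h₂₂.β_ne)
  have L3 : leftBlock A α d₁₁ d₂₁ d₁₂ = (leftFactor A α l1).submatrix Sum.inr Sum.inl +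
      (leftFactor R2 d₂₁.β l3).submatrix Sum.inr Sum.inl := by
    have e := h12s.perm.combination_mul_P (Y := R3.submatrix Sum.inr Sum.inr) g3.mul_P d₂₁.β
      (d₁₂.scale (d₂₁.β / d₁₁.β)).β
    have e' : (d₁₂.scale (d₂₁.β / d₁₁.β)).P = d₁₂.P := rfl
    rw [leftBlock, XW1, h₁₁.perm.combination_mul_P g1.mul_P, inv_smul_smul₀ hβ1, CMS,
      smul_mul_assoc, YW', smul_mul_assoc, smul_mul_assoc, ← e', e, hs3]
    simp only [smul_smul]
    have : (d₁₂.β * d₁₁.β * α)⁻¹ *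
        (α * d₁₁.β * ((d₂₁.β / d₁₁.β)⁻¹ * (d₂₁.β / d₁₁.β * d₁₂.β))) = 1 := by
      field_simp
    rw [this, one_smul]
  have U2 : rightBlock A α d₁₁ d₂₁ = (rightFactor A α l1).submatrix Sum.inl Sum.inr +
      (rightFactor R1 d₁₁.β l2).submatrix Sum.inl Sum.inr := by
    rw [rightBlock, mul_assoc, MX1, h₁₁.perm.Q_mul_combination g1.Q_mul, inv_smul_smul₀ hβ1,
      hschur, mul_smul_comm, mul_assoc, g2.M_mul, h₂₁.perm.Q_mul_combination g2.Q_mul,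
      smul_smul, smul_smul]
    have : (d₂₁.β * α)⁻¹ * (α * d₂₁.β) = 1 := by field_simp
    rw [mul_assoc, this, one_smul]
  have la1 : lastPivot A α l1 = d₁₁.β := g1.last
  have la2 : lastPivot R1 d₁₁.β l2 = d₂₁.β := g2.last
  have la3 : lastPivot R2 d₂₁.β l3 = (d₁₂.scale (d₂₁.β / d₁₁.β)).β := g3.last
  have la4 := g4.last
  refine ⟨l1 ++ (l2 ++ (l3 ++ l4)), ?_, ?_, ?_, ?_, ?_, ?_⟩
  · simp only [admissible_append, la1, ← hR1, la2, ← hR2, la3, ← hR3]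
    exact ⟨ad1, ad2, ad3, ad4⟩
  · simp only [residual_append, la1, ← hR1, la2, ← hR2, la3, ← hR3]
    rw [eq_fromBlocks_submatrix (residual _ _ _), g4.res, Y4, Y4', Z4, fromBlocks_zero]
  · simp only [leftFactor_append, la1, ← hR1, la2, ← hR2, la3, ← hR3]
    have F1 : leftFactor A α l1 =
        fromBlocks d₁₁.L 0 ((leftFactor A α l1).submatrix Sum.inr Sum.inl) 1 := by
      conv_lhs => rw [eq_fromBlocks_submatrix (leftFactor A α l1), g1.L_ff, g1.L_fo, g1.L_oo]
    have F2 : leftFactor R1 d₁₁.β l2 = fromBlocks 1 0 0 d₂₁.L := by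
      rw [eq_fromBlocks_submatrix (leftFactor R1 d₁₁.β l2), g2.L_ff, g2.L_fo, g2.L_oo, V2']
    have F3 : leftFactor R2 d₂₁.β l3 = fromBlocks (d₁₂.scale (d₂₁.β / d₁₁.β)).L 0
        ((leftFactor R2 d₂₁.β l3).submatrix Sum.inr Sum.inl) 1 := by
      conv_lhs => rw [eq_fromBlocks_submatrix (leftFactor R2 d₂₁.β l3), g3.L_ff, g3.L_fo, g3.L_oo]
    have F4 : leftFactor R3 (d₁₂.scale (d₂₁.β / d₁₁.β)).β l4 = fromBlocks 1 0 0 d₂₂.L := by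
      rw [eq_fromBlocks_submatrix (leftFactor R3 _ l4), g4.L_ff, g4.L_fo, g4.L_oo, V4']
    rw [dU, dL, L3]
    conv_lhs => rw [F1, F2, F3, F4]
    rw [← fromBlocks_one]
    simp only [sub_eq_add_neg, fromBlocks_add, fromBlocks_neg]
    congr 1
    · abel
    · abel
    · abel
    · abel
  · simp only [rightFactor_append, la1, ← hR1, la2, ← hR2, la3, ← hR3]
    have F1 : rightFactor A α l1 =
        fromBlocks d₁₁.U ((rightFactor A α l1).submatrix Sum.inl Sum.inr) 0 1 := by
      conv_lhs => rw [eq_fromBlocks_submatrix (rightFactor A α l1), g1.U_gg, g1.U_og, g1.U_oo]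
    have F2 : rightFactor R1 d₁₁.β l2 =
        fromBlocks d₂₁.U ((rightFactor R1 d₁₁.β l2).submatrix Sum.inl Sum.inr) 0 1 := by
      conv_lhs => rw [eq_fromBlocks_submatrix (rightFactor R1 d₁₁.β l2), g2.U_gg, g2.U_og, g2.U_oo]
    have F3 : rightFactor R2 d₂₁.β l3 =
        fromBlocks 1 0 0 (d₁₂.scale (d₂₁.β / d₁₁.β)).U := by
      rw [eq_fromBlocks_submatrix (rightFactor R2 d₂₁.β l3), g3.U_gg, g3.U_og, g3.U_oo, V3]
    have F4 : rightFactor R3 (d₁₂.scale (d₂₁.β / d₁₁.β)).β l4 = fromBlocks 1 0 0 d₂₂.U := by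
      rw [eq_fromBlocks_submatrix (rightFactor R3 _ l4), g4.U_gg, g4.U_og, g4.U_oo, V4]
    rw [dl, dr, U2]
    conv_lhs => rw [F1, F2, F3, F4]
    rw [← fromBlocks_one]
    simp only [sub_eq_add_neg, fromBlocks_add, fromBlocks_neg]
    congr 1
    · abel
    · abel
    · abel
    · abel
  · simp only [pivotWeights_append, la1, ← hR1, la2, ← hR2, la3, ← hR3]
    rw [eq_fromBlocks_submatrix (pivotWeights A α l1), g1.S_fg, g1.S_fo, g1.S_og, g1.S_oo,
      eq_fromBlocks_submatrix (pivotWeights R1 _ l2), g2.S_fg, g2.S_fo, g2.S_og, g2.S_oo,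
      eq_fromBlocks_submatrix (pivotWeights R2 _ l3), g3.S_fg, g3.S_fo, g3.S_og, g3.S_oo,
      eq_fromBlocks_submatrix (pivotWeights R3 _ l4), g4.S_fg, g4.S_fo, g4.S_og, g4.S_oo]
    simp only [fromBlocks_add, add_zero, zero_add]
  · simp only [lastPivot_append, la1, ← hR1, la2, ← hR2, la3, ← hR3, la4]

end BlockCalls

end BlockStep

/-! ### The matrices `M` and `W` of the recursive step -/

section Inverse

variable {F : Type*} [Field F] {ι : Type*} [DecidableEq ι] [Fintype ι]

/-- The matrix `M` of the recursive step. -/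
def assembledM (α : F) (d₁₁ d₂₁ d₁₂ d₂₂ : FactorData ι F) (L₃ : Matrix ι ι F)
    (E' : Matrix (ι ⊕ ι) (ι ⊕ ι) F) : Matrix (ι ⊕ ι) (ι ⊕ ι) F :=
  α⁻¹ • (fromBlocks
      (E'.toBlocks₁₁ * d₁₂.C * d₁₂.M * (α • d₁₁.E + α • d₁₁.C) * d₁₁.M)
      (E'.toBlocks₁₂ * d₂₂.C * d₂₂.M * (d₁₁.β • d₂₁.E + α • d₂₁.C) * d₂₁.M)
      (E'.toBlocks₂₁ * (d₂₁.β • d₁₂.E + α • d₁₂.C) * d₁₂.M * d₁₁.C * d₁₁.M)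
      (E'.toBlocks₂₂ * ((d₂₁.β / d₁₁.β * d₁₂.β) • d₂₂.E + α • d₂₂.C) * d₂₂.M * d₂₁.C * d₂₁.M) *
    fromBlocks ((d₂₂.β / (d₁₂.β * d₁₁.β)) • 1) 0
      (-(d₂₁.β⁻¹ • (L₃ * ((d₂₁.β / d₁₁.β)⁻¹ • d₁₂.P + (1 - d₁₂.P)) * d₁₂.H * d₁₂.M *
        d₁₁.H * d₁₁.M))) (d₂₁.β⁻¹ • 1))

/-- The matrix `W` of the recursive step. -/
def assembledW (α : F) (d₁₁ d₂₁ d₁₂ d₂₂ : FactorData ι F) (U₂ : Matrix ι ι F)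
    (E' : Matrix (ι ⊕ ι) (ι ⊕ ι) F) : Matrix (ι ⊕ ι) (ι ⊕ ι) F :=
  α⁻¹ • (fromBlocks ((d₂₂.β / (d₁₁.β * d₂₁.β)) • 1)
      (-(d₁₂.β⁻¹ • (d₁₁.W * d₁₁.H * d₂₁.W * d₂₁.H * U₂))) 0 (d₁₂.β⁻¹ • 1) *
    fromBlocks
      (d₁₁.W * (α • d₁₁.E + α • d₁₁.C) * d₂₁.W * d₂₁.C * E'.toBlocks₁₁)
      (d₁₁.W * d₁₁.C * d₂₁.W * (d₁₁.β • d₂₁.E + α • d₂₁.C) * E'.toBlocks₁₂)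
      (d₁₂.W * (d₂₁.β • d₁₂.E + α • d₁₂.C) * d₂₂.W * d₂₂.C * E'.toBlocks₂₁)
      (d₁₂.W * d₁₂.C * d₂₂.W * ((d₂₁.β / d₁₁.β * d₁₂.β) • d₂₂.E + α • d₂₂.C) * E'.toBlocks₂₂))

theorem assembledInverse_smul_left (α β β₁ β₂ c : F) (N₁₁ N₁₂ N₂₁ N₂₂ K : Matrix ι ι F) :
    assembledInverse α β β₁ β₂ (c • N₁₁) N₁₂ (c • N₂₁) N₂₂ K =
      α⁻¹ • (fromBlocks N₁₁ N₁₂ N₂₁ N₂₂ *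
        fromBlocks ((c * (β / β₁)) • 1) 0 (-((β / β₂) • K)) ((β / β₂) • 1)) := by
  rw [assembledInverse, fromBlocks_multiply, fromBlocks_multiply]
  congr 2 <;> simp [smul_smul, mul_comm]

theorem assembledInverse_smul_right (α β β₁ β₂ c : F) (N₁₁ N₁₂ N₂₁ N₂₂ K : Matrix ι ι F) :
    assembledInverse α β β₁ β₂ N₁₁ (c • N₁₂) N₂₁ (c • N₂₂) K =
      α⁻¹ • (fromBlocks N₁₁ N₁₂ N₂₁ N₂₂ *
        fromBlocks ((β / β₁) • 1) 0 (-((c * (β / β₂)) • K)) ((c * (β / β₂)) • 1)) := by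
  rw [assembledInverse, fromBlocks_multiply, fromBlocks_multiply]
  congr 2 <;> simp [smul_smul, mul_comm]

namespace BlockCalls

variable {a : ι → ℕ} {A : Matrix (ι ⊕ ι) (ι ⊕ ι) F} {α : F} {l₁₁ l₂₁ l₁₂ l₂₂ : List (ι × ι)}
  {d₁₁ d₂₁ d₁₂ d₂₂ : FactorData ι F} {S C P Q : Matrix (ι ⊕ ι) (ι ⊕ ι) F}

theorem scale_H_mul_M (c : F) (hc : c ≠ 0) (d : FactorData ι F) :
    (d.scale c).H * (d.scale c).M = (c⁻¹ • d.P + (1 - d.P)) * d.H * d.M := by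
  change c⁻¹ • ((c⁻¹ • d.P + (1 - d.P)) * d.H) * (c • d.M) = _
  rw [smul_mul_smul_comm, inv_mul_cancel₀ hc, one_smul]

/-- `mul_assembledInverse` applies to the call 12 scaled by `λ`. Its `M` is `λ` times that of the
call, and this `λ` moves into the first diagonal entry of the triangular factor. -/
theorem mul_assembledM (h : BlockCalls a A α l₁₁ l₂₁ l₁₂ l₂₂ d₁₁ d₂₁ d₁₂ d₂₂)
    (hp : ComplementedPermutation S (fromBlocks d₁₁.E d₁₂.E d₂₁.E d₂₂.E)
      (fromBlocks d₁₁.T d₂₁.T (d₁₂.scale (d₂₁.β / d₁₁.β)).T d₂₂.T) C P Q) (L₃ : Matrix ι ι F) :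
    fromBlocks (d₁₁.L * (d₁₂.scale (d₂₁.β / d₁₁.β)).L) 0 L₃ (d₂₁.L * d₂₂.L) *
      (d₂₂.β⁻¹ • (α • S + C)) *
      assembledM α d₁₁ d₂₁ d₁₂ d₂₂ L₃ ((fromBlocks d₁₁.E d₁₂.E d₂₁.E d₂₂.E + C)ᵀ) = 1 := by
  have key := mul_assembledInverse (L₃ := L₃) h.h₁₁.left h.scaled.left h.h₂₁.left h.h₂₂.left
    h.disjoint_upper h.disjoint_lower h.disjoint_leftHalf.ab h.disjoint_rightHalf.ab hp
    h.h₁₁.α_ne h.h₂₂.β_ne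
  rw [scale_H_mul_M _ h.ratio_ne] at key
  rw [← key]
  congr 1
  have e1 : (d₁₂.scale (d₂₁.β / d₁₁.β)).M = (d₂₁.β / d₁₁.β) • d₁₂.M := rfl
  have e2 : (d₁₂.scale (d₂₁.β / d₁₁.β)).C = d₁₂.C := rfl
  have e3 : (d₁₂.scale (d₂₁.β / d₁₁.β)).E = d₁₂.E := rfl
  have e4 : (d₁₂.scale (d₂₁.β / d₁₁.β)).β = (d₂₁.β / d₁₁.β) * d₁₂.β := rfl
  simp only [e1, e2, e3, e4, mul_smul_comm, smul_mul_assoc]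
  rw [assembledInverse_smul_left, assembledM]
  have h1 := h.h₁₁.β_ne
  have h2 := h.h₂₁.β_ne
  have h3 := h.h₁₂.β_ne
  have h4 := h.h₂₂.β_ne
  have c1 : d₂₁.β / d₁₁.β * (d₂₂.β / (d₁₁.β * (d₂₁.β / d₁₁.β * d₁₂.β))) =
      d₂₂.β / (d₁₂.β * d₁₁.β) := by field_simp
  have c2 : d₂₂.β / (d₂₁.β * d₂₂.β) = d₂₁.β⁻¹ := by field_simp
  rw [c1, c2]
  simp only [mul_assoc]

/-- The transpose of the statement for `M`, with the calls 12 and 21 interchanged. The scaled call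
is now in the second block column of `assembledInverse`, so `λ` is absorbed by the second row of the
triangular factor. -/
theorem assembledW_mul (h : BlockCalls a A α l₁₁ l₂₁ l₁₂ l₂₂ d₁₁ d₂₁ d₁₂ d₂₂)
    (hp : ComplementedPermutation S (fromBlocks d₁₁.E d₁₂.E d₂₁.E d₂₂.E)
      (fromBlocks d₁₁.T d₂₁.T (d₁₂.scale (d₂₁.β / d₁₁.β)).T d₂₂.T) C P Q) (U₂ : Matrix ι ι F) :
    assembledW α d₁₁ d₂₁ d₁₂ d₂₂ U₂ ((fromBlocks d₁₁.E d₁₂.E d₂₁.E d₂₂.E + C)ᵀ) *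
      (d₂₂.β⁻¹ • (α • S + C)) *
      fromBlocks (d₂₁.U * d₁₁.U) U₂ 0 (d₂₂.U * (d₁₂.scale (d₂₁.β / d₁₁.β)).U) = 1 := by
  have hpt := hp.transpose
  rw [fromBlocks_transpose, fromBlocks_transpose] at hpt
  have key := mul_assembledInverse (L₃ := U₂ᵀ) h.h₁₁.right h.h₂₁.right h.scaled.right h.h₂₂.right
    h.disjoint_leftHalf h.disjoint_rightHalf h.disjoint_upper.ab h.disjoint_lower.ab hpt
    h.h₁₁.α_ne h.h₂₂.β_ne
  rw [← transpose_inj, transpose_mul, transpose_mul, transpose_one, ← key, ← mul_assoc]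
  congr 1
  · congr 1
    rw [fromBlocks_transpose, transpose_mul, transpose_mul, transpose_zero]
  have e1 : (d₁₂.scale (d₂₁.β / d₁₁.β)).Wᵀ = (d₂₁.β / d₁₁.β) • d₁₂.Wᵀ := rfl
  have e2 : (d₁₂.scale (d₂₁.β / d₁₁.β)).C = d₁₂.C := rfl
  have e3 : (d₁₂.scale (d₂₁.β / d₁₁.β)).E = d₁₂.E := rfl
  have e4 : (d₁₂.scale (d₂₁.β / d₁₁.β)).β = (d₂₁.β / d₁₁.β) * d₁₂.β := rfl
  simp only [e1, e2, e3, e4, mul_smul_comm]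
  rw [assembledInverse_smul_right, assembledW, transpose_smul, transpose_mul,
    fromBlocks_transpose, fromBlocks_transpose]
  have h1 := h.h₁₁.β_ne
  have h2 := h.h₂₁.β_ne
  have h3 := h.h₁₂.β_ne
  have h4 := h.h₂₂.β_ne
  have c1 : d₂₁.β / d₁₁.β * (d₂₂.β / (d₂₁.β / d₁₁.β * d₁₂.β * d₂₂.β)) = d₁₂.β⁻¹ := by
    field_simp
  rw [c1]
  have hE : fromBlocks d₁₁.Eᵀ d₂₁.Eᵀ d₁₂.Eᵀ d₂₂.Eᵀ = (fromBlocks d₁₁.E d₁₂.E d₂₁.E d₂₂.E)ᵀ := by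
    rw [fromBlocks_transpose]
  rw [hE, ← transpose_add]
  simp only [transpose_mul, transpose_smul, transpose_neg, transpose_one, transpose_zero,
    transpose_add, mul_assoc]
  rfl

end BlockCalls

end Inverse

/-! ### The weights of an elimination form a weighted permutation -/

section FinElimination

variable {F : Type*} [Field F] {n : ℕ} {a b : Fin n → ℕ} {A : Matrix (Fin n) (Fin n) F} {α : F}
  {l : List (Fin n × Fin n)}

theorem Admissible.pivotWeights_ne_zero_iff {m n : Type*} [DecidableEq m] [DecidableEq n]
    {a : m → ℕ} {b : n → ℕ} {A : Matrix m n F} {α : F} {l : List (m × n)}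
    (hl : Admissible a b A α l) (hα : α ≠ 0) {i : m} {j : n} :
    pivotWeights A α l i j ≠ 0 ↔ (i, j) ∈ l := by
  constructor
  · exact fun h => by_contra fun h' => h (pivotWeights_eq_zero A α h')
  · intro h
    obtain ⟨t, ht, he⟩ := List.getElem_of_mem h
    have hp : ∀ s, lastPivot A α (l.take s) ≠ 0 := fun s => by
      rw [← List.take_append_drop s l, admissible_append] at hl
      exact hl.1.lastPivot_ne_zero hα
    have := hl.pivotWeights_getElem ht
    rw [he] at this
    rw [this]
    exact inv_ne_zero (mul_ne_zero (hp _) (hp _))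

theorem Admissible.isWeightedPermutation (hl : Admissible a b A α l) (hα : α ≠ 0) :
    IsWeightedPermutation (pivotWeights A α l) := by
  constructor
  · intro i j j' h h'
    rw [hl.pivotWeights_ne_zero_iff hα] at h h'
    exact congrArg Prod.snd (List.inj_on_of_nodup_map hl.nodup_fst h h' rfl)
  · intro i i' j h h'
    rw [hl.pivotWeights_ne_zero_iff hα] at h h'
    exact congrArg Prod.fst (List.inj_on_of_nodup_map hl.nodup_snd h h' rfl)

theorem Admissible.rowProj_eq (hl : Admissible a b A α l) (hα : α ≠ 0) :
    rowProj (pivotWeights A α l) = countDiag F (l.map Prod.fst) := by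
  classical
  rw [(hl.isWeightedPermutation hα).rowProj_eq, countDiag_of_nodup hl.nodup_fst]
  congr 1
  ext i
  have : ZeroRow (pivotWeights A α l) i ↔ i ∉ l.map Prod.fst := by
    rw [← not_iff_not, not_not, ZeroRow, not_forall]
    simp only [hl.pivotWeights_ne_zero_iff hα]
    simp
  by_cases h : i ∈ l.map Prod.fst
  · rw [if_pos h, if_neg (fun h' => this.1 h' h)]
  · rw [if_neg h, if_pos (this.2 h)]

theorem Admissible.colProj_eq (hl : Admissible a b A α l) (hα : α ≠ 0) :
    colProj (pivotWeights A α l) = countDiag F (l.map Prod.snd) := by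
  rw [← rowProj_transpose, ← pivotWeights_transpose, hl.transpose.rowProj_eq hα, map_fst_map_swap]

end FinElimination

/-! ### Induction over the recursive procedure -/

section Recursion

variable {F : Type*} [Field F]

/-- The output of the procedure with the matrices derived from `S`. -/
def Output.data {n : ℕ} (o : Output F n) : FactorData (Fin n) F where
  L := o.L
  S := o.S
  U := o.U
  M := o.M
  H := o.Shat
  W := o.W
  E := unitMap o.S
  T := pinv o.S
  C := compl o.S
  P := rowProj o.S
  Q := colProj o.S
  β := o.αr

/-- It suffices to check the defining identities of the output. -/
theorem isFactored_of_elimination {n : ℕ} {A : Matrix (Fin n) (Fin n) F} {α : F}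
    {l : List (Fin n × Fin n)} {o : Output F n} (hα : α ≠ 0)
    (adm : Admissible Fin.val Fin.val A α l) (res : residual A α l = 0)
    (L_eq : o.L = leftFactor A α l) (U_eq : o.U = rightFactor A α l)
    (S_eq : o.S = pivotWeights A α l) (β_eq : o.αr = lastPivot A α l)
    (H_eq : o.Shat = o.αr⁻¹ • (α • o.S + compl o.S)) (LHM : o.L * o.Shat * o.M = 1)
    (WHU : o.W * o.Shat * o.U = 1) : IsFactored Fin.val A α l o.data where
  α_ne := hα
  adm := adm
  res := res
  L_eq := L_eq
  U_eq := U_eq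
  S_eq := S_eq
  β_eq := β_eq
  P_eq := by
    change rowProj o.S = _
    rw [S_eq, adm.rowProj_eq hα]
  Q_eq := by
    change colProj o.S = _
    rw [S_eq, adm.colProj_eq hα]
  perm := by
    have : IsWeightedPermutation o.S := by
      rw [S_eq]
      exact adm.isWeightedPermutation hα
    exact this.complementedPermutation
  H_eq := H_eq
  LHM := LHM
  WHU := WHU

theorem compl_zero {n : ℕ} : compl (0 : Matrix (Fin n) (Fin n) F) = 1 := by
  classical
  ext i j
  by_cases hij : i = j
  · subst hij
    simp [compl, ZeroRow, ZeroCol]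
  · have : (Finset.univ.filter fun a => a < i).card ≠ (Finset.univ.filter fun a => a < j).card := by
      rw [Finset.filter_gt_eq_Iio, Finset.filter_gt_eq_Iio, Fin.card_Iio, Fin.card_Iio]
      exact fun h => hij (Fin.ext h)
    simp [compl, ZeroRow, ZeroCol, this, hij]

theorem isFactored_zeroOutput {n : ℕ} {α : F} (hα : α ≠ 0) :
    IsFactored Fin.val (0 : Matrix (Fin n) (Fin n) F) α [] (zeroOutput n α).data := by
  refine isFactored_of_elimination hα trivial rfl ?_ ?_ rfl rfl ?_ ?_ ?_
  · simp [zeroOutput, leftFactor, pivotCols, countDiag]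
  · simp [zeroOutput, rightFactor, pivotRows, pivotCols, countDiag]
  · simp [zeroOutput, compl_zero]
  · simp [zeroOutput, smul_smul, hα]
  · simp [zeroOutput, smul_smul, hα]

theorem isFactored_oneOutput {n : ℕ} [Unique (Fin n)] {A : Matrix (Fin n) (Fin n) F} {α : F}
    (hα : α ≠ 0) (hA : A default default ≠ 0) :
    IsFactored Fin.val A α [(default, default)] (oneOutput n (A default default) α).data := by
  refine isFactored_of_elimination hα ?_ ?_ ?_ ?_ ?_ rfl ?_ ?_ ?_
  · refine ⟨hA, fun u hu => ?_, fun u hu => ?_, trivial⟩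
    · rw [Subsingleton.elim u default] at hu
      exact absurd hu (lt_irrefl _)
    · rw [Subsingleton.elim u default] at hu
      exact absurd hu (lt_irrefl _)
  · ext i j
    rw [Subsingleton.elim i default, Subsingleton.elim j default]
    simp [residual, pivotStep]
  · ext i j
    rw [Subsingleton.elim i default, Subsingleton.elim j default]
    simp [oneOutput, leftFactor, pivotCols, pivotColumn, countDiag]
  · ext i j
    rw [Subsingleton.elim i default, Subsingleton.elim j default]
    simp [oneOutput, rightFactor, pivotRows, pivotCols, pivotColumn, countDiag]
  · ext i j
    rw [Subsingleton.elim i default, Subsingleton.elim j default]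
    simp [oneOutput, pivotWeights]
  · have : compl (oneOutput n (A default default) α).S = 0 := by
      ext i j
      have : ¬ ZeroRow (oneOutput n (A default default) α).S i := fun h => by
        have := h j
        simp [oneOutput, hα, hA] at this
      simp [compl, this]
    rw [this]
    ext i j
    simp [oneOutput]
    field_simp
  · ext i j
    rw [Subsingleton.elim i default, Subsingleton.elim j default]
    simp [oneOutput, Matrix.mul_apply]
    field_simp
  · ext i j
    rw [Subsingleton.elim i default, Subsingleton.elim j default]
    simp [oneOutput, Matrix.mul_apply]
    field_simp

section Glue

variable {p : ℕ}

theorem split_glue (A₁₁ A₁₂ A₂₁ A₂₂ : Matrix (Fin (2 ^ p)) (Fin (2 ^ p)) F) :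
    split (glue A₁₁ A₁₂ A₂₁ A₂₂) = fromBlocks A₁₁ A₁₂ A₂₁ A₂₂ := by
  simp [split, glue]

theorem unitMap_apply_congr {n n' : ℕ} {S : Matrix (Fin n) (Fin n) F}
    {T : Matrix (Fin n') (Fin n') F} {i j : Fin n} {i' j' : Fin n'} (h : S i j = T i' j') :
    unitMap S i j = unitMap T i' j' := by
  rw [unitMap, unitMap, of_apply, of_apply, h]

theorem split_unitMap_glue (A₁₁ A₁₂ A₂₁ A₂₂ : Matrix (Fin (2 ^ p)) (Fin (2 ^ p)) F) :
    split (unitMap (glue A₁₁ A₁₂ A₂₁ A₂₂)) =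
      fromBlocks (unitMap A₁₁) (unitMap A₁₂) (unitMap A₂₁) (unitMap A₂₂) := by
  have h := congrFun₂ (split_glue A₁₁ A₁₂ A₂₁ A₂₂)
  ext (i | i) (j | j)
  exacts [unitMap_apply_congr (h (Sum.inl i) (Sum.inl j)),
    unitMap_apply_congr (h (Sum.inl i) (Sum.inr j)),
    unitMap_apply_congr (h (Sum.inr i) (Sum.inl j)),
    unitMap_apply_congr (h (Sum.inr i) (Sum.inr j))]

theorem split_pinv_glue (A₁₁ A₁₂ A₂₁ A₂₂ : Matrix (Fin (2 ^ p)) (Fin (2 ^ p)) F) :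
    split (pinv (glue A₁₁ A₁₂ A₂₁ A₂₂)) =
      fromBlocks (pinv A₁₁) (pinv A₂₁) (pinv A₁₂) (pinv A₂₂) := by
  ext (i | i) (j | j) <;> simp [split, glue, pinv]

theorem unitMap_smul {n : ℕ} {c : F} (hc : c ≠ 0) (S : Matrix (Fin n) (Fin n) F) :
    unitMap (c • S) = unitMap S := by
  ext i j
  by_cases h : S i j = 0 <;> simp [unitMap, hc, h]

theorem pinv_smul {n : ℕ} (c : F) (S : Matrix (Fin n) (Fin n) F) :
    pinv (c⁻¹ • S) = c • pinv S := by
  ext i j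
  simp [pinv, mul_comm]

theorem split_injective : Function.Injective (split (F := F) (p := p)) := by
  intro A B h
  ext i j
  simpa [split] using congrFun₂ h ((halves p).symm i) ((halves p).symm j)

theorem split_mul (A B : Matrix (Fin (2 ^ (p + 1))) (Fin (2 ^ (p + 1))) F) :
    split (A * B) = split A * split B := by
  rw [split, split, split, submatrix_mul_equiv]

theorem split_one : split (1 : Matrix (Fin (2 ^ (p + 1))) (Fin (2 ^ (p + 1))) F) = 1 := by
  simp [split]

theorem halves_inl (i : Fin (2 ^ p)) : (halves p (Sum.inl i)).val = i.val := rfl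

theorem halves_inr (i : Fin (2 ^ p)) : (halves p (Sum.inr i)).val = 2 ^ p + i.val := rfl

end Glue

/-- All block statements hold over the index type `Fin (2 ^ p) ⊕ Fin (2 ^ p)`; they are transported
along `halves`, which places the left summand before the right one. -/
theorem exists_isFactored_blockStep {p : ℕ}
    {rec : Matrix (Fin (2 ^ p)) (Fin (2 ^ p)) F → F → Output F (2 ^ p)}
    (hrec : ∀ B β, β ≠ 0 → ∃ l, IsFactored Fin.val B β l (rec B β).data)
    (A : Matrix (Fin (2 ^ (p + 1))) (Fin (2 ^ (p + 1))) F) {α : F} (hα : α ≠ 0) :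
    ∃ l, IsFactored Fin.val A α l (blockStep rec A α).data := by
  obtain ⟨l₁₁, h₁₁⟩ := hrec (split A).toBlocks₁₁ α hα
  set o₁₁ := rec (split A).toBlocks₁₁ α with ho₁₁
  obtain ⟨l₂₁, h₂₁⟩ := hrec (α⁻¹ • ((split A).toBlocks₂₁ * o₁₁.W * compl o₁₁.S)) o₁₁.αr h₁₁.β_ne
  set o₂₁ := rec (α⁻¹ • ((split A).toBlocks₂₁ * o₁₁.W * compl o₁₁.S)) o₁₁.αr with ho₂₁
  obtain ⟨l₁₂, h₁₂⟩ := hrec (α⁻¹ • (compl o₁₁.S * (o₁₁.M * (split A).toBlocks₁₂))) o₁₁.αr h₁₁.β_ne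
  set o₁₂ := rec (α⁻¹ • (compl o₁₁.S * (o₁₁.M * (split A).toBlocks₁₂))) o₁₁.αr with ho₁₂
  have hlam : o₂₁.αr / o₁₁.αr ≠ 0 := div_ne_zero h₂₁.β_ne h₁₁.β_ne
  obtain ⟨l₂₂, h₂₂⟩ := hrec ((o₁₁.αr ^ 2 * α)⁻¹ • (compl o₂₁.S * o₂₁.M *
      schurBlock (split A) α o₁₁.data * o₁₂.W * compl o₁₂.S)) (o₂₁.αr / o₁₁.αr * o₁₂.αr)
    (mul_ne_zero hlam h₁₂.β_ne)
  set o₂₂ := rec ((o₁₁.αr ^ 2 * α)⁻¹ • (compl o₂₁.S * o₂₁.M *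
      schurBlock (split A) α o₁₁.data * o₁₂.W * compl o₁₂.S)) (o₂₁.αr / o₁₁.αr * o₁₂.αr) with ho₂₂
  have calls : BlockCalls Fin.val (split A) α l₁₁ l₂₁ l₁₂ l₂₂ o₁₁.data o₂₁.data o₁₂.data
      o₂₂.data := ⟨h₁₁, h₂₁, h₁₂, h₂₂⟩
  obtain ⟨l, adm, res, hL, hU, hS, hβ⟩ := calls.elimination
    (a' := fun s => (halves p s).val) (fun i j h => h)
    (fun i j h => by simpa [halves_inr] using h)
    (fun i j => by
      rw [halves_inl, halves_inr]
      omega)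
  have sp : ∀ X : Matrix (Fin (2 ^ (p + 1))) (Fin (2 ^ (p + 1))) F,
      X.submatrix (halves p) (halves p) = split X := fun _ => rfl
  have inj := (halves p).injective
  have adm' : Admissible Fin.val Fin.val A α (l.map (Prod.map (halves p) (halves p))) := by
    refine Admissible.embed adm (fun _ _ h => h) (fun _ _ h => h) ?_ ?_
    · exact fun u hu => absurd ((halves p).surjective u) hu
    · exact fun u hu => absurd ((halves p).surjective u) hu
  have eS : (blockStep rec A α).S = pivotWeights A α (l.map (Prod.map (halves p) (halves p))) := by
    apply split_injective
    rw [← sp (pivotWeights _ _ _), pivotWeights_submatrix _ _ inj inj, sp, hS]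
    exact split_glue _ _ _ _
  have eL : (blockStep rec A α).L = leftFactor A α (l.map (Prod.map (halves p) (halves p))) := by
    apply split_injective
    rw [← sp (leftFactor _ _ _), leftFactor_submatrix _ _ inj, sp, hL]
    exact split_glue _ _ _ _
  have eU : (blockStep rec A α).U = rightFactor A α (l.map (Prod.map (halves p) (halves p))) := by
    apply split_injective
    rw [← sp (rightFactor _ _ _), rightFactor_submatrix _ _ _ inj, sp, hU]
    exact split_glue _ _ _ _
  have eH : (blockStep rec A α).Shat = (blockStep rec A α).αr⁻¹ •
      (α • (blockStep rec A α).S + compl (blockStep rec A α).S) := by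
    rw [smul_add, smul_smul, mul_comm]
    rfl
  have e : (blockStep rec A α).S =
      glue o₁₁.S (((o₂₁.αr / o₁₁.αr) ^ 2)⁻¹ • o₁₂.S) o₂₁.S o₂₂.S := rfl
  have e1 : split (unitMap (blockStep rec A α).S) =
      fromBlocks (unitMap o₁₁.S) (unitMap o₁₂.S) (unitMap o₂₁.S) (unitMap o₂₂.S) := by
    rw [e, split_unitMap_glue, unitMap_smul (inv_ne_zero (pow_ne_zero 2 hlam))]
  have hperm : ComplementedPermutation (split (blockStep rec A α).S)
      (fromBlocks (unitMap o₁₁.S) (unitMap o₁₂.S) (unitMap o₂₁.S) (unitMap o₂₂.S))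
      (fromBlocks (pinv o₁₁.S) (pinv o₂₁.S) ((o₂₁.αr / o₁₁.αr) ^ 2 • pinv o₁₂.S) (pinv o₂₂.S))
      (split (compl (blockStep rec A α).S)) (split (rowProj (blockStep rec A α).S))
      (split (colProj (blockStep rec A α).S)) := by
    have hw : IsWeightedPermutation (blockStep rec A α).S := by
      rw [eS]
      exact adm'.isWeightedPermutation hα
    have := hw.complementedPermutation.submatrix (halves p)
    simp only [sp] at this
    have e2 : split (pinv (blockStep rec A α).S) = _ := (congrArg _ (congrArg _ e)).trans
      (split_pinv_glue _ _ _ _)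
    rw [pinv_smul] at e2
    rwa [e1, e2] at this
  have hE : split ((unitMap (blockStep rec A α).S + compl (blockStep rec A α).S)ᵀ) =
      (fromBlocks (unitMap o₁₁.S) (unitMap o₁₂.S) (unitMap o₂₁.S) (unitMap o₂₂.S) +
        split (compl (blockStep rec A α).S))ᵀ := by
    rw [← e1]
    rfl
  have eM : split (blockStep rec A α).M = assembledM α o₁₁.data o₂₁.data o₁₂.data o₂₂.data
      (leftBlock (split A) α o₁₁.data o₂₁.data o₁₂.data)
      (split ((unitMap (blockStep rec A α).S + compl (blockStep rec A α).S)ᵀ)) := by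
    rw [assembledM, ← split_glue, ← split_glue, ← split_mul]
    rfl
  have eW : split (blockStep rec A α).W = assembledW α o₁₁.data o₂₁.data o₁₂.data o₂₂.data
      (rightBlock (split A) α o₁₁.data o₂₁.data)
      (split ((unitMap (blockStep rec A α).S + compl (blockStep rec A α).S)ᵀ)) := by
    rw [assembledW, ← split_glue, ← split_glue, ← split_mul]
    rfl
  have sH : split (blockStep rec A α).Shat =
      o₂₂.αr⁻¹ • (α • split (blockStep rec A α).S + split (compl (blockStep rec A α).S)) := by
    rw [eH]
    rfl
  refine ⟨l.map (Prod.map (halves p) (halves p)), isFactored_of_elimination hα adm' ?_ eL eU eS ?_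
    eH ?_ ?_⟩
  · apply split_injective
    rw [← sp (residual _ _ _), residual_submatrix, sp, res]
    rfl
  · rw [lastPivot_submatrix, sp, hβ]
    rfl
  · apply split_injective
    have := calls.mul_assembledM hperm (leftBlock (split A) α o₁₁.data o₂₁.data o₁₂.data)
    rw [split_mul, split_mul, split_one, eM, hE, sH, ← this]
    congr 2
    exact split_glue _ _ _ _
  · apply split_injective
    have := calls.assembledW_mul hperm (rightBlock (split A) α o₁₁.data o₂₁.data)
    rw [split_mul, split_mul, split_one, eW, hE, sH, ← this]
    congr 1
    exact split_glue _ _ _ _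

/-- The procedure computes a complete elimination. -/
theorem exists_isFactored_lsu (p : ℕ) (A : Matrix (Fin (2 ^ p)) (Fin (2 ^ p)) F) {α : F}
    (hα : α ≠ 0) : ∃ l, IsFactored Fin.val A α l (lsu p A α).data := by
  induction p generalizing α with
  | zero =>
    by_cases hA : A = 0
    · subst hA
      rw [lsu, if_pos rfl]
      exact ⟨[], isFactored_zeroOutput hα⟩
    · rw [lsu, if_neg hA]
      let : Unique (Fin (2 ^ 0)) := inferInstanceAs (Unique (Fin 1))
      refine ⟨_, isFactored_oneOutput hα fun h => hA ?_⟩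
      ext i j
      rw [Subsingleton.elim i default, Subsingleton.elim j default, h, Matrix.zero_apply]
  | succ p ih =>
    by_cases hA : A = 0
    · subst hA
      rw [lsu, if_pos rfl]
      exact ⟨[], isFactored_zeroOutput hα⟩
    · rw [lsu, if_neg hA]
      exact exists_isFactored_blockStep (fun B β hβ => ih B hβ) A hα

end Recursion

/-! Bordered minors, and their relation to fraction-free elimination. -/

section BorderedMinors

variable {R : Type*} [CommRing R] {κ : Type} [Fintype κ] [DecidableEq κ] {m n : Type*}

/-- The minor of `M` formed by its upper left block, bordered by the rows and columns whose
positions are listed in `l`. -/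
def listMinor (M : Matrix (κ ⊕ m) (κ ⊕ n) R) (l : List (m × n)) : R :=
  (M.submatrix (Sum.map id fun t : Fin l.length => (l[t]).1)
    (Sum.map id fun t : Fin l.length => (l[t]).2)).det

/-- The matrix of the minors surrounding the upper left block. -/
def surroundingMinors (M : Matrix (κ ⊕ m) (κ ⊕ n) R) : Matrix m n R :=
  Matrix.of fun u v => listMinor M [(u, v)]

/-- The upper left block is enlarged by the row and the column at the position `x`. -/
def enlarge (M : Matrix (κ ⊕ m) (κ ⊕ n) R) (x : m × n) :
    Matrix ((κ ⊕ Unit) ⊕ m) ((κ ⊕ Unit) ⊕ n) R :=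
  M.submatrix (Sum.elim (Sum.map id fun _ => x.1) Sum.inr)
    (Sum.elim (Sum.map id fun _ => x.2) Sum.inr)

/-- Moving the first element of `Fin (t + 1)` to the left summand. -/
def sumUnitSumFin (κ : Type) (t : ℕ) : (κ ⊕ Unit) ⊕ Fin t ≃ κ ⊕ Fin (t + 1) where
  toFun := Sum.elim (Sum.map id fun _ => 0) (Sum.inr ∘ Fin.succ)
  invFun := Sum.elim (Sum.inl ∘ Sum.inl) (Fin.cases (Sum.inl (Sum.inr ())) Sum.inr)
  left_inv := by rintro ((_ | _) | _) <;> rfl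
  right_inv := by
    rintro (_ | i)
    · rfl
    · cases i using Fin.cases <;> rfl

theorem listMinor_nil (M : Matrix (κ ⊕ m) (κ ⊕ n) R) : listMinor M [] = M.toBlocks₁₁.det := by
  have : M.toBlocks₁₁ = (M.submatrix (Sum.map id fun t : Fin ([] : List (m × n)).length =>
      (([] : List (m × n))[t]).1) (Sum.map id fun t : Fin ([] : List (m × n)).length =>
      (([] : List (m × n))[t]).2)).submatrix (Equiv.sumEmpty κ (Fin 0)).symm
        (Equiv.sumEmpty κ (Fin 0)).symm := rfl
  rw [this]
  exact (det_submatrix_equiv_self (Equiv.sumEmpty κ (Fin 0)).symm _).symm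

/-- Absorbing the first border into the core leaves the determinant unchanged. This is what allows
inductions on the list, with varying core `κ`. -/
theorem listMinor_cons (M : Matrix (κ ⊕ m) (κ ⊕ n) R) (x : m × n) (l : List (m × n)) :
    listMinor M (x :: l) = listMinor (enlarge M x) l := by
  rw [listMinor, listMinor, ← det_submatrix_equiv_self (sumUnitSumFin κ l.length)]
  congr 1
  ext ((i | i) | i) ((j | j) | j) <;> rfl

theorem det_enlarge (M : Matrix (κ ⊕ m) (κ ⊕ n) R) (x : m × n) :
    (enlarge M x).toBlocks₁₁.det = surroundingMinors M x.1 x.2 := by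
  rw [← listMinor_nil, ← listMinor_cons]
  rfl

theorem listMinor_ofFn (M : Matrix (κ ⊕ m) (κ ⊕ n) R) {t : ℕ} (r : Fin t → m) (c : Fin t → n) :
    listMinor M (List.ofFn fun i => (r i, c i)) =
      (M.submatrix (Sum.map id r) (Sum.map id c)).det := by
  rw [listMinor, ← det_submatrix_equiv_self
    ((Equiv.refl κ).sumCongr (finCongr (List.length_ofFn (f := fun i => (r i, c i))).symm))]
  congr 1
  ext (i | i) (j | j) <;> simp

theorem listMinor_map {R' : Type*} [CommRing R'] (φ : R →+* R') (M : Matrix (κ ⊕ m) (κ ⊕ n) R)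
    (l : List (m × n)) : listMinor (M.map φ) l = φ (listMinor M l) := by
  rw [listMinor, listMinor, RingHom.map_det]
  rfl

theorem surroundingMinors_map {R' : Type*} [CommRing R'] (φ : R →+* R')
    (M : Matrix (κ ⊕ m) (κ ⊕ n) R) :
    surroundingMinors (M.map φ) = (surroundingMinors M).map φ := by
  ext u v
  exact listMinor_map φ M _

theorem listMinor_submatrix {m' n' : Type*} (M : Matrix (κ ⊕ m') (κ ⊕ n') R) (f : m → m')
    (g : n → n') (l : List (m × n)) :
    listMinor (M.submatrix (Sum.map id f) (Sum.map id g)) l =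
      listMinor M (l.map (Prod.map f g)) := by
  induction l generalizing κ with
  | nil => rw [List.map_nil, listMinor_nil, listMinor_nil]; rfl
  | cons x l ih =>
    rw [List.map_cons, listMinor_cons, listMinor_cons, ← ih]
    congr 1
    ext ((i | i) | i) ((j | j) | j) <;> rfl

theorem surroundingMinors_transpose (M : Matrix (κ ⊕ m) (κ ⊕ n) R) :
    surroundingMinors Mᵀ = (surroundingMinors M)ᵀ := by
  ext u v
  rw [surroundingMinors, of_apply, listMinor, transpose_apply, surroundingMinors, of_apply,
    listMinor, ← det_transpose]
  congr 1
  ext (i | i) (j | j) <;> simp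

theorem isMinor_listMinor (M : Matrix (κ ⊕ m) (κ ⊕ m) R) {l : List (m × m)}
    (h1 : (l.map Prod.fst).Nodup) (h2 : (l.map Prod.snd).Nodup) : IsMinor M (listMinor M l) := by
  have key : ∀ f : m × m → m, (l.map f).Nodup →
      Function.Injective (Sum.map id fun t : Fin l.length => f (l[t]) : _ → κ ⊕ m) := by
    intro f hf
    refine Function.Injective.sumMap Function.injective_id fun s t hst => ?_
    have := List.nodup_iff_injective_get.1 hf
      (a₁ := ⟨s, by simp⟩) (a₂ := ⟨t, by simp⟩) (by simpa using hst)
    simpa [Fin.ext_iff] using this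
  let e := (Fintype.equivFin (κ ⊕ Fin l.length)).symm
  refine ⟨_, (Sum.map id fun t : Fin l.length => (l[t]).1) ∘ e,
    (Sum.map id fun t : Fin l.length => (l[t]).2) ∘ e, (key _ h1).comp e.injective,
    (key _ h2).comp e.injective, ?_⟩
  rw [← submatrix_submatrix, det_submatrix_equiv_self]
  rfl

theorem IsMinor.of_transpose {m : Type*} {M : Matrix m m R} {x : R} (h : IsMinor Mᵀ x) :
    IsMinor M x := by
  obtain ⟨t, r, c, hr, hc, rfl⟩ := h
  refine ⟨t, c, r, hc, hr, ?_⟩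
  rw [← det_transpose]
  rfl

theorem isMinor_one {m : Type*} (M : Matrix m m R) : IsMinor M 1 :=
  ⟨0, Fin.elim0, Fin.elim0, fun i => i.elim0, fun i => i.elim0, by simp⟩

/-- `M` with a unit block in additional columns to the right of the lower block. -/
def augment [DecidableEq m] (M : Matrix (κ ⊕ m) (κ ⊕ n) R) : Matrix (κ ⊕ m) (κ ⊕ (n ⊕ m)) R :=
  (fromCols M (fromRows 0 1)).submatrix id (Equiv.sumAssoc κ n m).symm

theorem augment_submatrix [DecidableEq m] (M : Matrix (κ ⊕ m) (κ ⊕ n) R) :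
    (augment M).submatrix (Sum.map id id) (Sum.map id Sum.inl) = M := by
  ext (i | i) (j | j) <;> rfl

theorem surroundingMinors_augment_inl [DecidableEq m] (M : Matrix (κ ⊕ m) (κ ⊕ n) R) :
    (surroundingMinors (augment M)).submatrix id Sum.inl = surroundingMinors M := by
  ext u v
  rw [submatrix_apply, surroundingMinors, of_apply, surroundingMinors, of_apply]
  conv_rhs => rw [← augment_submatrix M, listMinor_submatrix]
  rfl

/-- A unit column is zero beside the core, so its bordered matrix is block triangular. Thus
eliminating the augmented matrix means eliminating `[A | α I]`. -/
theorem surroundingMinors_augment_inr [DecidableEq m] (M : Matrix (κ ⊕ m) (κ ⊕ n) R) :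
    (surroundingMinors (augment M)).submatrix id Sum.inr = M.toBlocks₁₁.det • 1 := by
  ext u v
  rw [submatrix_apply, surroundingMinors, of_apply, listMinor]
  have : (augment M).submatrix
      (Sum.map id fun t : Fin [(id u, (Sum.inr v : n ⊕ m))].length =>
        ([(id u, (Sum.inr v : n ⊕ m))][t]).1)
      (Sum.map id fun t : Fin [(id u, (Sum.inr v : n ⊕ m))].length =>
        ([(id u, (Sum.inr v : n ⊕ m))][t]).2) =
      fromBlocks M.toBlocks₁₁ 0 (Matrix.of fun _ j => M (Sum.inr u) (Sum.inl j))
        (Matrix.of fun _ _ => (1 : Matrix m m R) u v) := by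
    ext (i | i) (j | j)
    · rfl
    · simp [augment]
    · simp [augment]
    · simp [augment]
  rw [this, det_fromBlocks_zero₁₂]
  congr 1
  exact det_fin_one _

end BorderedMinors

/-! ### Sylvester's identity -/

section Sylvester

variable {F : Type*} [Field F] {κ : Type} [Fintype κ] [DecidableEq κ] {m n : Type*}
  [DecidableEq m] [DecidableEq n]

/-- Schur's formula for all bordered minors. -/
theorem listMinor_eq_mul_det (M : Matrix (κ ⊕ m) (κ ⊕ n) F) (h : M.toBlocks₁₁.det ≠ 0)
    (l : List (m × n)) :
    listMinor M l = M.toBlocks₁₁.det *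
      ((M.toBlocks₂₂ - M.toBlocks₂₁ * M.toBlocks₁₁⁻¹ * M.toBlocks₁₂).submatrix
        (fun t : Fin l.length => (l[t]).1) (fun t : Fin l.length => (l[t]).2)).det := by
  have := Matrix.invertibleOfIsUnitDet M.toBlocks₁₁ (isUnit_iff_ne_zero.2 h)
  have e : M.submatrix (Sum.map id fun t : Fin l.length => (l[t]).1)
      (Sum.map id fun t : Fin l.length => (l[t]).2) =
      fromBlocks M.toBlocks₁₁ (M.toBlocks₁₂.submatrix id fun t : Fin l.length => (l[t]).2)
        (M.toBlocks₂₁.submatrix (fun t : Fin l.length => (l[t]).1) id)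
        (M.toBlocks₂₂.submatrix (fun t : Fin l.length => (l[t]).1)
          fun t : Fin l.length => (l[t]).2) := by
    ext (i | i) (j | j) <;> rfl
  rw [listMinor, e, det_fromBlocks₁₁, invOf_eq_nonsing_inv]
  rfl

/-- Sylvester's identity for one step of elimination. -/
theorem pivotStep_surroundingMinors (M : Matrix (κ ⊕ m) (κ ⊕ n) F) (h : M.toBlocks₁₁.det ≠ 0)
    (x : m × n) :
    pivotStep (surroundingMinors M) M.toBlocks₁₁.det x = surroundingMinors (enlarge M x) := by
  ext u v
  rw [surroundingMinors, surroundingMinors, of_apply, ← listMinor_cons, pivotStep]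
  simp only [of_apply]
  -- By Schur's formula surrounding minors are `det` times entries of the Schur complement, and the
  -- doubly bordered minor is `det` times a 2 × 2 minor of it; both sides are `det ^ 2` times that
  -- minor.
  rw [div_eq_iff h]
  simp only [listMinor_eq_mul_det M h]
  rw [det_fin_two]
  have e : ∀ X : Matrix (Fin 1) (Fin 1) F, X.det = X 0 0 := det_fin_one
  erw [e, e, e, e]
  simp
  ring

/-- Each element of a residual is the pivot that would be used next; nothing is required of it. -/
theorem residual_eq_lastPivot (A : Matrix m n F) (α : F) (l : List (m × n)) (u : m) (v : n) :
    residual A α l u v = lastPivot A α (l ++ [(u, v)]) := by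
  rw [lastPivot_append]
  rfl

/-- The elements of the residuals are bordered minors. -/
theorem Admissible.residual_eq_listMinor {a : m → ℕ} {b : n → ℕ}
    {M : Matrix (κ ⊕ m) (κ ⊕ n) F} (h : M.toBlocks₁₁.det ≠ 0) {l : List (m × n)}
    (hl : Admissible a b (surroundingMinors M) M.toBlocks₁₁.det l) (u : m) (v : n) :
    residual (surroundingMinors M) M.toBlocks₁₁.det l u v = listMinor M (l ++ [(u, v)]) := by
  induction l generalizing κ with
  | nil => rfl
  | cons x l ih =>
    rw [residual, List.cons_append, listMinor_cons, pivotStep_surroundingMinors M h,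
      ← det_enlarge]
    obtain ⟨h1, -, -, h4⟩ := hl
    rw [pivotStep_surroundingMinors M h, ← det_enlarge] at h4
    rw [← det_enlarge] at h1
    exact ih h1 h4

theorem Admissible.lastPivot_eq_listMinor {a : m → ℕ} {b : n → ℕ}
    {M : Matrix (κ ⊕ m) (κ ⊕ n) F} (h : M.toBlocks₁₁.det ≠ 0) {l : List (m × n)}
    (hl : Admissible a b (surroundingMinors M) M.toBlocks₁₁.det l) :
    lastPivot (surroundingMinors M) M.toBlocks₁₁.det l = listMinor M l := by
  rcases l.eq_nil_or_concat with rfl | ⟨l, x, rfl⟩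
  · exact (listMinor_nil M).symm
  · rw [List.concat_eq_append] at hl ⊢
    rw [← residual_eq_lastPivot]
    exact ((admissible_append _ _ _ _ _ _).1 hl).1.residual_eq_listMinor h _ _

end Sylvester

/-! ### Integrality of the factors and of `α M`, `α W` -/

section Integrality

variable {R F : Type*} [CommRing R] [Field F] {φ : R →+* F} {κ : Type} [Fintype κ]
  [DecidableEq κ] {m n : Type*} [DecidableEq m] [DecidableEq n]

theorem det_toBlocks_map (M : Matrix (κ ⊕ m) (κ ⊕ n) R) :
    (M.map φ).toBlocks₁₁.det = φ M.toBlocks₁₁.det := by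
  rw [RingHom.map_det]
  rfl

theorem Admissible.residual_eq_map {a : m → ℕ} {b : n → ℕ} {M : Matrix (κ ⊕ m) (κ ⊕ n) R}
    (h : φ M.toBlocks₁₁.det ≠ 0) {l : List (m × n)}
    (hl : Admissible a b (surroundingMinors (M.map φ)) (φ M.toBlocks₁₁.det) l) (u : m) (v : n) :
    residual (surroundingMinors (M.map φ)) (φ M.toBlocks₁₁.det) l u v =
      φ (listMinor M (l ++ [(u, v)])) := by
  rw [← det_toBlocks_map] at h hl ⊢
  rw [hl.residual_eq_listMinor h, listMinor_map]

theorem Admissible.lastPivot_eq_map {a : m → ℕ} {b : n → ℕ} {M : Matrix (κ ⊕ m) (κ ⊕ n) R}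
    (h : φ M.toBlocks₁₁.det ≠ 0) {l : List (m × n)}
    (hl : Admissible a b (surroundingMinors (M.map φ)) (φ M.toBlocks₁₁.det) l) :
    lastPivot (surroundingMinors (M.map φ)) (φ M.toBlocks₁₁.det) l = φ (listMinor M l) := by
  rw [← det_toBlocks_map] at h hl ⊢
  rw [hl.lastPivot_eq_listMinor h, listMinor_map]

theorem Admissible.take {a : m → ℕ} {b : n → ℕ} {A : Matrix m n F} {α : F} {l : List (m × n)}
    (hl : Admissible a b A α l) (t : ℕ) : Admissible a b A α (l.take t) := by
  rw [← List.take_append_drop t l, admissible_append] at hl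
  exact hl.1

theorem Admissible.pivotCols_mem_range {a : m → ℕ} {b : n → ℕ} {M : Matrix (κ ⊕ m) (κ ⊕ n) R}
    (h : φ M.toBlocks₁₁.det ≠ 0) {l : List (m × n)}
    (hl : Admissible a b (surroundingMinors (M.map φ)) (φ M.toBlocks₁₁.det) l) (u v : m) :
    pivotCols (surroundingMinors (M.map φ)) (φ M.toBlocks₁₁.det) l u v ∈ φ.range := by
  by_cases hv : v ∈ l.map Prod.fst
  · obtain ⟨x, hx, rfl⟩ := List.mem_map.1 hv
    obtain ⟨t, ht, rfl⟩ := List.getElem_of_mem hx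
    rw [hl.pivotCols_getElem ht, (hl.take t).residual_eq_map h]
    exact ⟨_, rfl⟩
  · rw [pivotCols_col_eq_zero _ _ hv]
    exact zero_mem _

theorem Admissible.pivotRows_mem_range {a : m → ℕ} {b : n → ℕ} {M : Matrix (κ ⊕ m) (κ ⊕ n) R}
    (h : φ M.toBlocks₁₁.det ≠ 0) {l : List (m × n)}
    (hl : Admissible a b (surroundingMinors (M.map φ)) (φ M.toBlocks₁₁.det) l) (u v : n) :
    pivotRows (surroundingMinors (M.map φ)) (φ M.toBlocks₁₁.det) l u v ∈ φ.range := by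
  have e : (Mᵀ).toBlocks₁₁.det = M.toBlocks₁₁.det := by
    rw [← det_transpose]
    rfl
  have hl' := hl.transpose
  rw [← surroundingMinors_transpose, ← transpose_map, ← e] at hl'
  rw [← e] at h
  have := hl'.pivotCols_mem_range h v u
  rwa [transpose_map, surroundingMinors_transpose, e] at this

variable [Fintype m]

theorem mul_mem_range {k k' : Type*} {X : Matrix k m F} {Y : Matrix m k' F}
    (hX : ∀ i j, X i j ∈ φ.range) (hY : ∀ i j, Y i j ∈ φ.range) (i : k) (j : k') :
    (X * Y) i j ∈ φ.range :=
  sum_mem fun w _ => mul_mem (hX i w) (hY w j)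

/-- The left inverse factor is integral up to the initial denominator. -/
theorem LeftInverseData.smul_mem_range {a b : m → ℕ} {M : Matrix (κ ⊕ m) (κ ⊕ m) R}
    {β : F} {l : List (m × m)} {L N H S E T C P Q : Matrix m m F}
    (h : LeftInverseData (φ M.toBlocks₁₁.det) β L N H S E T C P Q)
    (hl : Admissible a b (surroundingMinors (M.map φ)) (φ M.toBlocks₁₁.det) l)
    (L_eq : L = leftFactor (surroundingMinors (M.map φ)) (φ M.toBlocks₁₁.det) l)
    (S_eq : S = pivotWeights (surroundingMinors (M.map φ)) (φ M.toBlocks₁₁.det) l)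
    (β_eq : β = lastPivot (surroundingMinors (M.map φ)) (φ M.toBlocks₁₁.det) l)
    (P_eq : P = countDiag F (l.map Prod.fst)) (Q_eq : Q = countDiag F (l.map Prod.snd))
    (hC : ∀ i j, C i j ∈ φ.range) (i j : m) :
    (φ M.toBlocks₁₁.det • N) i j ∈ φ.range := by
  have e1 : (surroundingMinors ((augment M).map φ)).submatrix id Sum.inl =
      surroundingMinors (M.map φ) := by
    rw [surroundingMinors_map, surroundingMinors_map, ← surroundingMinors_augment_inl M]
    rfl
  have e2 : (surroundingMinors ((augment M).map φ)).submatrix id Sum.inr =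
      φ M.toBlocks₁₁.det • 1 := by
    have : (surroundingMinors ((augment M).map φ)).submatrix id Sum.inr =
        ((surroundingMinors (augment M)).submatrix id Sum.inr).map φ := by
      rw [surroundingMinors_map]
      rfl
    rw [this, surroundingMinors_augment_inr]
    ext u v
    by_cases huv : u = v <;> simp [huv]
  have hα := h.α_ne
  rw [← e1] at hl L_eq S_eq β_eq
  have hα' : φ (augment M).toBlocks₁₁.det ≠ 0 := hα
  have hl' : Admissible (fun _ => 0) (fun _ => 0) (surroundingMinors ((augment M).map φ))
      (φ (augment M).toBlocks₁₁.det) (l.map (Prod.map id Sum.inl)) :=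
    hl.embed (by simp) (by simp) (by simp) (by simp)
  -- `M` applied to the block `α I` of `[A | α I]` is `α M`, and equals `β V + α Cᵀ Y`, where `β`
  -- and the entries of `V` and `Y` come from bordered minors of the augmented matrix over `R`.
  have key := h.M_mul (X := φ M.toBlocks₁₁.det • (1 : Matrix m m F))
    (V := (pivotRows (surroundingMinors ((augment M).map φ)) (φ (augment M).toBlocks₁₁.det)
      (l.map (Prod.map id Sum.inl))).submatrix Sum.inl Sum.inr)
    (Y := (residual (surroundingMinors ((augment M).map φ)) (φ (augment M).toBlocks₁₁.det)
      (l.map (Prod.map id Sum.inl))).submatrix id Sum.inr)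
    (by
      have := hl.submatrix_eq_add_residual hα Function.injective_id Sum.inl_injective id Sum.inr
      rw [e2, pivotCols_submatrix _ _ Function.injective_id, ← β_eq,
        ← hl.leftFactor_mul_pivotWeights, ← L_eq, ← S_eq] at this
      exact this)
    (by
      rw [Q_eq]
      exact hl.countDiag_mul_pivotRows_submatrix Sum.inl_injective _)
    (by
      rw [P_eq]
      exact countDiag_mul_residual_submatrix _ _ _ _)
  rw [Matrix.mul_smul, Matrix.mul_one] at key
  rw [key]
  refine add_mem (mul_mem ?_ (hl'.pivotRows_mem_range hα' _ _)) (mul_mem ⟨_, rfl⟩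
    (mul_mem_range (fun i j => hC j i) (fun u v => ?_) i j))
  · rw [β_eq, ← lastPivot_submatrix]
    exact ⟨_, (hl'.lastPivot_eq_map hα').symm⟩
  · rw [submatrix_apply, hl'.residual_eq_map hα']
    exact ⟨_, rfl⟩

theorem LeftInverseData.isUnit {ι : Type*} [Fintype ι] [DecidableEq ι] {α β : F}
    {L N H S E T C P Q : Matrix ι ι F} (h : LeftInverseData α β L N H S E T C P Q) :
    IsUnit L ∧ IsUnit N :=
  ⟨IsUnit.of_mul_eq_one _ h.mul_inv, IsUnit.of_mul_eq_one_right _ h.mul_eq_one⟩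

end Integrality

/-! ### Triangularity, and the entries of the factors as minors -/

section Triangular

variable {R F : Type*} [CommRing R] [Field F] {φ : R →+* F} {κ : Type} [Fintype κ]
  [DecidableEq κ] {n : ℕ}

theorem Admissible.nodup_take_append {m n : Type*} [DecidableEq m] [DecidableEq n]
    {a : m → ℕ} {b : n → ℕ} {A : Matrix m n F} {α : F} {l : List (m × n)}
    (hl : Admissible a b A α l) {t : ℕ} (ht : t < l.length) :
    ((l.take t).map Prod.snd ++ [(l[t]).2]).Nodup := by
  have : (l.take t).map Prod.snd ++ [(l[t]).2] = (l.take (t + 1)).map Prod.snd := by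
    rw [List.take_succ_eq_append_getElem ht, List.map_append]
    rfl
  rw [this, List.map_take]
  exact hl.nodup_snd.sublist (List.take_sublist _ _)

/-- The elements of the left factor on and below the diagonal are minors, the others are zero. -/
theorem Admissible.leftFactor_isMinor {M : Matrix (κ ⊕ Fin n) (κ ⊕ Fin n) R}
    (h : φ M.toBlocks₁₁.det ≠ 0) (hφ : Function.Injective φ) {l : List (Fin n × Fin n)}
    (hl : Admissible Fin.val Fin.val (surroundingMinors (M.map φ)) (φ M.toBlocks₁₁.det) l)
    (hr : residual (surroundingMinors (M.map φ)) (φ M.toBlocks₁₁.det) l = 0) (u v : Fin n) :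
    ∃ x : R, leftFactor (surroundingMinors (M.map φ)) (φ M.toBlocks₁₁.det) l u v = φ x ∧
      (u < v → x = 0) ∧ (v ≤ u → IsMinor M x) := by
  have hz : ∀ s (hs : s < l.length) (w : Fin n), w < (l[s]).1 →
      residual (surroundingMinors (M.map φ)) (φ M.toBlocks₁₁.det) (l.take s) w (l[s]).2 = 0 := by
    intro s hs w hw
    have := hl.drop s
    rw [List.drop_eq_getElem_cons hs] at this
    exact this.2.1 w hw
  have hm : ∀ s (hs : s < l.length) (w : Fin n), w ∉ (l.take s).map Prod.fst →
      IsMinor M (listMinor M (l.take s ++ [(w, (l[s]).2)])) := by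
    intro s hs w hw
    refine isMinor_listMinor M ?_ ?_
    · rw [List.map_append]
      refine List.nodup_append.2 ⟨(hl.take s).nodup_fst, by simp, ?_⟩
      intro x hx y hy
      rintro rfl
      rw [List.map_singleton, List.mem_singleton] at hy
      subst hy
      exact hw hx
    · rw [List.map_append]
      exact hl.nodup_take_append hs
  by_cases hv : v ∈ l.map Prod.fst
  · have e : leftFactor (surroundingMinors (M.map φ)) (φ M.toBlocks₁₁.det) l u v =
        pivotCols (surroundingMinors (M.map φ)) (φ M.toBlocks₁₁.det) l u v := by
      rw [leftFactor, countDiag_of_nodup hl.nodup_fst, Matrix.add_apply, Matrix.sub_apply]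
      by_cases huv : u = v
      · subst huv
        rw [Matrix.one_apply_eq, diagonal_apply_eq, if_pos hv, sub_self, add_zero]
      · rw [Matrix.one_apply_ne huv, diagonal_apply_ne _ huv, sub_self, add_zero]
    obtain ⟨x, hx, rfl⟩ := List.mem_map.1 hv
    obtain ⟨t, ht, rfl⟩ := List.getElem_of_mem hx
    have hval := (hl.take t).residual_eq_map h u (l[t]).2
    refine ⟨listMinor M (l.take t ++ [(u, (l[t]).2)]), ?_, fun huv => ?_, fun huv => ?_⟩
    · rw [e, hl.pivotCols_getElem ht, hval]
    · rw [hz t ht u huv] at hval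
      exact hφ (by rw [← hval, map_zero])
    -- If `u` is an earlier pivot row, the determinant has a repeated row, so it is no minor in the
    -- required sense; the entry is `0` and another vanishing minor is needed. At the earlier step
    -- `s` with pivot row `u`, the row `v` lies above the pivot, so the zero demanded by
    -- admissibility at row `v` and the column of that pivot is such a minor.
    · by_cases hu : u ∈ (l.take t).map Prod.fst
      · rw [Admissible.residual_pivot_row hu] at hval
        have h0 : listMinor M (l.take t ++ [(u, (l[t]).2)]) = 0 := hφ (by rw [← hval, map_zero])
        obtain ⟨y, hy, rfl⟩ := List.mem_map.1 hu
        obtain ⟨s, hs, rfl⟩ := List.getElem_of_mem hy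
        have hst : s < t := (List.length_take_le _ _).trans_lt' hs
        have hs' : s < l.length := hst.trans ht
        rw [List.getElem_take] at huv
        have hnd := List.nodup_iff_injective_get.1 hl.nodup_fst
        have hnot : ∀ i (hi : i < l.length), i < t → (l[t]).1 ≠ (l[i]).1 := by
          intro i hi hit heq
          have := hnd (a₁ := ⟨t, by simpa using ht⟩) (a₂ := ⟨i, by simpa using hi⟩)
            (by simpa using heq)
          rw [Fin.mk.injEq] at this
          omega
        have hlt : (l[t]).1 < (l[s]).1 := lt_of_le_of_ne huv (hnot s hs' hst)
        have h1 := hz s hs' _ hlt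
        rw [(hl.take s).residual_eq_map h] at h1
        rw [h0, ← hφ (h1.trans (map_zero φ).symm)]
        refine hm s hs' _ fun hmem => ?_
        obtain ⟨y, hy, hyv⟩ := List.mem_map.1 hmem
        obtain ⟨i, hi, rfl⟩ := List.getElem_of_mem hy
        have his : i < s := (List.length_take_le _ _).trans_lt' hi
        rw [List.getElem_take] at hyv
        exact hnot i (his.trans hs') (his.trans hst) hyv.symm
      · exact hm t ht u hu
  · have e : leftFactor (surroundingMinors (M.map φ)) (φ M.toBlocks₁₁.det) l u v =
        (1 : Matrix (Fin n) (Fin n) F) u v := by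
      rw [leftFactor, countDiag_of_nodup hl.nodup_fst, Matrix.add_apply, Matrix.sub_apply,
        pivotCols_col_eq_zero _ _ hv]
      by_cases huv : u = v
      · subst huv
        rw [diagonal_apply_eq, if_neg hv, sub_zero, zero_add]
      · rw [diagonal_apply_ne _ huv, sub_zero, zero_add]
    rw [e]
    by_cases huv : u = v
    · subst huv
      exact ⟨1, by simp, fun h' => absurd h' (lt_irrefl _), fun _ => isMinor_one M⟩
    -- Here `v` is not a pivot row, so fewer than `n` pivots are used and some column `w` has none.
    -- Bordering all pivots by `(v, w)` gives a minor that is zero because the residual is.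
    · refine ⟨0, by simp [huv], fun _ => rfl, fun _ => ?_⟩
      have hlen : (l.map Prod.snd).length < n := by
        have := List.Nodup.length_le_card (List.nodup_cons.2 ⟨hv, hl.nodup_fst⟩)
        simpa using this
      obtain ⟨w, hw⟩ : ∃ w, w ∉ l.map Prod.snd := by
        by_contra! hall
        have := Finset.card_le_card (s := Finset.univ) (t := (l.map Prod.snd).toFinset)
          fun w _ => List.mem_toFinset.2 (hall w)
        rw [Finset.card_univ, Fintype.card_fin] at this
        exact absurd (this.trans (List.toFinset_card_le _)) (not_le.2 hlen)
      have h1 := hl.residual_eq_map h v w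
      rw [hr] at h1
      have h0 : listMinor M (l ++ [(v, w)]) = 0 := hφ (by rw [← h1, map_zero, Matrix.zero_apply])
      rw [← h0]
      refine isMinor_listMinor M ?_ ?_
      · rw [List.map_append]
        exact List.nodup_append.2 ⟨hl.nodup_fst, by simp, by aesop⟩
      · rw [List.map_append]
        exact List.nodup_append.2 ⟨hl.nodup_snd, by simp, by aesop⟩

theorem Admissible.rightFactor_isMinor {M : Matrix (κ ⊕ Fin n) (κ ⊕ Fin n) R}
    (h : φ M.toBlocks₁₁.det ≠ 0) (hφ : Function.Injective φ) {l : List (Fin n × Fin n)}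
    (hl : Admissible Fin.val Fin.val (surroundingMinors (M.map φ)) (φ M.toBlocks₁₁.det) l)
    (hr : residual (surroundingMinors (M.map φ)) (φ M.toBlocks₁₁.det) l = 0) (u v : Fin n) :
    ∃ x : R, rightFactor (surroundingMinors (M.map φ)) (φ M.toBlocks₁₁.det) l u v = φ x ∧
      (v < u → x = 0) ∧ (u ≤ v → IsMinor M x) := by
  have e : (Mᵀ).toBlocks₁₁.det = M.toBlocks₁₁.det := by
    rw [← det_transpose]
    rfl
  have e' : surroundingMinors (Mᵀ.map φ) = (surroundingMinors (M.map φ))ᵀ := by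
    rw [transpose_map, surroundingMinors_transpose]
  obtain ⟨x, h1, h2, h3⟩ := Admissible.leftFactor_isMinor (M := Mᵀ) (φ := φ)
    (l := l.map Prod.swap) (by rwa [e]) hφ (by rw [e, e']; exact hl.transpose)
    (by rw [e, e', residual_transpose, hr, transpose_zero]) v u
  rw [e, e', leftFactor_transpose, transpose_apply] at h1
  exact ⟨x, h1, h2, fun huv => (h3 huv).of_transpose⟩

end Triangular

/-! ### Ranks and transfer to the base ring -/

section Conclusions

variable {F : Type*} [Field F]

theorem rank_countDiag {m : Type*} [Fintype m] [DecidableEq m] {l : List m} (h : l.Nodup) :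
    (countDiag F l).rank = l.length := by
  classical
  rw [countDiag_of_nodup h, rank_diagonal, Fintype.card_subtype, ← List.toFinset_card_of_nodup h]
  congr 1
  ext i
  simp

section

variable {ι : Type*} [Fintype ι] [DecidableEq ι] {a : ι → ℕ} {A : Matrix ι ι F} {α : F}
  {l : List (ι × ι)} {d : FactorData ι F}

theorem IsFactored.smul_mul_eq (h : IsFactored a A α l d) : α • (d.L * d.S * d.U) = A := by
  have e := h.adm.eq_add_residual h.α_ne
  rw [h.res, smul_zero, add_zero] at e
  conv_rhs => rw [e]
  have hU : d.S * d.U = d.S * pivotRows A α l := by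
    have := h.adm.transpose.leftFactor_mul_pivotWeights
    rw [pivotWeights_transpose, leftFactor_transpose, ← h.S_eq, ← h.U_eq, ← transpose_mul] at this
    rw [← transpose_inj, this, transpose_mul]
    rfl
  rw [Matrix.mul_assoc, hU, ← Matrix.mul_assoc, h.L_eq, h.S_eq, h.adm.leftFactor_mul_pivotWeights]

/-- `S = P * S` and `P = S * T` give equal ranks, and `P` is the projection to the distinct pivot
rows. -/
theorem IsFactored.rank_S (h : IsFactored a A α l d) : d.S.rank = l.length := by
  have hP : d.P.rank = l.length := by
    rw [h.P_eq, rank_countDiag h.adm.nodup_fst, List.length_map]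
  refine le_antisymm ?_ ?_
  · rw [← hP, ← h.perm.P_S]
    exact rank_mul_le_left _ _
  · rw [← hP, ← h.perm.mul_T]
    exact rank_mul_le_left _ _

theorem IsFactored.rank_eq (h : IsFactored a A α l d) : A.rank = l.length := by
  have hL := (Matrix.isUnit_iff_isUnit_det _).1 h.left.isUnit.1
  have hU := (Matrix.isUnit_iff_isUnit_det _).1 h.right.isUnit.1
  rw [det_transpose] at hU
  rw [← h.smul_mul_eq, rank_smul_of_mem_nonZeroDivisors _
    (mem_nonZeroDivisors_of_ne_zero h.α_ne), rank_mul_eq_left_of_isUnit_det _ _ hU,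
    rank_mul_eq_right_of_isUnit_det _ _ hL, h.rank_S]

end

theorem compl_mem_range {R : Type*} [CommRing R] (φ : R →+* F) {n : ℕ}
    (S : Matrix (Fin n) (Fin n) F) (i j : Fin n) : compl S i j ∈ φ.range := by
  rw [compl, of_apply]
  split_ifs
  · exact one_mem _
  · exact zero_mem _

theorem borderedMinor_eq_listMinor {R : Type*} [CommRing R] {k n t : ℕ}
    (M : Matrix (Fin k ⊕ Fin n) (Fin k ⊕ Fin n) R) (r c : Fin t → Fin n) :
    borderedMinor M r c = listMinor M (List.ofFn fun i => (r i, c i)) :=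
  (listMinor_ofFn M r c).symm

theorem ofFn_castLE {β : Type*} (l : List β) {t : ℕ} (ht : t ≤ l.length) :
    (List.ofFn fun i : Fin t => l[(Fin.castLE ht i)]) = l.take t := by
  apply List.ext_getElem <;> simp [ht]

theorem exists_map_eq {R : Type*} [CommRing R] (φ : R →+* F) {m n : Type*} {A : Matrix m n F}
    (h : ∀ i j, A i j ∈ φ.range) : ∃ B : Matrix m n R, A = B.map φ := by
  choose B hB using h
  exact ⟨Matrix.of B, by ext i j; exact (hB i j).symm⟩

end Conclusions

end

end LSUFactorization

/-! ### The theorem -/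

open Matrix LSUFactorization

theorem mainTheorem1 {R F : Type*} [CommRing R] [IsDomain R] [Field F] [Algebra R F]
    [IsFractionRing R F] (k p r : ℕ)
    (𝓜 : Matrix (Fin k ⊕ Fin (2 ^ p)) (Fin k ⊕ Fin (2 ^ p)) R)
    (α : R) (hα : α = 𝓜.toBlocks₁₁.det) (hα0 : α ≠ 0)
    (A : Matrix (Fin (2 ^ p)) (Fin (2 ^ p)) R)
    (hA : ∀ i j, A i j = LSUFactorization.borderedMinor 𝓜 ![i] ![j])
    (hr : (A.map (algebraMap R F)).rank = r)
    (out : LSUFactorization.Output F (2 ^ p))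
    (hout : out = LSUFactorization.lsu p (A.map (algebraMap R F)) (algebraMap R F α)) :
    -- `L` is lower triangular, of full rank, over `R`, and its entries are minors
    (∃ L : Matrix (Fin (2 ^ p)) (Fin (2 ^ p)) R, out.L = L.map (algebraMap R F) ∧
      (∀ i j, i < j → L i j = 0) ∧ (∀ i j, j ≤ i → LSUFactorization.IsMinor 𝓜 (L i j))) ∧
    out.L.rank = 2 ^ p ∧
    -- `U` is upper triangular, of full rank, over `R`, and its entries are minors
    (∃ U : Matrix (Fin (2 ^ p)) (Fin (2 ^ p)) R, out.U = U.map (algebraMap R F) ∧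
      (∀ i j, j < i → U i j = 0) ∧ (∀ i j, i ≤ j → LSUFactorization.IsMinor 𝓜 (U i j))) ∧
    out.U.rank = 2 ^ p ∧
    -- `L Ī = Ī` and `J̄ U = J̄`
    out.L * (1 - LSUFactorization.rowProj out.S) = 1 - LSUFactorization.rowProj out.S ∧
    (1 - LSUFactorization.colProj out.S) * out.U = 1 - LSUFactorization.colProj out.S ∧
    -- `S` is a weighted permutation of rank `r`; its nonzero elements come from nested minors
    LSUFactorization.IsWeightedPermutation out.S ∧
    out.S.rank = r ∧
    (∃ (row col : Fin r → Fin (2 ^ p)) (d : Fin (r + 1) → R),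
      Function.Injective row ∧ Function.Injective col ∧
      (∀ t : Fin (r + 1), d t = LSUFactorization.borderedMinor 𝓜
        (row ∘ Fin.castLE t.is_le) (col ∘ Fin.castLE t.is_le)) ∧
      (∀ t, d t ≠ 0) ∧ d 0 = α ∧
      (∀ t : Fin r, out.S (row t) (col t) = (algebraMap R F (d t.castSucc * d t.succ))⁻¹) ∧
      (∀ i j, out.S i j ≠ 0 → ∃ t, i = row t ∧ j = col t) ∧
      out.αr = algebraMap R F (d (Fin.last r))) ∧
    out.Shat = out.αr⁻¹ • (algebraMap R F α • out.S + LSUFactorization.compl out.S) ∧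
    -- `M` and `W` are of full rank; `α M` and `α W` are over `R`
    out.M.rank = 2 ^ p ∧ out.W.rank = 2 ^ p ∧
    (∃ M : Matrix (Fin (2 ^ p)) (Fin (2 ^ p)) R,
      algebraMap R F α • out.M = M.map (algebraMap R F)) ∧
    (∃ W : Matrix (Fin (2 ^ p)) (Fin (2 ^ p)) R,
      algebraMap R F α • out.W = W.map (algebraMap R F)) ∧
    -- the three identities
    algebraMap R F α • (out.L * out.S * out.U) = A.map (algebraMap R F) ∧
    out.L * out.Shat * out.M = 1 ∧
    out.W * out.Shat * out.U = 1 := by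
  classical
  have hA' : A.map (algebraMap R F) = surroundingMinors (𝓜.map (algebraMap R F)) := by
    rw [surroundingMinors_map]
    ext i j
    rw [Matrix.map_apply, Matrix.map_apply, hA, borderedMinor_eq_listMinor]
    rfl
  have hφ : Function.Injective (algebraMap R F) := IsFractionRing.injective R F
  have hαF : algebraMap R F α ≠ 0 := fun h => hα0 (hφ (h.trans (map_zero _).symm))
  obtain ⟨l, h⟩ := exists_isFactored_lsu p (A.map (algebraMap R F)) hαF
  rw [← hout] at h
  have hlen : r = l.length := hr.symm.trans h.rank_eq
  subst hlen
  clear hr hout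
  have hLSU := h.smul_mul_eq
  have hSr := h.rank_S
  rw [hA', hα] at h
  rw [hα] at hαF
  have hadm := h.adm
  -- The nested minors of the statement are the last pivots of the initial segments of `l`; the
  -- segment with `t = 0` gives `α`.
  have hPa : ∀ t, lastPivot (surroundingMinors (𝓜.map (algebraMap R F)))
      (algebraMap R F 𝓜.toBlocks₁₁.det) (l.take t) = algebraMap R F (listMinor 𝓜 (l.take t)) :=
    fun t => (hadm.take t).lastPivot_eq_map hαF
  have hMr : ∀ X : Matrix (Fin (2 ^ p)) (Fin (2 ^ p)) F, IsUnit X → X.rank = 2 ^ p :=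
    fun X hX => (Matrix.rank_of_isUnit X hX).trans (Fintype.card_fin _)
  have hC : ∀ i j, LSUFactorization.compl out.S i j ∈ (algebraMap R F).range := compl_mem_range _ _
  have eT : (𝓜ᵀ).toBlocks₁₁.det = 𝓜.toBlocks₁₁.det := by
    rw [← Matrix.det_transpose]
    rfl
  have eT' : surroundingMinors (𝓜ᵀ.map (algebraMap R F)) =
      (surroundingMinors (𝓜.map (algebraMap R F)))ᵀ := by
    rw [Matrix.transpose_map, surroundingMinors_transpose]
  refine ⟨?_, hMr _ h.left.isUnit.1, ?_, ?_, h.left.L_compl, h.compl_mul_U, ?_, hSr, ?_, ?_,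
    hMr _ h.left.isUnit.2, ?_, ?_, ?_, hLSU, h.LHM, h.WHU⟩
  · choose L h1 h2 h3 using hadm.leftFactor_isMinor hαF hφ h.res
    refine ⟨Matrix.of L, ?_, h2, h3⟩
    ext i j
    exact (congrFun₂ h.L_eq i j).trans (h1 i j)
  · choose U h1 h2 h3 using hadm.rightFactor_isMinor hαF hφ h.res
    refine ⟨Matrix.of U, ?_, h2, h3⟩
    ext i j
    exact (congrFun₂ h.U_eq i j).trans (h1 i j)
  · rw [← Matrix.rank_transpose]
    exact hMr _ h.right.isUnit.1
  · have := hadm.isWeightedPermutation hαF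
    rwa [← h.S_eq] at this
  · have hinj : ∀ f : Fin (2 ^ p) × Fin (2 ^ p) → Fin (2 ^ p), (l.map f).Nodup →
        Function.Injective fun t : Fin l.length => f (l[t]) := by
      intro f hf s t hst
      have := List.nodup_iff_injective_get.1 hf
        (a₁ := ⟨s, by simp⟩) (a₂ := ⟨t, by simp⟩) (by simpa using hst)
      simpa [Fin.ext_iff] using this
    have hS : out.S = _ := h.S_eq
    refine ⟨fun t => (l[t]).1, fun t => (l[t]).2, fun t => listMinor 𝓜 (l.take t),
      hinj _ hadm.nodup_fst, hinj _ hadm.nodup_snd, fun t => ?_, fun t ht => ?_, ?_, fun t => ?_,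
      fun i j hij => ?_, ?_⟩
    · rw [borderedMinor_eq_listMinor]
      dsimp only
      rw [← ofFn_castLE l t.is_le]
      rfl
    · refine (hadm.take t).lastPivot_ne_zero hαF ?_
      rw [hPa]
      dsimp only at ht
      rw [ht, map_zero]
    · rw [hα]
      exact listMinor_nil 𝓜
    · rw [hS, map_mul]
      dsimp only
      rw [← hPa, ← hPa]
      exact hadm.pivotWeights_getElem t.2
    · rw [hS, hadm.pivotWeights_ne_zero_iff hαF] at hij
      obtain ⟨t, ht, he⟩ := List.getElem_of_mem hij
      exact ⟨⟨t, ht⟩, by simp [he], by simp [he]⟩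
    · dsimp only
      rw [← hPa, Fin.val_last, List.take_length]
      exact h.β_eq
  · rw [hα]
    exact h.H_eq
  · rw [← Matrix.rank_transpose]
    exact hMr _ h.right.isUnit.2
  · rw [hα]
    exact exists_map_eq _ (h.left.smul_mem_range hadm h.L_eq h.S_eq h.β_eq h.P_eq h.Q_eq hC)
  · rw [hα]
    refine exists_map_eq _ fun i j => ?_
    have key := h.right
    rw [← eT] at key
    -- `W` is the transpose of the left inverse factor belonging to the elimination of `𝓜ᵀ` with
    -- swapped pivots.
    have := key.smul_mem_range (M := 𝓜ᵀ) (l := l.map Prod.swap) (a := Fin.val) (b := Fin.val)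
      (by rw [eT, eT']; exact hadm.transpose)
      (by rw [eT, eT', leftFactor_transpose, h.U_eq])
      (by rw [eT, eT', pivotWeights_transpose, h.S_eq])
      (by rw [eT, eT', lastPivot_transpose, h.β_eq])
      (by rw [map_fst_map_swap, h.Q_eq])
      (by rw [h.P_eq]; simp [Function.comp_def])
      (fun i j => hC j i) j i
    rwa [eT] at this
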